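/- Let $(X,\omega)$ be a Kähler manifold of complex dimension $n$, not necessarily compact. In local holomorphic coordinates write $\omega = i\,g_{\alpha\bar\beta}\,dz^\alpha\wedge d\bar z^\beta$, where $g$ is the associated Hermitian metric on $TX^{1,0}$; let $D$ be its Chern connection, with curvature $R\in\mathcal A^{1,1}(\operatorname{End}TX^{1,0})$. Let $K$ be a compact Lie group with Lie algebra $\mathfrak k$, acting smoothly on $X$ by isometries which preserve $\omega$. For $v\in\mathfrak k$ denote also by $v$ the vector field $x\mapsto \frac{d}{dt}\big|_{t=0}\exp(tv)\cdot x$ on $X$. Let $\mu:X\to\mathfrak k^*$ be a moment map: $\mu$ is smooth, it is $K$-equivariant for the coadjoint action, and $d\langle\mu,v\rangle=-\iota_v\omega$ for all $v\in\mathfrak k$. For a smooth real function $h$ on $X$ let $g^{-1}i\bar\partial\partial h\in\mathcal A^0(\operatorname{End}TX^{1,0})$ be the endomorphism given in local holomorphic coordinates by $i g^{\alpha\bar\beta}\,\partial_{\bar\beta}\partial_\gamma h\;dz^\gamma\otimes\frac{\partial}{\partial z^\alpha}$, and put $H_v := g^{-1}i\bar\partial\partial\langle\mu,v\rangle$ for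 $v\in\mathfrak k$. Then the connection $D$ is $K$-invariant, and $v\mapsto H_v$ is a moment map for the $K$-action on $TX^{1,0}$ with respect to $D$. That is, it defines a smooth $K$-equivariant section of $\operatorname{End}TX^{1,0}\otimes\mathfrak k^*$, and $$\iota_v R=-D H_v\qquad\text{for all }v\in\mathfrak k,$$ where on the right $D$ is the induced connection on $\operatorname{End}TX^{1,0}$. Consequently, for every integer $k\ge 0$ the equivariant Chern--Weil representative of the $k$-th equivariant Chern character of $TX^{1,0}$ determined by $D$ and this moment map is $$\widetilde{\operatorname{ch}}_{k,\mathrm{eq}}(X,\omega)(v)=\operatorname{tr}\left(\frac1{k!}\left(\frac{i}{2\pi}\,(R+H_v)\right)^k\right),\qquad v\in\mathfrak k .$$ In particular $\widetilde{\operatorname{ch}}_{k,\mathrm{eq}}(X,\omega)$ is an equivariant differential form (a $K$-equivariant polynomial map from $\mathfrak k$ to smooth complex differential forms on $X$), and it is equivariantly closed: $$d\big(\widetilde{\operatorname{ch}}_{k,\mathrm{eq}}(X,\omega)(v)\big)+\iota_v\big(\widetilde{\operatorname{ch}}_{k,\mathrm{eq}}(X,\omega)(v)\big)=0\qquad\text{for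 all }v\in\mathfrak k .$$ -/

import Mathlib

open scoped Manifold ContDiff

noncomputable section

namespace KahlerMoment

/-! ### Linear algebra of vector-valued alternating forms -/

/-- The model space `ℂⁿ`. In Mathlib the tangent space of a manifold modelled on `ℂⁿ` at a point `x`
is, by definition, `ℂⁿ`, identified with the tangent space through the preferred chart at `x`.
Throughout, a fibre of the tangent bundle of a complex manifold is written `Cn n`. As a real vector
space it is `T_x X`, its complex structure is `J = i •`, and as a complex vector space it is
`T_x X^{1,0}` (via `u ↦ u^{1,0} = (u - i J u) / 2`; the standard basis vector `e_α` corresponds to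
`∂/∂z^α`). -/
abbrev Cn (n : ℕ) := EuclideanSpace ℂ (Fin n)

/-- The fibre of `End TX^{1,0}`. -/
abbrev EndC (n : ℕ) := Cn n →L[ℂ] Cn n

/-- The (non-antisymmetrised) product of two forms with values in an algebra. -/
def prodMultilinear {E A : Type*} [NormedAddCommGroup E] [NormedSpace ℝ E]
    [NormedRing A] [NormedAlgebra ℝ A] {p q r : ℕ} (h : p + q = r)
    (a : E [⋀^Fin p]→L[ℝ] A) (b : E [⋀^Fin q]→L[ℝ] A) :
    ContinuousMultilinearMap ℝ (fun _ : Fin r => E) A where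
  toMultilinearMap :=
    ((LinearMap.mul' ℝ A).compMultilinearMap
      (a.toMultilinearMap.domCoprod b.toMultilinearMap)).domDomCongr
        (finSumFinEquiv.trans (finCongr h))
  cont := by
    show Continuous fun m : Fin r → E =>
      a (fun i => m (finCongr h (finSumFinEquiv (Sum.inl i)))) *
        b (fun j => m (finCongr h (finSumFinEquiv (Sum.inr j))))
    exact (a.cont.comp (continuous_pi fun i => continuous_apply _)).mul
      (b.cont.comp (continuous_pi fun j => continuous_apply _))

/-- The wedge product of alternating forms with values in an algebra (products taken in the given
order), normalised by shuffles, in degree `r = p + q`: for one-forms `(a ∧ b)(u, w) = a u * b w - a w * b u`. -/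
def wedge {E A : Type*} [NormedAddCommGroup E] [NormedSpace ℝ E]
    [NormedRing A] [NormedAlgebra ℝ A] {p q r : ℕ} (h : p + q = r)
    (a : E [⋀^Fin p]→L[ℝ] A) (b : E [⋀^Fin q]→L[ℝ] A) : E [⋀^Fin r]→L[ℝ] A :=
  ((p.factorial * q.factorial : ℝ)⁻¹) •
    ContinuousMultilinearMap.alternatization (prodMultilinear h a b)

/-- The product of two inhomogeneous forms; `a p` is the component of degree `p`. -/
def mulMixed {E A : Type*} [NormedAddCommGroup E] [NormedSpace ℝ E]
    [NormedRing A] [NormedAlgebra ℝ A]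
    (a b : (p : ℕ) → E [⋀^Fin p]→L[ℝ] A) : (p : ℕ) → E [⋀^Fin p]→L[ℝ] A :=
  fun p => ∑ ij : Finset.HasAntidiagonal.antidiagonal p,
    wedge (Finset.HasAntidiagonal.mem_antidiagonal.mp ij.2) (a ij.1.1) (b ij.1.2)

/-- Powers of an inhomogeneous form. -/
def powMixed {E A : Type*} [NormedAddCommGroup E] [NormedSpace ℝ E]
    [NormedRing A] [NormedAlgebra ℝ A]
    (a : (p : ℕ) → E [⋀^Fin p]→L[ℝ] A) : ℕ → (p : ℕ) → E [⋀^Fin p]→L[ℝ] A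
  | 0 => fun p => match p with
    | 0 => ContinuousAlternatingMap.constOfIsEmpty ℝ E (Fin 0) 1
    | _ + 1 => 0
  | k + 1 => mulMixed (powMixed a k) a

/-- The trace, as a real-linear map. -/
def traceCLM (n : ℕ) : EndC n →L[ℝ] ℂ :=
  LinearMap.toContinuousLinearMap
    (((LinearMap.trace ℂ (Cn n)).restrictScalars ℝ).comp
      ((ContinuousLinearMap.coeLM ℂ : EndC n →ₗ[ℂ] (Cn n →ₗ[ℂ] Cn n)).restrictScalars ℝ))

/-! ### Wirtinger operators on functions of `n` complex variables -/

/-- The `(1,0)`-part `∂f` of the differential: `u ↦ ½ (Df(u) - i Df(iu))`. -/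
def delOp {n : ℕ} {F : Type*} [NormedAddCommGroup F] [NormedSpace ℂ F]
    (f : Cn n → F) (z : Cn n) : Cn n →L[ℝ] F :=
  (1 / 2 : ℂ) • (fderiv ℝ f z
    - Complex.I • (fderiv ℝ f z).comp (Complex.I • ContinuousLinearMap.id ℝ (Cn n)))

/-- The `(0,1)`-part `∂̄f` of the differential: `u ↦ ½ (Df(u) + i Df(iu))`. -/
def delbarOp {n : ℕ} {F : Type*} [NormedAddCommGroup F] [NormedSpace ℂ F]
    (f : Cn n → F) (z : Cn n) : Cn n →L[ℝ] F :=
  (1 / 2 : ℂ) • (fderiv ℝ f z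
    + Complex.I • (fderiv ℝ f z).comp (Complex.I • ContinuousLinearMap.id ℝ (Cn n)))

/-! ### Fields on a complex manifold, and their expressions in charts -/

section Fields

variable {n : ℕ} {X : Type*} [TopologicalSpace X] [ChartedSpace (Cn n) X]

/-- The differential at `z` of the inverse of the preferred chart at `x₀`: the holomorphic
coordinate frame of the tangent bundle at the point of `X` with coordinates `z`. -/
def frame (x₀ : X) (z : Cn n) : EndC n :=
  mfderiv 𝓘(ℂ, Cn n) 𝓘(ℂ, Cn n) (chartAt (Cn n) x₀).symm z

/-- The differential of the preferred chart at `x₀`, at the point of `X` with coordinates `z`. -/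
def coframe (x₀ : X) (z : Cn n) : EndC n :=
  mfderiv 𝓘(ℂ, Cn n) 𝓘(ℂ, Cn n) (chartAt (Cn n) x₀) ((chartAt (Cn n) x₀).symm z)

/-- A (not necessarily smooth) `F`-valued `p`-form in the preferred chart at `x₀`. -/
def formInChart {p : ℕ} {F : Type*} [NormedAddCommGroup F] [NormedSpace ℝ F]
    (a : X → Cn n [⋀^Fin p]→L[ℝ] F) (x₀ : X) (z : Cn n) : Cn n [⋀^Fin p]→L[ℝ] F :=
  (a ((chartAt (Cn n) x₀).symm z)).compContinuousLinearMap ((frame x₀ z).restrictScalars ℝ)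

/-- A section of the tangent bundle in the preferred chart at `x₀`. -/
def vectorInChart (s : X → Cn n) (x₀ : X) (z : Cn n) : Cn n :=
  coframe x₀ z (s ((chartAt (Cn n) x₀).symm z))

/-- A section of `End TX^{1,0}` in the preferred chart at `x₀`. -/
def endInChart (σ : X → EndC n) (x₀ : X) (z : Cn n) : EndC n :=
  coframe x₀ z * σ ((chartAt (Cn n) x₀).symm z) * frame x₀ z

def IsSmoothForm {p : ℕ} {F : Type*} [NormedAddCommGroup F] [NormedSpace ℝ F]
    (a : X → Cn n [⋀^Fin p]→L[ℝ] F) : Prop :=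
  ∀ x₀ : X, ContDiffOn ℝ ∞ (formInChart a x₀) (chartAt (Cn n) x₀).target

def IsSmoothVector (s : X → Cn n) : Prop :=
  ∀ x₀ : X, ContDiffOn ℝ ∞ (vectorInChart s x₀) (chartAt (Cn n) x₀).target

def IsSmoothEnd (σ : X → EndC n) : Prop :=
  ∀ x₀ : X, ContDiffOn ℝ ∞ (endInChart σ x₀) (chartAt (Cn n) x₀).target

/-- The exterior derivative, computed at `x` in the preferred chart at `x` (which is the chart that
identifies the tangent space at `x` with `Cn n`). -/
def extD {p : ℕ} {F : Type*} [NormedAddCommGroup F] [NormedSpace ℝ F]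
    (a : X → Cn n [⋀^Fin p]→L[ℝ] F) (x : X) : Cn n [⋀^Fin (p + 1)]→L[ℝ] F :=
  extDeriv (formInChart a x) (chartAt (Cn n) x x)

/-! ### Connections on `TX^{1,0}` -/

/-- A connection on `TX^{1,0}` is given by its local connection forms: `Θ x₀ z u` is the value on
the vector `u` of the connection form, at the point with coordinates `z`, with respect to the
coordinate frame of the preferred chart at `x₀`; that is `D = d + Θ x₀` in this frame.
This is the covariant derivative `(D_u s)(x)`. -/
def covDeriv (Θ : X → Cn n → Cn n →L[ℝ] EndC n) (s : X → Cn n) (x : X) (u : Cn n) : Cn n :=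
  fderiv ℝ (vectorInChart s x) (chartAt (Cn n) x x) u + Θ x (chartAt (Cn n) x x) u (s x)

/-- The induced covariant derivative on sections of `End TX^{1,0}`: `Dσ = dσ + [Θ, σ]`. -/
def covDerivEnd (Θ : X → Cn n → Cn n →L[ℝ] EndC n) (σ : X → EndC n) (x : X) (u : Cn n) : EndC n :=
  fderiv ℝ (endInChart σ x) (chartAt (Cn n) x x) u
    + (Θ x (chartAt (Cn n) x x) u * σ x - σ x * Θ x (chartAt (Cn n) x x) u)

/-- An `EndC n`-valued linear map, as an alternating form of degree one. -/
def oneForm (θ : Cn n →L[ℝ] EndC n) : Cn n [⋀^Fin 1]→L[ℝ] EndC n :=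
  ContinuousAlternatingMap.ofSubsingleton ℝ (Cn n) (EndC n) (0 : Fin 1) θ

/-- The curvature `dΘ + Θ ∧ Θ`, a two-form with values in `End TX^{1,0}`. -/
def curvature (Θ : X → Cn n → Cn n →L[ℝ] EndC n) (x : X) : Cn n [⋀^Fin 2]→L[ℝ] EndC n :=
  extDeriv (fun z => oneForm (Θ x z)) (chartAt (Cn n) x x)
    + wedge rfl (oneForm (Θ x (chartAt (Cn n) x x))) (oneForm (Θ x (chartAt (Cn n) x x)))

/-! ### Kähler metrics -/

/-- `Ω` is (the Kähler form of) a Kähler metric: a smooth closed real two-form of type `(1,1)` with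
`Ω(u, Ju) > 0` for `u ≠ 0`. -/
structure IsKahlerForm (Ω : X → Cn n [⋀^Fin 2]→L[ℝ] ℝ) : Prop where
  smooth : IsSmoothForm Ω
  closed : ∀ x, extD Ω x = 0
  type_one_one : ∀ x (u w : Cn n), Ω x ![Complex.I • u, Complex.I • w] = Ω x ![u, w]
  pos : ∀ x (u : Cn n), u ≠ 0 → 0 < Ω x ![u, Complex.I • u]

/-- The Hermitian form `g(s, t) = g_{αβ̄} s^α t̄^β` with `Ω = i g_{αβ̄} dz^α ∧ dz̄^β`. -/
def herm (a : Cn n [⋀^Fin 2]→L[ℝ] ℝ) (s t : Cn n) : ℂ :=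
  (1 / 2 : ℂ) * ((a ![s, Complex.I • t] : ℂ) - Complex.I * (a ![s, t] : ℂ))

/-- The operator with matrix `(g_{γβ̄})_{β,γ}` (row `β`, column `γ`), in the chart at `x₀`. -/
def gram (Ω : X → Cn n [⋀^Fin 2]→L[ℝ] ℝ) (x₀ : X) (z : Cn n) : EndC n :=
  Matrix.toEuclideanCLM (𝕜 := ℂ) (Matrix.of fun β γ : Fin n =>
    herm (formInChart Ω x₀ z) (EuclideanSpace.single γ 1) (EuclideanSpace.single β 1))

/-- The Chern connection of the Hermitian metric `g` on `TX^{1,0}`, which in the holomorphic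
coordinate frame has connection form `Θ^α_γ = g^{αβ̄} ∂g_{γβ̄}`. -/
def chernConnection (Ω : X → Cn n [⋀^Fin 2]→L[ℝ] ℝ) (x₀ : X) (z : Cn n) : Cn n →L[ℝ] EndC n :=
  (ContinuousLinearMap.mul ℝ (EndC n) (Ring.inverse (gram Ω x₀ z))).comp (delOp (gram Ω x₀) z)

/-- The operator with matrix `(∂_β̄ ∂_γ h)_{β,γ}` (row `β`, column `γ`), in the chart at `x₀`. -/
def complexHessian (h : X → ℝ) (x₀ : X) (z : Cn n) : EndC n :=
  Matrix.toEuclideanCLM (𝕜 := ℂ) (Matrix.of fun β γ : Fin n =>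
    delbarOp (fun z' => delOp (fun z'' => ((h ((chartAt (Cn n) x₀).symm z'') : ℝ) : ℂ)) z'
      (EuclideanSpace.single γ 1)) z (EuclideanSpace.single β 1))

/-- The section `g⁻¹ i∂̄∂h` of `End TX^{1,0}`, that is `i g^{αβ̄} ∂_β̄ ∂_γ h dz^γ ⊗ ∂/∂z^α`. -/
def metricHessian (Ω : X → Cn n [⋀^Fin 2]→L[ℝ] ℝ) (h : X → ℝ) (x : X) : EndC n :=
  Complex.I • (Ring.inverse (gram Ω x (chartAt (Cn n) x x))
    * complexHessian h x (chartAt (Cn n) x x))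

/-- The inhomogeneous `End TX^{1,0}`-valued form `R + H`, with `R` a two-form and `H` a section. -/
def curvPlus (R : X → Cn n [⋀^Fin 2]→L[ℝ] EndC n) (H : X → EndC n) (x : X) :
    (p : ℕ) → Cn n [⋀^Fin p]→L[ℝ] EndC n
  | 0 => ContinuousAlternatingMap.constOfIsEmpty ℝ (Cn n) (Fin 0) (H x)
  | 2 => R x
  | _ => 0

end Fields

/-! ### Lie group actions and equivariant differential forms -/

section Action

variable {EK : Type*} [NormedAddCommGroup EK] [NormedSpace ℝ EK]
  (K : Type*) [TopologicalSpace K] [ChartedSpace EK K] [Group K]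
  {n : ℕ} {X : Type*} [TopologicalSpace X] [ChartedSpace (Cn n) X] [MulAction K X]

/-- The Lie algebra `𝔨` of `K`. -/
abbrev LieAlg := GroupLieAlgebra 𝓘(ℝ, EK) K

variable {K}

/-- The adjoint action of `K` on `𝔨`. -/
def Ad (k : K) : LieAlg (EK := EK) K →L[ℝ] LieAlg (EK := EK) K :=
  mfderiv 𝓘(ℝ, EK) 𝓘(ℝ, EK) (fun g : K => k * g * k⁻¹) 1

/-- The differential at `x` of the action of `k`. -/
def actD (k : K) (x : X) : Cn n →L[ℝ] Cn n :=
  mfderiv 𝓘(ℝ, Cn n) 𝓘(ℝ, Cn n) (fun y : X => k • y) x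

/-- The vector field on `X` generated by `v ∈ 𝔨`: the derivative of `exp(tv) • x` at `t = 0`. -/
def fund (v : LieAlg (EK := EK) K) (x : X) : Cn n :=
  (mfderiv 𝓘(ℝ, EK) 𝓘(ℝ, Cn n) (fun k : K => k • x) 1 : EK →L[ℝ] Cn n) v

/-- `μ : X → 𝔨*` is a moment map for the action of `K` on `(X, Ω)`. -/
structure IsMomentMap (Ω : X → Cn n [⋀^Fin 2]→L[ℝ] ℝ)
    (μ : X → Module.Dual ℝ (LieAlg (EK := EK) K)) : Prop where
  smooth : ∀ v, ContMDiff 𝓘(ℝ, Cn n) 𝓘(ℝ, ℝ) ∞ (fun x => μ x v)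
  equivariant : ∀ (k : K) x v, μ (k • x) (Ad k v) = μ x v
  hamiltonian : ∀ v x (u : Cn n),
    (mfderiv 𝓘(ℝ, Cn n) 𝓘(ℝ, ℝ) (fun y => μ y v) x : Cn n →L[ℝ] ℝ) u = -Ω x ![fund v x, u]

/-- The connection `Θ` on `TX^{1,0}` is `K`-invariant: `D (k · s) = k · D s` for every smooth
section `s`, where `(k · s)(y) = dk (s (k⁻¹ y))`. -/
def IsInvariantConnection (K : Type*) [Group K] [MulAction K X]
    (Θ : X → Cn n → Cn n →L[ℝ] EndC n) : Prop :=
  ∀ (k : K) (s : X → Cn n), IsSmoothVector s → ∀ (x : X) (u : Cn n),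
    covDeriv Θ (fun y => actD k (k⁻¹ • y) (s (k⁻¹ • y))) (k • x) (actD k x u)
      = actD k x (covDeriv Θ s x u)

/-- `σ`, given by `v ↦ ⟨σ, v⟩`, is a moment map for the action of `K` on the complex vector bundle
`TX^{1,0}` with respect to the connection `Θ`: a `K`-equivariant smooth section of
`End TX^{1,0} ⊗ 𝔨*` with `ι_v F = - D ⟨σ, v⟩`, where `F` is the curvature. -/
structure IsBundleMomentMap (Θ : X → Cn n → Cn n →L[ℝ] EndC n)
    (σ : LieAlg (EK := EK) K → X → EndC n) : Prop where
  map_add : ∀ v w x, σ (v + w) x = σ v x + σ w x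
  map_smul : ∀ (c : ℝ) v x, σ (c • v) x = (c : ℂ) • σ v x
  smooth : ∀ v, IsSmoothEnd (σ v)
  equivariant : ∀ (k : K) v x (u : Cn n), σ (Ad k v) (k • x) (actD k x u) = actD k x (σ v x u)
  moment : ∀ v x (u : Cn n), curvature Θ x ![fund v x, u] = -covDerivEnd Θ (σ v) x u

/-- A map from `𝔨` to a real vector space is polynomial if it is a finite sum of homogeneous terms
`v ↦ m (v, …, v)` with `m` multilinear. -/
def IsPolynomialMap {V W : Type*} [AddCommGroup V] [Module ℝ V] [AddCommGroup W] [Module ℝ W]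
    (f : V → W) : Prop :=
  ∃ (d : ℕ) (m : (j : ℕ) → MultilinearMap ℝ (fun _ : Fin j => V) W),
    ∀ v, f v = ∑ j ∈ Finset.range (d + 1), m j (fun _ => v)

/-- `α` is an equivariant differential form (with complex coefficients): a `K`-equivariant
polynomial map from `𝔨` to smooth forms; `α v p` is the component of degree `p` of `α v`. -/
structure IsEquivariantForm
    (α : LieAlg (EK := EK) K → (p : ℕ) → X → Cn n [⋀^Fin p]→L[ℝ] ℂ) : Prop where
  smooth : ∀ v p, IsSmoothForm (α v p)
  polynomial : IsPolynomialMap α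
  equivariant : ∀ (k : K) v p x, (α (Ad k v) p (k • x)).compContinuousLinearMap (actD k x) = α v p x

/-- The equivariant differential `(d_eq α)(v) = d (α v) + ι_v (α v)`, by degrees. -/
def eqD (α : LieAlg (EK := EK) K → (p : ℕ) → X → Cn n [⋀^Fin p]→L[ℝ] ℂ)
    (v : LieAlg (EK := EK) K) : (p : ℕ) → (x : X) → Cn n [⋀^Fin p]→L[ℝ] ℂ
  | 0 => fun x => (α v 1 x).curryLeft (fund v x)
  | p + 1 => fun x => extD (α v p) x + (α v (p + 2) x).curryLeft (fund v x)

/-- The form `tr ((1/k!) ((i/2π) (F + ⟨σ, v⟩))^k)`, where `F` is the curvature of `Θ`. -/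
def eqChernCharacter (Θ : X → Cn n → Cn n →L[ℝ] EndC n)
    (σ : LieAlg (EK := EK) K → X → EndC n) (k : ℕ) (v : LieAlg (EK := EK) K) (p : ℕ) (x : X) :
    Cn n [⋀^Fin p]→L[ℝ] ℂ :=
  (traceCLM n).compContinuousAlternatingMap
    ((1 / (k.factorial : ℂ)) •
      powMixed (fun q => (Complex.I / (2 * Real.pi)) • curvPlus (curvature Θ) (σ v) x q) k p)

end Action

end KahlerMoment

end

noncomputable section

namespace KahlerMoment

/-! ### Signed sums over permutations -/

section AltSum

variable {E A : Type*} [AddCommGroup A]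

/-! Work in a holomorphic chart, with G the Gram operator of the metric, Θ = G⁻¹∂G the Chern
connection form, h = ⟨μ,v⟩, and V the vector field generated by v. The Hamilton equation reads
g(V,t) = i ∂̄_t h. Taking the (1,0)-derivative of it, and using that the Chern connection of a
Kähler metric is torsion free (`chernOf_gramOf_symm`), gives H = Θ(V) + DV: the metric Hessian is
the covariant derivative of V (`LocalMoment.hessian_eq`).

The moment equation then follows by comparing types. Put E(u) = R(V,u) + D_u H. After inserting the
formula for H, E(u) becomes the Lie derivative of the connection along V, which is complex-linear in
u because V is holomorphic and Θ has type (1,0) (`curvOf_add_covariant`). On the other hand R(V,u)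
is g-skew-adjoint because D is unitary, and D_u H is g-skew-adjoint because H is. A form which is
both complex-linear and skew-adjoint is zero (`eq_zero_of_skew`, `curvOf_chernOf_moment`).

Holomorphy of V comes from the action: maps preserving both the form and the metric commute with the
complex structure (`isKahlerMap_smul`), and V is an infinitesimal version of such maps
(`exists_holoOn_fund`). Passing from charts to the manifold and acting by K are the same problem:
both are holomorphic maps between chart domains which preserve the Kähler form (`IsKahlerChartMap`).
Naturality of Θ, of its curvature and of the metric Hessian under such maps gives the tensoriality
of R and H, the invariance of D and the equivariance of H.

Equivariant closedness is checked one point at a time (`eqDAt_powMixed_curvOf`). A gauge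
transformation makes the connection form vanish at the point. There the Bianchi identity says dR = 0
and the moment equation says dH + ι_v R = 0, so R + H is closed for d + ι_v at that point. This
operator is a derivation on even forms (`eqDAt_mulMixed`, resting on the antiderivation rules for
the wedge product), so the powers are closed too, and the trace does not see the gauge.
Polynomiality in v holds because R + H_v is affine in v. -/

/-- The antisymmetrisation of a function of `r` vectors. -/
def altSum {r : ℕ} (m : (Fin r → E) → A) (w : Fin r → E) : A :=
  ∑ σ : Equiv.Perm (Fin r), Equiv.Perm.sign σ • m (w ∘ σ)

/-- A permutation of `Fin (r + 1)` is determined by the image of `0` and a permutation of `Fin r`. -/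
def consPerm {r : ℕ} (x : Fin (r + 1) × Equiv.Perm (Fin r)) : Equiv.Perm (Fin (r + 1)) :=
  (x.1.cycleRange)⁻¹ * Equiv.Perm.decomposeFin.symm (0, x.2)

theorem consPerm_zero {r : ℕ} (x : Fin (r + 1) × Equiv.Perm (Fin r)) : consPerm x 0 = x.1 := by
  simp [consPerm, Equiv.Perm.inv_def]

theorem bijective_consPerm {r : ℕ} : Function.Bijective (consPerm (r := r)) := by
  rw [Fintype.bijective_iff_injective_and_card]
  constructor
  · rintro ⟨i, τ⟩ ⟨j, ρ⟩ h
    have h0 := congrArg (fun σ => σ 0) h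
    simp only [consPerm_zero] at h0
    subst h0
    simpa [consPerm] using h
  · simp [Fintype.card_perm, Nat.factorial_succ]

theorem sign_consPerm {r : ℕ} (x : Fin (r + 1) × Equiv.Perm (Fin r)) :
    Equiv.Perm.sign (consPerm x) = (-1) ^ (x.1 : ℕ) * Equiv.Perm.sign x.2 := by
  simp [consPerm, Equiv.Perm.decomposeFin.symm_sign, Fin.sign_cycleRange]

theorem cons_comp_decomposeFin {r : ℕ} (v : E) (w : Fin r → E) (τ : Equiv.Perm (Fin r)) :
    (Fin.cons v w : Fin (r + 1) → E) ∘ Equiv.Perm.decomposeFin.symm (0, τ)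
      = Fin.cons v (w ∘ τ) := by
  funext k
  refine Fin.cases ?_ (fun k => ?_) k <;> simp

theorem comp_cycleRange_inv {r : ℕ} (w : Fin (r + 1) → E) (i : Fin (r + 1)) :
    w ∘ ⇑((i.cycleRange)⁻¹) = Fin.cons (w i) (i.removeNth w) := by
  have h := Fin.cons_comp_cycleRange (w i) (i.removeNth w) i
  rw [Fin.insertNth_self_removeNth] at h
  conv_lhs => rw [← h]
  funext k
  rw [Equiv.Perm.inv_def]
  exact congrArg _ (Equiv.apply_symm_apply _ k)

theorem comp_consPerm {r : ℕ} (w : Fin (r + 1) → E) (x : Fin (r + 1) × Equiv.Perm (Fin r)) :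
    w ∘ consPerm x = Fin.cons (w x.1) (x.1.removeNth w ∘ x.2) := by
  rw [← cons_comp_decomposeFin, ← comp_cycleRange_inv]
  rfl

theorem cons_comp_consPerm_inv {r : ℕ} (v : E) (w : Fin r → E)
    (x : Fin (r + 1) × Equiv.Perm (Fin r)) :
    (Fin.cons v w : Fin (r + 1) → E) ∘ ⇑((consPerm x)⁻¹) = x.1.insertNth v (w ∘ ⇑((x.2)⁻¹)) := by
  rw [← Fin.cons_comp_cycleRange, ← cons_comp_decomposeFin]
  funext k
  simp only [Function.comp_apply, consPerm, mul_inv_rev, inv_inv, Equiv.Perm.coe_mul]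
  congr 1
  rw [Equiv.Perm.inv_eq_iff_eq]
  generalize x.1.cycleRange k = j
  refine Fin.cases ?_ (fun j => ?_) j <;> simp

theorem sign_pow_smul (k : ℕ) (s : ℤˣ) (a : A) :
    (((-1) ^ k * s : ℤˣ)) • a = ((-1 : ℤ) ^ k) • (s • a) := by
  rw [mul_smul]
  simp [Units.smul_def]

/-- Permutations are grouped by the image of `0`, that is by the vector which lands in the first
slot of `m`. This is the shape of the alternating sum defining the exterior derivative. -/
theorem altSum_eq_sum_removeNth {r : ℕ} (m : (Fin (r + 1) → E) → A) (w : Fin (r + 1) → E) :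
    altSum m w = ∑ i : Fin (r + 1), ((-1 : ℤ) ^ (i : ℕ)) •
      altSum (fun w' => m (Fin.cons (w i) w')) (i.removeNth w) := by
  unfold altSum
  rw [← (Equiv.ofBijective _ bijective_consPerm).sum_comp, Fintype.sum_prod_type]
  refine Finset.sum_congr rfl fun i _ => ?_
  rw [Finset.smul_sum]
  refine Finset.sum_congr rfl fun τ _ => ?_
  simp only [Equiv.ofBijective_apply, sign_consPerm, comp_consPerm, sign_pow_smul]

/-- The companion expansion groups the inverse permutations instead, that is by the slot of `m`
which receives `v`. It is what computes an interior product. -/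
theorem altSum_cons {r : ℕ} (m : (Fin (r + 1) → E) → A) (v : E) (w : Fin r → E) :
    altSum m (Fin.cons v w) = ∑ i : Fin (r + 1), ((-1 : ℤ) ^ (i : ℕ)) •
      altSum (fun w' => m (i.insertNth v w')) w := by
  unfold altSum
  rw [← Equiv.sum_comp (Equiv.inv (Equiv.Perm (Fin (r + 1)))),
    ← (Equiv.ofBijective _ bijective_consPerm).sum_comp, Fintype.sum_prod_type]
  refine Finset.sum_congr rfl fun i _ => ?_
  rw [Finset.smul_sum, ← Equiv.sum_comp (Equiv.inv (Equiv.Perm (Fin r)))]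
  refine Finset.sum_congr rfl fun τ _ => ?_
  simp only [Equiv.ofBijective_apply, Equiv.inv_apply, Equiv.Perm.sign_inv, sign_consPerm,
    cons_comp_consPerm_inv, sign_pow_smul, inv_inv]

theorem altSum_comp_perm {r : ℕ} (m : (Fin r → E) → A) (ρ : Equiv.Perm (Fin r)) (w : Fin r → E) :
    altSum (fun w' => Equiv.Perm.sign ρ • m (w' ∘ ρ)) w = altSum m w := by
  unfold altSum
  refine Eq.trans ?_ (Equiv.sum_comp (Equiv.mulRight ρ) _)
  refine Finset.sum_congr rfl fun σ _ => ?_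
  simp only [Equiv.coe_mulRight, Equiv.Perm.sign_mul, mul_smul]
  rfl

/-- Moving the `i`-th vector to the front is a cycle of sign `(-1)^i`, and an antisymmetrisation
absorbs it. Hence all summands of an alternating sum contribute equally once antisymmetrised again.
-/
theorem altSum_removeNth {r : ℕ} (m : (Fin (r + 1) → E) → A) (i : Fin (r + 1))
    (w : Fin (r + 1) → E) :
    altSum (fun w' => ((-1 : ℤ) ^ (i : ℕ)) • m (Fin.cons (w' i) (i.removeNth w'))) w
      = altSum m w := by
  rw [← altSum_comp_perm m (i.cycleRange)⁻¹ w]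
  refine congrFun (congrArg altSum (funext fun w' => ?_)) w
  rw [comp_cycleRange_inv, Equiv.Perm.sign_inv, Fin.sign_cycleRange]
  simp [Units.smul_def]

theorem altSum_zsmul {r : ℕ} (c : ℤ) (m : (Fin r → E) → A) (w : Fin r → E) :
    altSum (fun w' => c • m w') w = c • altSum m w := by
  simp only [altSum, Finset.smul_sum]
  exact Finset.sum_congr rfl fun σ _ => smul_comm _ _ _

theorem altSum_sum {r : ℕ} {ι : Type*} (s : Finset ι) (m : ι → (Fin r → E) → A) (w : Fin r → E) :
    altSum (fun w' => ∑ i ∈ s, m i w') w = ∑ i ∈ s, altSum (m i) w := by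
  simp only [altSum, Finset.smul_sum]
  exact Finset.sum_comm

theorem altSum_congr {r : ℕ} {m m' : (Fin r → E) → A} (h : ∀ w, m w = m' w) (w : Fin r → E) :
    altSum m w = altSum m' w := by
  rw [funext h]

/-- Describing insertion through the numerical values of indices reduces the block identities below
to arithmetic, without transport along equalities of degrees. -/
theorem insertNth_eq_ite (r : ℕ) (i : Fin (r + 1)) (v : E) (w : Fin r → E) (k : Fin (r + 1)) :
    (i.insertNth v w : Fin (r + 1) → E) k =
      if h : k.val < i.val then w ⟨k, by omega⟩
      else if h' : k.val = i.val then v else w ⟨k - 1, by omega⟩ := by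
  split_ifs with h h'
  · have : k = i.succAbove ⟨k, by omega⟩ := by
      rw [Fin.succAbove_of_castSucc_lt _ _ (by rw [Fin.lt_def]; exact h)]; rfl
    conv_lhs => rw [this]
    rw [Fin.insertNth_apply_succAbove]
  · rw [Fin.ext h', Fin.insertNth_apply_same]
  · have : k = i.succAbove ⟨k - 1, by omega⟩ := by
      rw [Fin.succAbove_of_le_castSucc _ _ (by rw [Fin.le_def]; simp only [Fin.val_castSucc]; omega)]
      exact Fin.ext (by simp only [Fin.val_succ]; omega)
    conv_lhs => rw [this]
    rw [Fin.insertNth_apply_succAbove]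

end AltSum

/-! ### The wedge product -/

section Wedge

/-! ### Splitting a tuple of vectors into two blocks. -/

section Blocks

variable {E : Type*} {p q r : ℕ}

/-- The first `p` of `r = p + q` vectors. -/
def firstVec (h : p + q = r) (w : Fin r → E) : Fin p → E := fun i => w (Fin.cast h (Fin.castAdd q i))

/-- The last `q` of `r = p + q` vectors. -/
def lastVec (h : p + q = r) (w : Fin r → E) : Fin q → E := fun i => w (Fin.cast h (Fin.natAdd p i))

theorem sum_fin_split {M : Type*} [AddCommMonoid M] (h : p + q = r) (f : Fin r → M) :
    ∑ i, f i = ∑ i : Fin p, f (Fin.cast h (Fin.castAdd q i))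
      + ∑ j : Fin q, f (Fin.cast h (Fin.natAdd p j)) := by
  subst h
  exact Fin.sum_univ_add f

theorem firstVec_insertNth_castAdd (h : (p + 1) + q = r + 1) (h' : p + q = r) (i : Fin (p + 1))
    (v : E) (w : Fin r → E) :
    firstVec h ((Fin.cast h (Fin.castAdd q i)).insertNth v w) = i.insertNth v (firstVec h' w) := by
  funext k
  simp only [firstVec, insertNth_eq_ite, Fin.val_cast, Fin.val_castAdd]
  split_ifs <;> rfl

theorem lastVec_insertNth_castAdd (h : (p + 1) + q = r + 1) (h' : p + q = r) (i : Fin (p + 1))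
    (v : E) (w : Fin r → E) :
    lastVec h ((Fin.cast h (Fin.castAdd q i)).insertNth v w) = lastVec h' w := by
  funext k
  simp only [lastVec, insertNth_eq_ite, Fin.val_cast, Fin.val_castAdd, Fin.val_natAdd]
  rw [dif_neg (by omega), dif_neg (by omega)]
  exact congrArg w (Fin.ext (by simp only [Fin.val_cast, Fin.val_natAdd]; omega))

theorem firstVec_insertNth_natAdd (h : p + (q + 1) = r + 1) (h' : p + q = r) (j : Fin (q + 1))
    (v : E) (w : Fin r → E) :
    firstVec h ((Fin.cast h (Fin.natAdd p j)).insertNth v w) = firstVec h' w := by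
  funext k
  simp only [firstVec, insertNth_eq_ite, Fin.val_cast, Fin.val_castAdd, Fin.val_natAdd]
  rw [dif_pos (by omega)]
  rfl

theorem lastVec_insertNth_natAdd (h : p + (q + 1) = r + 1) (h' : p + q = r) (j : Fin (q + 1))
    (v : E) (w : Fin r → E) :
    lastVec h ((Fin.cast h (Fin.natAdd p j)).insertNth v w) = j.insertNth v (lastVec h' w) := by
  funext k
  simp only [lastVec, insertNth_eq_ite, Fin.val_cast, Fin.val_natAdd]
  by_cases h1 : (k : ℕ) < j
  · rw [dif_pos (by omega), dif_pos h1]; rfl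
  · by_cases h2 : (k : ℕ) = j
    · rw [dif_neg (by omega), dif_pos (by omega), dif_neg h1, dif_pos h2]
    · rw [dif_neg (by omega), dif_neg (by omega), dif_neg h1, dif_neg h2]
      exact congrArg w (Fin.ext (by simp only [Fin.val_cast, Fin.val_natAdd]; omega))

theorem removeNth_firstVec (h : (p + 1) + q = r + 1) (h' : p + q = r) (i : Fin (p + 1))
    (w : Fin (r + 1) → E) : i.removeNth (firstVec h w)
      = firstVec h' ((Fin.cast h (Fin.castAdd q i)).removeNth w) := by
  conv_lhs => rw [← Fin.insertNth_self_removeNth (Fin.cast h (Fin.castAdd q i)) w]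
  rw [firstVec_insertNth_castAdd h h', Fin.removeNth_insertNth]

theorem lastVec_removeNth (h : (p + 1) + q = r + 1) (h' : p + q = r) (i : Fin (p + 1))
    (w : Fin (r + 1) → E) :
    lastVec h w = lastVec h' ((Fin.cast h (Fin.castAdd q i)).removeNth w) := by
  conv_lhs => rw [← Fin.insertNth_self_removeNth (Fin.cast h (Fin.castAdd q i)) w]
  rw [lastVec_insertNth_castAdd h h']

theorem firstVec_removeNth (h : p + (q + 1) = r + 1) (h' : p + q = r) (j : Fin (q + 1))
    (w : Fin (r + 1) → E) :
    firstVec h w = firstVec h' ((Fin.cast h (Fin.natAdd p j)).removeNth w) := by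
  conv_lhs => rw [← Fin.insertNth_self_removeNth (Fin.cast h (Fin.natAdd p j)) w]
  rw [firstVec_insertNth_natAdd h h']

theorem removeNth_lastVec (h : p + (q + 1) = r + 1) (h' : p + q = r) (j : Fin (q + 1))
    (w : Fin (r + 1) → E) : j.removeNth (lastVec h w)
      = lastVec h' ((Fin.cast h (Fin.natAdd p j)).removeNth w) := by
  conv_lhs => rw [← Fin.insertNth_self_removeNth (Fin.cast h (Fin.natAdd p j)) w]
  rw [lastVec_insertNth_natAdd h h', Fin.removeNth_insertNth]

end Blocks

variable {E A : Type*} [NormedAddCommGroup E] [NormedSpace ℝ E]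
  [NormedRing A] [NormedAlgebra ℝ A] {p q r : ℕ}

theorem wedge_apply (h : p + q = r) (a : E [⋀^Fin p]→L[ℝ] A) (b : E [⋀^Fin q]→L[ℝ] A)
    (w : Fin r → E) :
    wedge h a b w = ((p.factorial * q.factorial : ℝ)⁻¹) •
      altSum (fun w' => a (firstVec h w') * b (lastVec h w')) w := by
  rw [wedge, ContinuousAlternatingMap.smul_apply,
    ContinuousMultilinearMap.alternatization_apply_apply]
  rfl

theorem factorial_inv_smul_left {M : Type*} [AddCommGroup M] [Module ℝ M] (p q : ℕ) (x : M) :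
    (((p + 1).factorial * q.factorial : ℝ)⁻¹) • ((p + 1 : ℕ) • x)
      = ((p.factorial * q.factorial : ℝ)⁻¹) • x := by
  rw [← Nat.cast_smul_eq_nsmul ℝ, smul_smul]
  congr 1
  have := Nat.factorial_ne_zero p
  have := Nat.factorial_ne_zero q
  rw [Nat.factorial_succ]
  push_cast
  field_simp

theorem factorial_inv_smul_right {M : Type*} [AddCommGroup M] [Module ℝ M] (p q : ℕ) (x : M) :
    ((p.factorial * (q + 1).factorial : ℝ)⁻¹) • ((q + 1 : ℕ) • x)
      = ((p.factorial * q.factorial : ℝ)⁻¹) • x := by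
  rw [mul_comm, factorial_inv_smul_left, mul_comm]

/-- Since `a` is alternating, each of the `p + 1` positions in the first block gives the same term.
Their number turns the normalisation `1/(p+1)!` into `1/p!`. -/
theorem sum_castAdd_wedge (h : (p + 1) + q = r + 1) (h' : p + q = r)
    (a : E [⋀^Fin (p + 1)]→L[ℝ] A) (b : E [⋀^Fin q]→L[ℝ] A) (v : E) (w : Fin r → E) :
    (((p + 1).factorial * q.factorial : ℝ)⁻¹) • ∑ i : Fin (p + 1),
      ((-1 : ℤ) ^ (Fin.cast h (Fin.castAdd q i) : ℕ)) • altSum (fun w' =>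
        a (firstVec h ((Fin.cast h (Fin.castAdd q i)).insertNth v w')) *
        b (lastVec h ((Fin.cast h (Fin.castAdd q i)).insertNth v w'))) w
      = wedge h' (a.curryLeft v) b w := by
  rw [wedge_apply, Finset.sum_congr rfl (g := fun _ =>
    altSum (fun w' => a.curryLeft v (firstVec h' w') * b (lastVec h' w')) w) fun i _ => ?_]
  · rw [Finset.sum_const, Finset.card_univ, Fintype.card_fin, factorial_inv_smul_left]
  · rw [← altSum_zsmul]
    refine altSum_congr (fun w' => ?_) w
    rw [firstVec_insertNth_castAdd h h', lastVec_insertNth_castAdd h h', ← smul_mul_assoc,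
      Fin.val_cast, Fin.val_castAdd, a.neg_one_pow_smul_map_insertNth]
    rfl

/-- The same count in the second block. The sign `(-1)^p` remains because the `j`-th slot of that
block is the slot `p + j` of the whole tuple. -/
theorem sum_natAdd_wedge (h : p + (q + 1) = r + 1) (h' : p + q = r)
    (a : E [⋀^Fin p]→L[ℝ] A) (b : E [⋀^Fin (q + 1)]→L[ℝ] A) (v : E) (w : Fin r → E) :
    ((p.factorial * (q + 1).factorial : ℝ)⁻¹) • ∑ j : Fin (q + 1),
      ((-1 : ℤ) ^ (Fin.cast h (Fin.natAdd p j) : ℕ)) • altSum (fun w' =>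
        a (firstVec h ((Fin.cast h (Fin.natAdd p j)).insertNth v w')) *
        b (lastVec h ((Fin.cast h (Fin.natAdd p j)).insertNth v w'))) w
      = ((-1 : ℤ) ^ p) • wedge h' a (b.curryLeft v) w := by
  rw [wedge_apply, smul_comm, Finset.sum_congr rfl (g := fun _ =>
    ((-1 : ℤ) ^ p) • altSum (fun w' => a (firstVec h' w') * b.curryLeft v (lastVec h' w')) w)
    fun j _ => ?_]
  · rw [Finset.sum_const, Finset.card_univ, Fintype.card_fin, factorial_inv_smul_right]
  · rw [← altSum_zsmul, ← altSum_zsmul]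
    refine altSum_congr (fun w' => ?_) w
    rw [firstVec_insertNth_natAdd h h', lastVec_insertNth_natAdd h h', Fin.val_cast,
      Fin.val_natAdd, pow_add, mul_smul, ← mul_smul_comm, b.neg_one_pow_smul_map_insertNth]
    rfl

theorem wedge_curryLeft (h : p + q = r + 1) (a : E [⋀^Fin p]→L[ℝ] A) (b : E [⋀^Fin q]→L[ℝ] A)
    (v : E) (w : Fin r → E) : (wedge h a b).curryLeft v w =
    ((p.factorial * q.factorial : ℝ)⁻¹) • ∑ i : Fin p,
      ((-1 : ℤ) ^ (Fin.cast h (Fin.castAdd q i) : ℕ)) • altSum (fun w' =>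
        a (firstVec h ((Fin.cast h (Fin.castAdd q i)).insertNth v w')) *
        b (lastVec h ((Fin.cast h (Fin.castAdd q i)).insertNth v w'))) w +
    ((p.factorial * q.factorial : ℝ)⁻¹) • ∑ j : Fin q,
      ((-1 : ℤ) ^ (Fin.cast h (Fin.natAdd p j) : ℕ)) • altSum (fun w' =>
        a (firstVec h ((Fin.cast h (Fin.natAdd p j)).insertNth v w')) *
        b (lastVec h ((Fin.cast h (Fin.natAdd p j)).insertNth v w'))) w := by
  rw [ContinuousAlternatingMap.curryLeft_apply_apply, wedge_apply, ← smul_add, ← sum_fin_split h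
    (fun i => ((-1 : ℤ) ^ (i : ℕ)) • altSum (fun w' =>
        a (firstVec h (i.insertNth v w')) * b (lastVec h (i.insertNth v w'))) w)]
  congr 1
  exact altSum_cons _ v w

/-- The wedge product in degree `r`, equal to zero unless the degrees add up to `r`. -/
def wedgeIn (r : ℕ) (a : E [⋀^Fin p]→L[ℝ] A) (b : E [⋀^Fin q]→L[ℝ] A) : E [⋀^Fin r]→L[ℝ] A :=
  if h : p + q = r then wedge h a b else 0

/-- The interior product, equal to zero in degree zero. -/
def intProd (v : E) : {p : ℕ} → (E [⋀^Fin p]→L[ℝ] A) → E [⋀^Fin (p - 1)]→L[ℝ] A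
  | 0, _ => 0
  | _ + 1, a => a.curryLeft v

theorem wedge_zero_left (h : p + q = r) (b : E [⋀^Fin q]→L[ℝ] A) :
    wedge h (0 : E [⋀^Fin p]→L[ℝ] A) b = 0 := by
  ext w
  simp [wedge_apply, altSum]

theorem wedge_zero_right (h : p + q = r) (a : E [⋀^Fin p]→L[ℝ] A) :
    wedge h a (0 : E [⋀^Fin q]→L[ℝ] A) = 0 := by
  ext w
  simp [wedge_apply, altSum]

theorem wedgeIn_zero_left (b : E [⋀^Fin q]→L[ℝ] A) :
    wedgeIn r (0 : E [⋀^Fin p]→L[ℝ] A) b = 0 := by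
  unfold wedgeIn
  split_ifs
  exacts [wedge_zero_left _ _, rfl]

theorem wedgeIn_zero_right (a : E [⋀^Fin p]→L[ℝ] A) :
    wedgeIn r a (0 : E [⋀^Fin q]→L[ℝ] A) = 0 := by
  unfold wedgeIn
  split_ifs
  exacts [wedge_zero_right _ _, rfl]

/-- The interior product is an antiderivation of the wedge product. -/
theorem curryLeft_wedgeIn (a : E [⋀^Fin p]→L[ℝ] A) (b : E [⋀^Fin q]→L[ℝ] A) (v : E) :
    (wedgeIn (r + 1) a b).curryLeft v
      = wedgeIn r (intProd v a) b + ((-1 : ℤ) ^ p) • wedgeIn r a (intProd v b) := by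
  by_cases h : p + q = r + 1
  · ext w
    rw [wedgeIn, dif_pos h, wedge_curryLeft, ContinuousAlternatingMap.add_apply]
    congr 1
    · rcases p with _ | p
      · simp [intProd, wedgeIn_zero_left]
      · have h' : p + q = r := by omega
        rw [sum_castAdd_wedge h h']
        simp only [intProd, wedgeIn, Nat.add_sub_cancel]
        rw [dif_pos h']
    · rcases q with _ | q
      · simp [intProd, wedgeIn_zero_right]
      · have h' : p + q = r := by omega
        rw [sum_natAdd_wedge h h', ContinuousAlternatingMap.smul_apply]
        simp only [intProd, wedgeIn, Nat.add_sub_cancel]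
        rw [dif_pos h']
  · have h1 : wedgeIn r (intProd v a) b = 0 := by
      rcases p with _ | p
      · exact wedgeIn_zero_left _
      · exact dif_neg (by omega)
    have h2 : wedgeIn r a (intProd v b) = 0 := by
      rcases q with _ | q
      · exact wedgeIn_zero_right _
      · exact dif_neg (by omega)
    rw [h1, h2, wedgeIn, dif_neg h]
    ext w
    simp

end Wedge

end KahlerMoment
end

/-! ### Continuity of the wedge product, and the Leibniz rule for the exterior derivative. -/

noncomputable section

namespace KahlerMoment

/-- There are `r!` terms and permuting the vectors leaves the product of norms unchanged. The bound
makes the wedge product a continuous bilinear map, so that the product rule for Fréchet derivatives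
applies to it. -/
theorem norm_altSum_le {E A : Type*} [NormedAddCommGroup E] [NormedRing A] {r : ℕ} (m : (Fin r → E) → A) (C : ℝ) (hm : ∀ w, ‖m w‖ ≤ C * ∏ i, ‖w i‖)
    (w : Fin r → E) : ‖altSum m w‖ ≤ r.factorial * C * ∏ i, ‖w i‖ := by
  calc ‖altSum m w‖ ≤ ∑ _σ : Equiv.Perm (Fin r), C * ∏ i, ‖w i‖ := by
        refine norm_sum_le_of_le _ fun σ _ => ?_
        rw [Units.smul_def, norm_isUnit_zsmul _ (Units.isUnit _)]
        refine (hm _).trans_eq ?_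
        congr 1
        exact Equiv.prod_comp σ (fun i => ‖w i‖)
    _ = _ := by simp [Fintype.card_perm, mul_assoc]

section WedgeCalculus

variable {E A : Type*} [NormedAddCommGroup E] [NormedSpace ℝ E]
  [NormedRing A] [NormedAlgebra ℝ A] {p q r : ℕ}

theorem wedge_add_left (h : p + q = r) (a a' : E [⋀^Fin p]→L[ℝ] A) (b : E [⋀^Fin q]→L[ℝ] A) :
    wedge h (a + a') b = wedge h a b + wedge h a' b := by
  ext w
  simp only [wedge_apply, ContinuousAlternatingMap.add_apply, ← smul_add, altSum,
    ← Finset.sum_add_distrib, add_mul]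

theorem wedge_add_right (h : p + q = r) (a : E [⋀^Fin p]→L[ℝ] A) (b b' : E [⋀^Fin q]→L[ℝ] A) :
    wedge h a (b + b') = wedge h a b + wedge h a b' := by
  ext w
  simp only [wedge_apply, ContinuousAlternatingMap.add_apply, ← smul_add, altSum,
    ← Finset.sum_add_distrib, mul_add]

theorem wedge_smul_left (h : p + q = r) (c : ℝ) (a : E [⋀^Fin p]→L[ℝ] A)
    (b : E [⋀^Fin q]→L[ℝ] A) : wedge h (c • a) b = c • wedge h a b := by
  ext w
  simp only [wedge_apply, ContinuousAlternatingMap.smul_apply, altSum, smul_mul_assoc]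
  rw [smul_comm]
  congr 1
  rw [Finset.smul_sum]
  exact Finset.sum_congr rfl fun σ _ => smul_comm _ _ _

theorem wedge_smul_right (h : p + q = r) (c : ℝ) (a : E [⋀^Fin p]→L[ℝ] A)
    (b : E [⋀^Fin q]→L[ℝ] A) : wedge h a (c • b) = c • wedge h a b := by
  ext w
  simp only [wedge_apply, ContinuousAlternatingMap.smul_apply, altSum, mul_smul_comm]
  rw [smul_comm]
  congr 1
  rw [Finset.smul_sum]
  exact Finset.sum_congr rfl fun σ _ => smul_comm _ _ _

theorem prod_fin_split {M : Type*} [CommMonoid M] (h : p + q = r) (f : Fin r → M) :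
    ∏ i, f i = (∏ i : Fin p, f (Fin.cast h (Fin.castAdd q i)))
      * ∏ j : Fin q, f (Fin.cast h (Fin.natAdd p j)) := by
  subst h
  exact Fin.prod_univ_add f

theorem norm_wedge_le (h : p + q = r) (a : E [⋀^Fin p]→L[ℝ] A) (b : E [⋀^Fin q]→L[ℝ] A) :
    ‖wedge h a b‖ ≤ ‖((p.factorial * q.factorial : ℝ)⁻¹)‖ * r.factorial * ‖a‖ * ‖b‖ := by
  refine ContinuousAlternatingMap.opNorm_le_bound _ (by positivity) fun w => ?_
  rw [wedge_apply, norm_smul]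
  simp only [mul_assoc]
  refine mul_le_mul_of_nonneg_left ?_ (norm_nonneg _)
  refine (norm_altSum_le _ (‖a‖ * ‖b‖) (fun w => ?_) w).trans_eq (by ring)
  refine (norm_mul_le _ _).trans ?_
  refine (mul_le_mul (a.le_opNorm _) (b.le_opNorm _) (norm_nonneg _) (by positivity)).trans_eq ?_
  rw [prod_fin_split h (fun i => ‖w i‖)]
  simp only [firstVec, lastVec]
  ring

/-- The wedge product as a continuous bilinear map. -/
def wedgeL (h : p + q = r) :
    (E [⋀^Fin p]→L[ℝ] A) →L[ℝ] (E [⋀^Fin q]→L[ℝ] A) →L[ℝ] E [⋀^Fin r]→L[ℝ] A :=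
  LinearMap.mkContinuous₂
    (LinearMap.mk₂ ℝ (wedge h) (wedge_add_left h) (wedge_smul_left h) (wedge_add_right h)
      (wedge_smul_right h)) _ (norm_wedge_le h)

@[simp]
theorem wedgeL_apply (h : p + q = r) (a : E [⋀^Fin p]→L[ℝ] A) (b : E [⋀^Fin q]→L[ℝ] A) :
    wedgeL h a b = wedge h a b := rfl

-- Both sides antisymmetrise the single function `M` of `r + 1` vectors in which the differentiation
-- vector comes first. On the right each of the `p + 1` terms of the inner alternating sum gives the
-- same contribution, by `altSum_removeNth`, and the factorials absorb their number.
open ContinuousAlternatingMap in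
theorem alternatizeUncurryFin_wedge_left (h : p + q = r) (h' : p + 1 + q = r + 1)
    (a : E →L[ℝ] E [⋀^Fin p]→L[ℝ] A) (b : E [⋀^Fin q]→L[ℝ] A) :
    alternatizeUncurryFin (((wedgeL h).flip b).comp a) = wedge h' (alternatizeUncurryFin a) b := by
  ext w
  obtain ⟨M, hM⟩ : ∃ M : (Fin (r + 1) → E) → A, ∀ v w', M (Fin.cons v w')
      = a v (firstVec h w') * b (lastVec h w') :=
    ⟨fun w' => a (w' 0) (firstVec h (Fin.tail w')) * b (lastVec h (Fin.tail w')), fun v w' => rfl⟩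
  have h1 : ∀ w', alternatizeUncurryFin a (firstVec h' w') * b (lastVec h' w')
      = ∑ i : Fin (p + 1), ((-1 : ℤ) ^ (Fin.cast h' (Fin.castAdd q i) : ℕ)) •
        M (Fin.cons (w' (Fin.cast h' (Fin.castAdd q i)))
          ((Fin.cast h' (Fin.castAdd q i)).removeNth w')) := fun w' => by
    rw [alternatizeUncurryFin_apply, Finset.sum_mul]
    refine Finset.sum_congr rfl fun i _ => ?_
    rw [hM, Fin.val_cast, Fin.val_castAdd, removeNth_firstVec h' h, lastVec_removeNth h' h i,
      smul_mul_assoc]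
    rfl
  rw [alternatizeUncurryFin_apply, wedge_apply, altSum_congr h1, altSum_sum]
  simp only [altSum_removeNth M, Finset.sum_const, Finset.card_univ, Fintype.card_fin]
  rw [factorial_inv_smul_left, altSum_eq_sum_removeNth, Finset.smul_sum]
  refine Finset.sum_congr rfl fun i _ => ?_
  simp only [hM]
  rw [smul_comm, ← wedge_apply]
  rfl

-- As for the left factor; `(-1)^p` is the sign of carrying the differentiation vector past the `p`
-- arguments of `a`.
open ContinuousAlternatingMap in
theorem alternatizeUncurryFin_wedge_right (h : p + q = r) (h' : p + (q + 1) = r + 1)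
    (a : E [⋀^Fin p]→L[ℝ] A) (b : E →L[ℝ] E [⋀^Fin q]→L[ℝ] A) :
    alternatizeUncurryFin ((wedgeL h a).comp b)
      = ((-1 : ℤ) ^ p) • wedge h' a (alternatizeUncurryFin b) := by
  ext w
  obtain ⟨M, hM⟩ : ∃ M : (Fin (r + 1) → E) → A, ∀ v w', M (Fin.cons v w')
      = a (firstVec h w') * b v (lastVec h w') :=
    ⟨fun w' => a (firstVec h (Fin.tail w')) * b (w' 0) (lastVec h (Fin.tail w')), fun v w' => rfl⟩
  have h1 : ∀ w', ((-1 : ℤ) ^ p) • (a (firstVec h' w') * alternatizeUncurryFin b (lastVec h' w'))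
      = ∑ j : Fin (q + 1), ((-1 : ℤ) ^ (Fin.cast h' (Fin.natAdd p j) : ℕ)) •
        M (Fin.cons (w' (Fin.cast h' (Fin.natAdd p j)))
          ((Fin.cast h' (Fin.natAdd p j)).removeNth w')) := fun w' => by
    rw [alternatizeUncurryFin_apply, Finset.mul_sum, Finset.smul_sum]
    refine Finset.sum_congr rfl fun j _ => ?_
    rw [hM, Fin.val_cast, Fin.val_natAdd, removeNth_lastVec h' h, firstVec_removeNth h' h j,
      pow_add, mul_smul, mul_smul_comm]
    rfl
  rw [alternatizeUncurryFin_apply, ContinuousAlternatingMap.smul_apply, wedge_apply,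
    smul_comm ((-1 : ℤ) ^ p), ← altSum_zsmul, altSum_congr h1, altSum_sum]
  simp only [altSum_removeNth M, Finset.sum_const, Finset.card_univ, Fintype.card_fin]
  rw [factorial_inv_smul_right, altSum_eq_sum_removeNth, Finset.smul_sum]
  refine Finset.sum_congr rfl fun i _ => ?_
  simp only [hM]
  rw [smul_comm, ← wedge_apply]
  rfl

open ContinuousAlternatingMap in
/-- The exterior derivative is an antiderivation of the wedge product. -/
theorem extDeriv_wedge (h : p + q = r) (h₁ : p + 1 + q = r + 1) (h₂ : p + (q + 1) = r + 1)
    {a : E → E [⋀^Fin p]→L[ℝ] A} {b : E → E [⋀^Fin q]→L[ℝ] A} {z : E}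
    (ha : DifferentiableAt ℝ a z) (hb : DifferentiableAt ℝ b z) :
    extDeriv (fun z => wedge h (a z) (b z)) z
      = wedge h₁ (extDeriv a z) (b z) + ((-1 : ℤ) ^ p) • wedge h₂ (a z) (extDeriv b z) := by
  have hd : fderiv ℝ (fun z => wedge h (a z) (b z)) z
      = (wedgeL h (a z)).comp (fderiv ℝ b z) + ((wedgeL h).flip (b z)).comp (fderiv ℝ a z) :=
    ((wedgeL h).hasFDerivAt_of_bilinear ha.hasFDerivAt hb.hasFDerivAt).fderiv
  rw [extDeriv, hd, alternatizeUncurryFin_add, alternatizeUncurryFin_wedge_left h h₁,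
    alternatizeUncurryFin_wedge_right h h₂]
  exact add_comm _ _

theorem extDeriv_wedgeIn
    {a : E → E [⋀^Fin p]→L[ℝ] A} {b : E → E [⋀^Fin q]→L[ℝ] A} {z : E}
    (ha : DifferentiableAt ℝ a z) (hb : DifferentiableAt ℝ b z) :
    extDeriv (fun z => wedgeIn r (a z) (b z)) z
      = wedgeIn (r + 1) (extDeriv a z) (b z)
        + ((-1 : ℤ) ^ p) • wedgeIn (r + 1) (a z) (extDeriv b z) := by
  unfold wedgeIn
  by_cases h : p + q = r
  · simp only [dif_pos h]
    rw [dif_pos (by omega), dif_pos (by omega), extDeriv_wedge]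
    exacts [ha, hb]
  · simp only [dif_neg h]
    rw [dif_neg (by omega), dif_neg (by omega)]
    ext w
    simp [extDeriv, ContinuousAlternatingMap.alternatizeUncurryFin_apply]

theorem contDiffAt_wedge {G : Type*} [NormedAddCommGroup G] [NormedSpace ℝ G] (h : p + q = r)
    {a : G → E [⋀^Fin p]→L[ℝ] A} {b : G → E [⋀^Fin q]→L[ℝ] A} {z : G} {m : WithTop ℕ∞}
    (ha : ContDiffAt ℝ m a z) (hb : ContDiffAt ℝ m b z) :
    ContDiffAt ℝ m (fun z => wedge h (a z) (b z)) z := by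
  have h1 := (ContinuousLinearMap.isBoundedBilinearMap
    (wedgeL (E := E) (A := A) h)).contDiff.contDiffAt (n := m) (x := (a z, b z))
  have h2 := ContDiffAt.comp z h1 (ha.prodMk hb)
  exact h2

end WedgeCalculus

end KahlerMoment
end

noncomputable section

namespace KahlerMoment

/-! ### Inhomogeneous forms, gauge transport, and the operator d + ι_v at a point. -/

section Mixed

variable {E A : Type*} [NormedAddCommGroup E] [NormedSpace ℝ E]
  [NormedRing A] [NormedAlgebra ℝ A] {p q r : ℕ}

theorem wedgeIn_add_left (a a' : E [⋀^Fin p]→L[ℝ] A) (b : E [⋀^Fin q]→L[ℝ] A) :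
    wedgeIn r (a + a') b = wedgeIn r a b + wedgeIn r a' b := by
  unfold wedgeIn
  split_ifs
  exacts [wedge_add_left _ _ _ _, (add_zero _).symm]

theorem wedgeIn_add_right (a : E [⋀^Fin p]→L[ℝ] A) (b b' : E [⋀^Fin q]→L[ℝ] A) :
    wedgeIn r a (b + b') = wedgeIn r a b + wedgeIn r a b' := by
  unfold wedgeIn
  split_ifs
  exacts [wedge_add_right _ _ _ _, (add_zero _).symm]

theorem wedgeIn_smul_left (c : ℝ) (a : E [⋀^Fin p]→L[ℝ] A) (b : E [⋀^Fin q]→L[ℝ] A) :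
    wedgeIn r (c • a) b = c • wedgeIn r a b := by
  unfold wedgeIn
  split_ifs
  · exact wedge_smul_left _ _ _ _
  · ext w
    simp

theorem wedgeIn_smul_right (c : ℝ) (a : E [⋀^Fin p]→L[ℝ] A) (b : E [⋀^Fin q]→L[ℝ] A) :
    wedgeIn r a (c • b) = c • wedgeIn r a b := by
  unfold wedgeIn
  split_ifs
  · exact wedge_smul_right _ _ _ _
  · ext w
    simp

theorem contDiffAt_wedgeIn {G : Type*} [NormedAddCommGroup G] [NormedSpace ℝ G]
    {a : G → E [⋀^Fin p]→L[ℝ] A} {b : G → E [⋀^Fin q]→L[ℝ] A} {z : G} {m : WithTop ℕ∞}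
    (ha : ContDiffAt ℝ m a z) (hb : ContDiffAt ℝ m b z) :
    ContDiffAt ℝ m (fun z => wedgeIn r (a z) (b z)) z := by
  unfold wedgeIn
  split_ifs with h
  · exact contDiffAt_wedge h ha hb
  · exact contDiffAt_const

theorem mulMixed_eq (a b : (p : ℕ) → E [⋀^Fin p]→L[ℝ] A) (p : ℕ) :
    mulMixed a b p = ∑ ij ∈ Finset.HasAntidiagonal.antidiagonal p,
      wedgeIn p (a ij.1) (b ij.2) := by
  rw [mulMixed, ← Finset.sum_coe_sort (Finset.HasAntidiagonal.antidiagonal p)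
    (fun ij => wedgeIn p (a ij.1) (b ij.2))]
  refine Finset.sum_congr rfl fun ij _ => ?_
  rw [wedgeIn, dif_pos (Finset.HasAntidiagonal.mem_antidiagonal.mp ij.2)]

/-- The multiplication of inhomogeneous forms, as a bilinear map. -/
def mulMixedL : ((p : ℕ) → E [⋀^Fin p]→L[ℝ] A) →ₗ[ℝ] ((p : ℕ) → E [⋀^Fin p]→L[ℝ] A) →ₗ[ℝ]
    ((p : ℕ) → E [⋀^Fin p]→L[ℝ] A) :=
  LinearMap.mk₂ ℝ mulMixed
    (fun a a' b => funext fun p => by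
      simp only [Pi.add_apply, mulMixed_eq, wedgeIn_add_left, Finset.sum_add_distrib])
    (fun c a b => funext fun p => by
      simp only [Pi.smul_apply, mulMixed_eq, wedgeIn_smul_left, Finset.smul_sum])
    (fun a b b' => funext fun p => by
      simp only [Pi.add_apply, mulMixed_eq, wedgeIn_add_right, Finset.sum_add_distrib])
    (fun c a b => funext fun p => by
      simp only [Pi.smul_apply, mulMixed_eq, wedgeIn_smul_right, Finset.smul_sum])

/-- An inhomogeneous form whose components of odd degree vanish. -/
def IsEvenMixed (a : (p : ℕ) → E [⋀^Fin p]→L[ℝ] A) : Prop := ∀ p, Odd p → a p = 0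

theorem IsEvenMixed.mul {a b : (p : ℕ) → E [⋀^Fin p]→L[ℝ] A} (ha : IsEvenMixed a)
    (hb : IsEvenMixed b) : IsEvenMixed (mulMixed a b) := by
  intro p hp
  rw [mulMixed_eq]
  refine Finset.sum_eq_zero fun ij hij => ?_
  rw [← Finset.HasAntidiagonal.mem_antidiagonal.mp hij] at hp
  rcases Nat.even_or_odd ij.1 with h | h
  · rw [hb _ (Nat.odd_add'.mp hp |>.mpr h), wedgeIn_zero_right]
  · rw [ha _ h, wedgeIn_zero_left]

theorem IsEvenMixed.pow {a : (p : ℕ) → E [⋀^Fin p]→L[ℝ] A} (ha : IsEvenMixed a) (k : ℕ) :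
    IsEvenMixed (powMixed a k) := by
  induction k with
  | zero =>
    rintro (_ | p) hp
    · exact absurd hp (by decide)
    · rfl
  | succ k ih => exact ih.mul ha

theorem contDiffAt_mulMixed {G : Type*} [NormedAddCommGroup G] [NormedSpace ℝ G]
    {a b : G → (p : ℕ) → E [⋀^Fin p]→L[ℝ] A} {z : G} {m : WithTop ℕ∞}
    (ha : ∀ p, ContDiffAt ℝ m (fun z => a z p) z) (hb : ∀ p, ContDiffAt ℝ m (fun z => b z p) z)
    (p : ℕ) : ContDiffAt ℝ m (fun z => mulMixed (a z) (b z) p) z := by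
  simp only [mulMixed_eq]
  exact ContDiffAt.sum fun ij _ => contDiffAt_wedgeIn (ha _) (hb _)

theorem contDiffAt_powMixed {G : Type*} [NormedAddCommGroup G] [NormedSpace ℝ G]
    {a : G → (p : ℕ) → E [⋀^Fin p]→L[ℝ] A} {z : G} {m : WithTop ℕ∞}
    (ha : ∀ p, ContDiffAt ℝ m (fun z => a z p) z) (k : ℕ) :
    ∀ p, ContDiffAt ℝ m (fun z => powMixed (a z) k p) z := by
  induction k with
  | zero =>
    rintro (_ | p)
    · exact contDiffAt_const
    · exact contDiffAt_const
  | succ k ih => exact contDiffAt_mulMixed ih ha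

/-- The map `x ↦ c x d`. -/
def sandwich (c d : A) : A →L[ℝ] A :=
  ((ContinuousLinearMap.mul ℝ A).flip d).comp (ContinuousLinearMap.mul ℝ A c)

@[simp]
theorem sandwich_apply (c d x : A) : sandwich c d x = c * x * d := rfl

/-- Pull-back by `g` and conjugation by `c` (with inverse `d`). -/
def transport {E' : Type*} [NormedAddCommGroup E'] [NormedSpace ℝ E'] (g : E' →L[ℝ] E) (c d : A)
    (a : E [⋀^Fin p]→L[ℝ] A) : E' [⋀^Fin p]→L[ℝ] A :=
  (sandwich c d).compContinuousAlternatingMap (a.compContinuousLinearMap g)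

@[simp]
theorem transport_apply {E' : Type*} [NormedAddCommGroup E'] [NormedSpace ℝ E'] (g : E' →L[ℝ] E)
    (c d : A) (a : E [⋀^Fin p]→L[ℝ] A) (w : Fin p → E') :
    transport g c d a w = c * a (fun i => g (w i)) * d := rfl

section Transport

variable {E' : Type*} [NormedAddCommGroup E'] [NormedSpace ℝ E'] (g : E' →L[ℝ] E) {c d : A}

theorem transport_wedgeIn (hdc : d * c = 1) (a : E [⋀^Fin p]→L[ℝ] A) (b : E [⋀^Fin q]→L[ℝ] A) :
    transport g c d (wedgeIn r a b) = wedgeIn r (transport g c d a) (transport g c d b) := by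
  unfold wedgeIn
  split_ifs with h
  · ext w
    simp only [transport_apply, wedge_apply, altSum, mul_smul_comm, smul_mul_assoc,
      Finset.mul_sum, Finset.sum_mul]
    congr 1
    refine Finset.sum_congr rfl fun σ _ => ?_
    simp only [Units.smul_def]
    congr 1
    have : ∀ x y : A, c * (x * y) * d = (c * x * d) * (c * y * d) := fun x y => by
      simp only [mul_assoc]
      rw [← mul_assoc d c, hdc, one_mul]
    exact this _ _
  · ext w
    simp

theorem transport_sum {ι : Type*} (s : Finset ι) (a : ι → E [⋀^Fin p]→L[ℝ] A) :
    transport g c d (∑ i ∈ s, a i) = ∑ i ∈ s, transport g c d (a i) := by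
  ext w
  simp [ContinuousAlternatingMap.sum_apply, Finset.mul_sum, Finset.sum_mul]

/-- Both inverse relations are used: `c * d = 1` preserves the unit, and `d * c = 1` cancels between
two adjacent factors. -/
theorem transport_powMixed (hcd : c * d = 1) (hdc : d * c = 1)
    (a : (p : ℕ) → E [⋀^Fin p]→L[ℝ] A) (k : ℕ) :
    ∀ p, transport g c d (powMixed a k p) = powMixed (fun q => transport g c d (a q)) k p := by
  induction k with
  | zero =>
    rintro (_ | p)
    · ext w
      simp [powMixed, hcd]
    · ext w
      simp [powMixed]
  | succ k ih =>
    intro p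
    simp only [powMixed, mulMixed_eq, transport_sum]
    refine Finset.sum_congr rfl fun ij _ => ?_
    rw [transport_wedgeIn g hdc, ih]

end Transport

/-- The operator `d + ι_v` at the point `z` on inhomogeneous forms on a vector space. -/
def eqDAt (v : E) (P : E → (p : ℕ) → E [⋀^Fin p]→L[ℝ] A) (z : E) : (p : ℕ) → E [⋀^Fin p]→L[ℝ] A
  | 0 => (P z 1).curryLeft v
  | p + 1 => extDeriv (fun z => P z p) z + (P z (p + 2)).curryLeft v

theorem extDeriv_sum {ι : Type*} (s : Finset ι) {a : ι → E → E [⋀^Fin p]→L[ℝ] A} {z : E}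
    (ha : ∀ i ∈ s, DifferentiableAt ℝ (a i) z) :
    extDeriv (fun z => ∑ i ∈ s, a i z) z = ∑ i ∈ s, extDeriv (a i) z := by
  simp only [extDeriv]
  rw [fderiv_fun_sum ha]
  exact map_sum (ContinuousAlternatingMap.alternatizeUncurryFinCLM ℝ E A) _ _

theorem curryLeft_sum {ι : Type*} (s : Finset ι) (a : ι → E [⋀^Fin (p + 1)]→L[ℝ] A) (v : E) :
    (∑ i ∈ s, a i).curryLeft v = ∑ i ∈ s, (a i).curryLeft v := by
  ext w
  simp [ContinuousAlternatingMap.sum_apply]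

/-- In odd degree there is nothing to change sign. This turns the antiderivations d and ι_v into
derivations when the left factor is even. -/
theorem IsEvenMixed.neg_one_pow_smul_wedgeIn {a : (p : ℕ) → E [⋀^Fin p]→L[ℝ] A}
    (ha : IsEvenMixed a) (i : ℕ) (b : E [⋀^Fin q]→L[ℝ] A) :
    ((-1 : ℤ) ^ i) • wedgeIn r (a i) b = wedgeIn r (a i) b := by
  rcases Nat.even_or_odd i with h | h
  · rw [h.neg_one_pow, one_smul]
  · rw [ha i h, wedgeIn_zero_left]
    ext w
    simp

theorem curryLeft_mulMixed {a b : (p : ℕ) → E [⋀^Fin p]→L[ℝ] A} (ha : IsEvenMixed a) (v : E)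
    (p : ℕ) : (mulMixed a b (p + 1)).curryLeft v =
      ∑ ij ∈ Finset.HasAntidiagonal.antidiagonal p,
        wedgeIn p ((a (ij.1 + 1)).curryLeft v) (b ij.2)
      + ∑ ij ∈ Finset.HasAntidiagonal.antidiagonal p,
        wedgeIn p (a ij.1) ((b (ij.2 + 1)).curryLeft v) := by
  rw [mulMixed_eq, curryLeft_sum]
  simp only [curryLeft_wedgeIn, ha.neg_one_pow_smul_wedgeIn]
  rw [Finset.sum_add_distrib, Finset.Nat.sum_antidiagonal_succ]
  conv_lhs => rw [Finset.Nat.sum_antidiagonal_succ']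
  simp only [intProd, wedgeIn_zero_left, wedgeIn_zero_right, zero_add]

/-- The Leibniz rule for d + ι_v with an even left factor. Everything is at the single point `z`:
the interior product is tensorial, so only the value `v` of the vector field at `z` enters, and
closedness away from `z` is not needed. -/
theorem eqDAt_mulMixed {v : E} {P F : E → (p : ℕ) → E [⋀^Fin p]→L[ℝ] A} {z : E}
    (hPe : IsEvenMixed (P z))
    (hPd : ∀ p, DifferentiableAt ℝ (fun z => P z p) z)
    (hFd : ∀ p, DifferentiableAt ℝ (fun z => F z p) z)
    (hP : ∀ p, eqDAt v P z p = 0) (hF : ∀ p, eqDAt v F z p = 0) (p : ℕ) :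
    eqDAt v (fun z => mulMixed (P z) (F z)) z p = 0 := by
  have hP0 : (P z 1).curryLeft v = 0 := hP 0
  have hF0 : (F z 1).curryLeft v = 0 := hF 0
  rcases p with _ | p
  · simp only [eqDAt]
    rw [curryLeft_mulMixed hPe]
    simp [hP0, hF0, wedgeIn_zero_left, wedgeIn_zero_right]
  · simp only [eqDAt]
    rw [curryLeft_mulMixed hPe]
    simp only [mulMixed_eq]
    -- Both interior-product sums run over pairs of total degree `p + 1`. Splitting off the terms
    -- with `P z 1` and `F z 1` contracted, which vanish by the degree-zero equations, reindexes
    -- them over pairs of total degree `p`, to match the exterior-derivative sum.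
    rw [Finset.Nat.sum_antidiagonal_succ]
    conv_lhs =>
      rw [Finset.Nat.sum_antidiagonal_succ' (f := fun ij : ℕ × ℕ =>
        wedgeIn (p + 1) (P z ij.1) ((F z (ij.2 + 1)).curryLeft v))]
    simp only [zero_add, hP0, hF0, wedgeIn_zero_left, wedgeIn_zero_right]
    rw [extDeriv_sum (a := fun (ij : ℕ × ℕ) z => wedgeIn p (P z ij.1) (F z ij.2)),
      ← Finset.sum_add_distrib, ← Finset.sum_add_distrib]
    · refine Finset.sum_eq_zero fun ij _ => ?_
      rw [extDeriv_wedgeIn (hPd _) (hFd _), hPe.neg_one_pow_smul_wedgeIn, add_add_add_comm,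
        ← wedgeIn_add_left, ← wedgeIn_add_right]
      have h1 := hP (ij.1 + 1)
      have h2 := hF (ij.2 + 1)
      simp only [eqDAt] at h1 h2
      rw [h1, h2, wedgeIn_zero_left, wedgeIn_zero_right, add_zero]
    · intro ij _
      unfold wedgeIn
      split_ifs with h
      · exact ((wedgeL h).hasFDerivAt_of_bilinear (hPd _).hasFDerivAt
          (hFd _).hasFDerivAt).differentiableAt
      · exact differentiableAt_const _

theorem differentiableAt_powMixed {F : E → (p : ℕ) → E [⋀^Fin p]→L[ℝ] A} {z : E}
    (hFd : ∀ p, ContDiffAt ℝ 1 (fun z => F z p) z) (k p : ℕ) :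
    DifferentiableAt ℝ (fun z => powMixed (F z) k p) z :=
  (contDiffAt_powMixed hFd k p).differentiableAt one_ne_zero

/-- If an even inhomogeneous form is closed for `d + ι_v` at a point, then so are its powers. -/
theorem eqDAt_powMixed {v : E} {F : E → (p : ℕ) → E [⋀^Fin p]→L[ℝ] A} {z : E}
    (hFe : IsEvenMixed (F z)) (hFd : ∀ p, ContDiffAt ℝ 1 (fun z => F z p) z)
    (hF : ∀ p, eqDAt v F z p = 0) (k : ℕ) :
    ∀ p, eqDAt v (fun z => powMixed (F z) k) z p = 0 := by
  induction k with
  | zero =>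
    rintro (_ | _ | p)
    · ext w; simp [eqDAt, powMixed]
    · ext w; simp [eqDAt, powMixed, extDeriv, ContinuousAlternatingMap.alternatizeUncurryFin_apply]
    · ext w; simp [eqDAt, powMixed, extDeriv, ContinuousAlternatingMap.alternatizeUncurryFin_apply]
  | succ k ih =>
    exact eqDAt_mulMixed (hFe.pow k) (differentiableAt_powMixed hFd k)
      (fun p => (hFd p).differentiableAt one_ne_zero) ih hF

end Mixed

/-! ### Polynomial maps -/

section Polynomial

variable {V W W' W'' : Type*} [AddCommGroup V] [Module ℝ V] [AddCommGroup W] [Module ℝ W]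
  [AddCommGroup W'] [Module ℝ W'] [AddCommGroup W''] [Module ℝ W'']

theorem isPolynomialMap_const (c : W) : IsPolynomialMap (fun _ : V => c) := by
  refine ⟨0, fun j => if h : j = 0 then by
    subst h; exact MultilinearMap.constOfIsEmpty ℝ (fun _ : Fin 0 => V) c else 0, fun v => ?_⟩
  simp

theorem IsPolynomialMap.comp_linear {f : V → W} (hf : IsPolynomialMap f) (T : W →ₗ[ℝ] W') :
    IsPolynomialMap (fun v => T (f v)) := by
  obtain ⟨d, m, hm⟩ := hf
  refine ⟨d, fun j => T.compMultilinearMap (m j), fun v => ?_⟩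
  simp [hm]

/-- The constant part of the affine factor keeps the degree of each homogeneous term and the linear
part raises it by one. This is the induction step for powers of R + H_v. -/
theorem IsPolynomialMap.mul_affine {f : V → W} (hf : IsPolynomialMap f)
    (B : W →ₗ[ℝ] W' →ₗ[ℝ] W'') (c : W') (L : V →ₗ[ℝ] W') :
    IsPolynomialMap (fun v => B (f v) (c + L v)) := by
  obtain ⟨d, m, hm⟩ := hf
  let m₁ : (j : ℕ) → MultilinearMap ℝ (fun _ : Fin j => V) W'' := fun j =>
    match j with
    | 0 => 0
    | j + 1 => MultilinearMap.uncurryRight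
      ((LinearMap.lcomp ℝ W'' L ∘ₗ B).compMultilinearMap (m j))
  -- The hypothesis says nothing about `m (d + 1)`, which the longer sum would include, so it is cut
  -- off here.
  let m₀ : (j : ℕ) → MultilinearMap ℝ (fun _ : Fin j => V) W'' := fun j =>
    if j ≤ d then (B.flip c).compMultilinearMap (m j) else 0
  refine ⟨d + 1, fun j => m₀ j + m₁ j, fun v => ?_⟩
  simp only [add_apply, Finset.sum_add_distrib, map_add]
  congr 1
  · rw [Finset.sum_range_succ, hm]
    simp only [m₀]
    rw [if_neg (by omega), map_sum, LinearMap.sum_apply, zero_apply, add_zero]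
    refine Finset.sum_congr rfl fun j hj => ?_
    rw [if_pos (by rw [Finset.mem_range] at hj; omega)]
    rfl
  · rw [Finset.sum_range_succ', hm, map_sum, LinearMap.sum_apply]
    simp only [m₁, zero_apply, add_zero]
    refine Finset.sum_congr rfl fun j hj => ?_
    rw [MultilinearMap.uncurryRight_apply]
    rfl

end Polynomial

end KahlerMoment
end

noncomputable section

namespace KahlerMoment

open Topology

/-! ### Two-forms -/

section TwoForm

variable {E F : Type*} [NormedAddCommGroup E] [NormedSpace ℝ E] [NormedAddCommGroup F]
  [NormedSpace ℝ F]

theorem twoForm_add_left (a : E [⋀^Fin 2]→L[ℝ] F) (u u' w : E) :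
    a ![u + u', w] = a ![u, w] + a ![u', w] :=
  a.toMultilinearMap.cons_add ![w] u u'

theorem twoForm_smul_left (a : E [⋀^Fin 2]→L[ℝ] F) (c : ℝ) (u w : E) :
    a ![c • u, w] = c • a ![u, w] :=
  a.toMultilinearMap.cons_smul ![w] c u

theorem twoForm_swap (a : E [⋀^Fin 2]→L[ℝ] F) (u w : E) : a ![w, u] = -a ![u, w] := by
  have h := a.toAlternatingMap.map_swap ![u, w] (i := 0) (j := 1) (by decide)
  have h' : (![u, w] ∘ Equiv.swap (0 : Fin 2) 1) = ![w, u] := by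
    funext i; fin_cases i <;> rfl
  rwa [h'] at h

theorem twoForm_add_right (a : E [⋀^Fin 2]→L[ℝ] F) (u w w' : E) :
    a ![u, w + w'] = a ![u, w] + a ![u, w'] := by
  rw [twoForm_swap a (w + w') u, twoForm_swap a w u, twoForm_swap a w' u, twoForm_add_left,
    neg_add]

theorem twoForm_smul_right (a : E [⋀^Fin 2]→L[ℝ] F) (c : ℝ) (u w : E) :
    a ![u, c • w] = c • a ![u, w] := by
  rw [twoForm_swap a (c • w) u, twoForm_swap a w u, twoForm_smul_left, smul_neg]

theorem twoForm_neg_right (a : E [⋀^Fin 2]→L[ℝ] F) (u w : E) : a ![u, -w] = -a ![u, w] := by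
  rw [← neg_one_smul ℝ, twoForm_smul_right, neg_one_smul]

theorem ext_twoForm {a b : E [⋀^Fin 2]→L[ℝ] F} (h : ∀ u w, a ![u, w] = b ![u, w]) : a = b := by
  ext v
  have : v = ![v 0, v 1] := by funext i; fin_cases i <;> rfl
  rw [this, h]

theorem extDeriv_twoForm_apply (η : E → E [⋀^Fin 2]→L[ℝ] F) (z u v w : E) :
    extDeriv η z ![u, v, w]
      = fderiv ℝ η z u ![v, w] - fderiv ℝ η z v ![u, w] + fderiv ℝ η z w ![u, v] := by
  rw [extDeriv, ContinuousAlternatingMap.alternatizeUncurryFin_apply, Fin.sum_univ_three]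
  have h0 : Fin.removeNth 0 ![u, v, w] = ![v, w] := by funext i; fin_cases i <;> rfl
  have h1 : Fin.removeNth 1 ![u, v, w] = ![u, w] := by funext i; fin_cases i <;> rfl
  have h2 : Fin.removeNth 2 ![u, v, w] = ![u, v] := by funext i; fin_cases i <;> rfl
  rw [h0, h1, h2]
  simp [sub_eq_add_neg]

theorem extDeriv_oneForm_apply (θ : E → E [⋀^Fin 1]→L[ℝ] F) (z u w : E) :
    extDeriv θ z ![u, w] = fderiv ℝ θ z u ![w] - fderiv ℝ θ z w ![u] := by
  rw [extDeriv, ContinuousAlternatingMap.alternatizeUncurryFin_apply, Fin.sum_univ_two]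
  have h0 : Fin.removeNth 0 ![u, w] = ![w] := by funext i; fin_cases i; rfl
  have h1 : Fin.removeNth 1 ![u, w] = ![u] := by funext i; fin_cases i; rfl
  rw [h0, h1]
  simp [sub_eq_add_neg]

end TwoForm

/-! ### The Wirtinger operators -/

section Wirtinger

variable {n : ℕ} {F : Type*} [NormedAddCommGroup F] [NormedSpace ℂ F]

theorem delOp_apply (f : Cn n → F) (z u : Cn n) :
    delOp f z u = (1 / 2 : ℂ) • (fderiv ℝ f z u - Complex.I • fderiv ℝ f z (Complex.I • u)) := rfl

theorem delbarOp_apply (f : Cn n → F) (z u : Cn n) :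
    delbarOp f z u = (1 / 2 : ℂ) • (fderiv ℝ f z u + Complex.I • fderiv ℝ f z (Complex.I • u)) :=
  rfl

theorem fderiv_eq_delOp_add_delbarOp (f : Cn n → F) (z u : Cn n) :
    fderiv ℝ f z u = delOp f z u + delbarOp f z u := by
  rw [delOp_apply, delbarOp_apply]
  module

theorem delOp_smul_I (f : Cn n → F) (z u : Cn n) :
    delOp f z (Complex.I • u) = Complex.I • delOp f z u := by
  rw [delOp_apply, delOp_apply, smul_smul Complex.I Complex.I u, Complex.I_mul_I, neg_one_smul,
    map_neg]
  match_scalars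
  · linear_combination (1 / 2 : ℂ) * Complex.I_sq
  · ring

theorem contDiffOn_delOp {f : Cn n → F} {U : Set (Cn n)} (hU : IsOpen U)
    (hf : ContDiffOn ℝ ∞ f U) : ContDiffOn ℝ ∞ (delOp f) U := by
  have h1 : ContDiffOn ℝ ∞ (fderiv ℝ f) U := hf.fderiv_of_isOpen hU (by simp)
  unfold delOp
  exact (h1.sub ((h1.clm_comp contDiffOn_const).const_smul _)).const_smul _

/-- A real-linear map which commutes with `i` is complex-linear. -/
theorem map_complex_smul_of_map_I {L : Cn n →+ F} (hr : ∀ (r : ℝ) u, L (r • u) = r • L u)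
    (hI : ∀ u, L (Complex.I • u) = Complex.I • L u) (c : ℂ) (u : Cn n) : L (c • u) = c • L u := by
  conv_lhs => rw [← Complex.re_add_im c, add_smul, mul_smul, map_add, Complex.coe_smul,
    Complex.coe_smul, hr, hr, hI]
  conv_rhs => rw [← Complex.re_add_im c, add_smul, mul_smul, Complex.coe_smul, Complex.coe_smul]

end Wirtinger

/-! ### Operators given by matrices -/

section Adjoint

variable {n : ℕ}

theorem ext_inner_end {S T : EndC n} (h : ∀ s t : Cn n, inner ℂ t (S s) = inner ℂ t (T s)) :
    S = T :=
  ContinuousLinearMap.ext fun s => ext_inner_left ℂ fun t => h s t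

/-- Expanding both vectors in the standard basis recovers the form from its matrix. Through this the
Gram and Hessian matrices become operators characterised without coordinates, and operator
identities can be tested on inner products. -/
theorem inner_matrix_sesquilinear (Φ : Cn n → Cn n → ℂ)
    (h1 : ∀ s s' t, Φ (s + s') t = Φ s t + Φ s' t) (h2 : ∀ (c : ℂ) s t, Φ (c • s) t = c * Φ s t)
    (h3 : ∀ s t t', Φ s (t + t') = Φ s t + Φ s t')
    (h4 : ∀ (c : ℂ) s t, Φ s (c • t) = starRingEnd ℂ c * Φ s t) (s t : Cn n) :
    inner ℂ t (Matrix.toEuclideanCLM (𝕜 := ℂ) (Matrix.of fun β γ : Fin n =>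
      Φ (EuclideanSpace.single γ 1) (EuclideanSpace.single β 1)) s) = Φ s t := by
  let Ψ : Cn n →ₗ[ℂ] Cn n →ₛₗ[starRingEnd ℂ] ℂ :=
    LinearMap.mk₂'ₛₗ (RingHom.id ℂ) (starRingEnd ℂ) Φ h1 h2 h3 h4
  have hs : s = ∑ γ, s γ • EuclideanSpace.single γ (1 : ℂ) := by
    ext i; simp [Pi.single_apply]
  have ht : t = ∑ β, t β • EuclideanSpace.single β (1 : ℂ) := by
    ext i; simp [Pi.single_apply]
  have hR : Φ s t = ∑ β, ∑ γ, s γ * (starRingEnd ℂ (t β) *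
      Φ (EuclideanSpace.single γ 1) (EuclideanSpace.single β 1)) := by
    change Ψ s t = _
    conv_lhs => rw [hs, ht]
    rw [map_sum]
    refine Finset.sum_congr rfl fun β _ => ?_
    rw [map_sum, LinearMap.sum_apply]
    refine Finset.sum_congr rfl fun γ _ => ?_
    change Φ _ _ = _
    rw [h2, h4]
  rw [hR, PiLp.inner_apply]
  refine Finset.sum_congr rfl fun β _ => ?_
  rw [Matrix.ofLp_toEuclideanCLM]
  simp only [Matrix.mulVec, dotProduct, Matrix.of_apply]
  change _ * starRingEnd ℂ (t β) = _
  rw [Finset.sum_mul]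
  exact Finset.sum_congr rfl fun γ _ => by ring

theorem isUnit_of_inner_ne_zero {G : EndC n} (h : ∀ s, s ≠ 0 → inner ℂ s (G s) ≠ 0) :
    IsUnit G := by
  rw [ContinuousLinearMap.isUnit_iff_isUnit_toLinearMap, LinearMap.isUnit_iff_ker_eq_bot,
    LinearMap.ker_eq_bot']
  intro s hs
  by_contra h0
  refine h s h0 ?_
  have : G s = 0 := hs
  rw [this, inner_zero_right]

end Adjoint

end KahlerMoment
end

noncomputable section

namespace KahlerMoment

open Topology

/-! ### Hermitian metrics -/

section Gram

variable {n : ℕ}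

/-- A real two-form of type `(1,1)`. -/
def IsOneOne (a : Cn n [⋀^Fin 2]→L[ℝ] ℝ) : Prop :=
  ∀ u w, a ![Complex.I • u, Complex.I • w] = a ![u, w]

theorem IsOneOne.apply_I_left {a : Cn n [⋀^Fin 2]→L[ℝ] ℝ} (ha : IsOneOne a) (u w : Cn n) :
    a ![Complex.I • u, w] = -a ![u, Complex.I • w] := by
  rw [← ha u (Complex.I • w), smul_smul, Complex.I_mul_I, neg_one_smul, twoForm_neg_right, neg_neg]

theorem herm_add_left (a : Cn n [⋀^Fin 2]→L[ℝ] ℝ) (s s' t : Cn n) :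
    herm a (s + s') t = herm a s t + herm a s' t := by
  simp only [herm, twoForm_add_left]
  push_cast
  ring

theorem herm_add_right (a : Cn n [⋀^Fin 2]→L[ℝ] ℝ) (s t t' : Cn n) :
    herm a s (t + t') = herm a s t + herm a s t' := by
  simp only [herm, twoForm_add_right, smul_add]
  push_cast
  ring

theorem smul_eq_re_add_im (c : ℂ) (s : Cn n) : c • s = c.re • s + c.im • (Complex.I • s) := by
  conv_lhs => rw [← Complex.re_add_im c, add_smul, mul_smul, Complex.coe_smul, Complex.coe_smul]

/-- Type (1,1) is essential here. Conjugate-linearity in the second slot, by contrast, holds for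
every real two-form by the construction of `herm`. -/
theorem IsOneOne.herm_smul_left {a : Cn n [⋀^Fin 2]→L[ℝ] ℝ} (ha : IsOneOne a) (c : ℂ)
    (s t : Cn n) : herm a (c • s) t = c * herm a s t := by
  rw [smul_eq_re_add_im, herm_add_left]
  conv_rhs => rw [← Complex.re_add_im c]
  simp only [herm, twoForm_smul_left, ha.apply_I_left, smul_smul Complex.I Complex.I,
    Complex.I_mul_I, neg_one_smul, twoForm_neg_right, smul_eq_mul]
  push_cast
  linear_combination ((1 / 2 : ℂ) * c.im * (a ![s, t] : ℂ)) * Complex.I_sq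

theorem herm_smul_right (a : Cn n [⋀^Fin 2]→L[ℝ] ℝ) (c : ℂ)
    (s t : Cn n) : herm a s (c • t) = starRingEnd ℂ c * herm a s t := by
  rw [smul_eq_re_add_im, herm_add_right]
  have hc : starRingEnd ℂ c = c.re - c.im * Complex.I := by
    apply Complex.ext <;> simp
  rw [hc]
  simp only [herm, twoForm_smul_right, smul_comm Complex.I, smul_smul Complex.I Complex.I,
    Complex.I_mul_I, neg_one_smul, twoForm_neg_right, smul_eq_mul]
  push_cast
  linear_combination (-(1 / 2 : ℂ) * c.im * (a ![s, t] : ℂ)) * Complex.I_sq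

theorem IsOneOne.conj_herm {a : Cn n [⋀^Fin 2]→L[ℝ] ℝ} (ha : IsOneOne a) (s t : Cn n) :
    starRingEnd ℂ (herm a s t) = herm a t s := by
  have h : a ![t, Complex.I • s] = a ![s, Complex.I • t] := by
    rw [twoForm_swap, ha.apply_I_left, neg_neg]
  simp only [herm, h, twoForm_swap a s t, map_mul, map_sub, Complex.conj_ofReal, Complex.conj_I,
    map_div₀, map_one, map_ofNat]
  push_cast
  ring

/-- The operator representing a Hermitian form. -/
def gramOf (a : Cn n [⋀^Fin 2]→L[ℝ] ℝ) : EndC n :=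
  Matrix.toEuclideanCLM (𝕜 := ℂ) (Matrix.of fun β γ : Fin n =>
    herm a (EuclideanSpace.single γ 1) (EuclideanSpace.single β 1))

theorem IsOneOne.inner_gramOf {a : Cn n [⋀^Fin 2]→L[ℝ] ℝ} (ha : IsOneOne a) (s t : Cn n) :
    inner ℂ t (gramOf a s) = herm a s t :=
  inner_matrix_sesquilinear (herm a) (herm_add_left a) ha.herm_smul_left (herm_add_right a)
    (herm_smul_right a) s t

theorem IsOneOne.star_gramOf {a : Cn n [⋀^Fin 2]→L[ℝ] ℝ} (ha : IsOneOne a) :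
    star (gramOf a) = gramOf a := by
  refine ext_inner_end fun s t => ?_
  rw [ContinuousLinearMap.star_eq_adjoint, ContinuousLinearMap.adjoint_inner_right,
    ha.inner_gramOf, ← inner_conj_symm, ha.inner_gramOf, ha.conj_herm]

/-- A positive real two-form of type `(1,1)`. -/
structure IsPositiveOneOne (a : Cn n [⋀^Fin 2]→L[ℝ] ℝ) : Prop where
  oneOne : IsOneOne a
  pos : ∀ u, u ≠ 0 → 0 < a ![u, Complex.I • u]

theorem twoForm_self (a : Cn n [⋀^Fin 2]→L[ℝ] ℝ) (u : Cn n) : a ![u, u] = 0 := by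
  have := twoForm_swap a u u
  linarith

theorem IsPositiveOneOne.isUnit_gramOf {a : Cn n [⋀^Fin 2]→L[ℝ] ℝ} (ha : IsPositiveOneOne a) :
    IsUnit (gramOf a) := by
  refine isUnit_of_inner_ne_zero fun s hs => ?_
  rw [ha.oneOne.inner_gramOf, herm, twoForm_self]
  have := (ha.pos s hs).ne'
  simpa using this

/-- The pull-back of a two-form by a complex-linear map. -/
theorem herm_compContinuousLinearMap (a : Cn n [⋀^Fin 2]→L[ℝ] ℝ) (L : EndC n) (s t : Cn n) :
    herm (a.compContinuousLinearMap (L.restrictScalars ℝ)) s t = herm a (L s) (L t) := by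
  have h : ∀ u w : Cn n, a.compContinuousLinearMap (L.restrictScalars ℝ) ![u, w]
      = a ![L u, L w] := fun u w => by
    rw [ContinuousAlternatingMap.compContinuousLinearMap_apply]
    congr 1
    funext i; fin_cases i <;> rfl
  simp only [herm, h, map_smul]

theorem IsOneOne.comp {a : Cn n [⋀^Fin 2]→L[ℝ] ℝ} (ha : IsOneOne a) (L : EndC n) :
    IsOneOne (a.compContinuousLinearMap (L.restrictScalars ℝ)) := by
  have h : ∀ u w : Cn n, a.compContinuousLinearMap (L.restrictScalars ℝ) ![u, w]
      = a ![L u, L w] := fun u w => by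
    rw [ContinuousAlternatingMap.compContinuousLinearMap_apply]
    congr 1
    funext i; fin_cases i <;> rfl
  intro u w
  rw [h, h, map_smul, map_smul, ha]

theorem IsPositiveOneOne.comp {a : Cn n [⋀^Fin 2]→L[ℝ] ℝ} (ha : IsPositiveOneOne a) {L : EndC n}
    (hL : IsUnit L) : IsPositiveOneOne (a.compContinuousLinearMap (L.restrictScalars ℝ)) := by
  refine ⟨ha.oneOne.comp L, fun u hu => ?_⟩
  have hu' : L u ≠ 0 := by
    intro h0
    obtain ⟨M, hM⟩ := hL.exists_left_inv
    apply hu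
    have := congrArg (fun T : EndC n => T u) hM
    simpa [h0] using this.symm
  have := ha.pos (L u) hu'
  rw [← map_smul] at this
  convert this using 1
  rw [ContinuousAlternatingMap.compContinuousLinearMap_apply]
  congr 1
  funext i; fin_cases i <;> rfl

theorem IsOneOne.gramOf_comp {a : Cn n [⋀^Fin 2]→L[ℝ] ℝ} (ha : IsOneOne a) (L : EndC n) :
    gramOf (a.compContinuousLinearMap (L.restrictScalars ℝ)) = star L * gramOf a * L := by
  refine ext_inner_end fun s t => ?_
  rw [(ha.comp L).inner_gramOf, herm_compContinuousLinearMap, mul_assoc]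
  change _ = inner ℂ t (star L (gramOf a (L s)))
  rw [ContinuousLinearMap.star_eq_adjoint, ContinuousLinearMap.adjoint_inner_right,
    ha.inner_gramOf]

end Gram

/-! ### Holomorphic maps -/

section Holo

variable {n : ℕ}

/-- `f` is a smooth map on the open set `U` with complex-linear derivative `L`. -/
structure HoloOn (f : Cn n → Cn n) (L : Cn n → EndC n) (U : Set (Cn n)) : Prop where
  isOpen : IsOpen U
  smooth : ContDiffOn ℝ ∞ L U
  hasFDerivAt : ∀ z ∈ U, HasFDerivAt f ((L z).restrictScalars ℝ) z

variable {f : Cn n → Cn n} {L : Cn n → EndC n} {U : Set (Cn n)} {z : Cn n}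

theorem hasFDerivAt_of_contDiffOn {E F : Type*} [NormedAddCommGroup E] [NormedSpace ℝ E]
    [NormedAddCommGroup F] [NormedSpace ℝ F]
    {g : E → F} {U : Set E} {z : E} (hg : ContDiffOn ℝ ∞ g U) (hU : IsOpen U) (hz : z ∈ U) :
    HasFDerivAt g (fderiv ℝ g z) z :=
  ((hg.contDiffAt (hU.mem_nhds hz)).differentiableAt (by simp)).hasFDerivAt

theorem HoloOn.fderiv_apply (h : HoloOn f L U) (hz : z ∈ U) (u : Cn n) :
    fderiv ℝ f z u = L z u := by
  rw [(h.hasFDerivAt z hz).fderiv]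
  rfl

theorem HoloOn.hasFDerivAt_deriv (h : HoloOn f L U) (hz : z ∈ U) :
    HasFDerivAt L (fderiv ℝ L z) z :=
  hasFDerivAt_of_contDiffOn h.smooth h.isOpen hz

theorem HoloOn.symm (h : HoloOn f L U) (hz : z ∈ U) (u w : Cn n) :
    fderiv ℝ L z u w = fderiv ℝ L z w u := by
  have h1 : ∀ᶠ y in 𝓝 z, HasFDerivAt f ((L y).restrictScalars ℝ) y :=
    Filter.eventually_of_mem (h.isOpen.mem_nhds hz) h.hasFDerivAt
  have h2 : HasFDerivAt (fun y => (L y).restrictScalars ℝ)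
      ((ContinuousLinearMap.restrictScalarsL ℂ (Cn n) (Cn n) ℝ ℝ).comp (fderiv ℝ L z)) z :=
    (ContinuousLinearMap.restrictScalarsL ℂ (Cn n) (Cn n) ℝ ℝ).hasFDerivAt.comp z
      (h.hasFDerivAt_deriv hz)
  exact second_derivative_symmetric_of_eventually h1 h2 u w

/-- Symmetry of the second derivative moves `i` into the slot where the derivative is complex-linear
by assumption. So the derivative of a holomorphic map is again holomorphic. -/
theorem HoloOn.fderiv_smul_I (h : HoloOn f L U) (hz : z ∈ U) (u : Cn n) :
    fderiv ℝ L z (Complex.I • u) = Complex.I • fderiv ℝ L z u := by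
  refine ContinuousLinearMap.ext fun w => ?_
  rw [h.symm hz, map_smul, h.symm hz]
  rfl

theorem HoloOn.contDiffOn (h : HoloOn f L U) : ContDiffOn ℝ ∞ f U := by
  have h1 : ∀ z ∈ U, fderiv ℝ f z = (L z).restrictScalars ℝ := fun z hz =>
    (h.hasFDerivAt z hz).fderiv
  rw [contDiffOn_infty_iff_fderiv_of_isOpen h.isOpen]
  refine ⟨fun z hz => (h.hasFDerivAt z hz).differentiableAt.differentiableWithinAt, ?_⟩
  refine ContDiffOn.congr ?_ h1
  exact (ContinuousLinearMap.restrictScalarsL ℂ (Cn n) (Cn n) ℝ ℝ).contDiff.comp_contDiffOn h.smooth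

end Holo

end KahlerMoment
end

noncomputable section

namespace KahlerMoment

open Topology

/-! ### Product rules in evaluated form. -/

section ProductRule

variable {E A : Type*} [NormedAddCommGroup E] [NormedSpace ℝ E] [NormedRing A] [NormedAlgebra ℝ A]

theorem hasFDerivAt_mul_apply {a b : E → A} {a' b' : E →L[ℝ] A} {z : E}
    (ha : HasFDerivAt a a' z) (hb : HasFDerivAt b b' z) :
    ∃ c' : E →L[ℝ] A, HasFDerivAt (fun y => a y * b y) c' z ∧ ∀ u, c' u = a' u * b z + a z * b' u :=
  ⟨_, ha.fun_mul' hb, fun u => by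
    simp [add_comm]⟩

theorem fderiv_mul_apply {a b : E → A} {z : E} (ha : DifferentiableAt ℝ a z)
    (hb : DifferentiableAt ℝ b z) (u : E) :
    fderiv ℝ (fun y => a y * b y) z u = fderiv ℝ a z u * b z + a z * fderiv ℝ b z u := by
  obtain ⟨c', hc, h⟩ := hasFDerivAt_mul_apply ha.hasFDerivAt hb.hasFDerivAt
  rw [hc.fderiv, h]

theorem fderiv_star_apply {n : ℕ} {a : Cn n → EndC n} {z : Cn n} (ha : DifferentiableAt ℝ a z)
    (u : Cn n) : fderiv ℝ (fun y => star (a y)) z u = star (fderiv ℝ a z u) := by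
  rw [ha.hasFDerivAt.star.fderiv]
  rfl

theorem differentiableAt_star {n : ℕ} {a : Cn n → EndC n} {z : Cn n}
    (ha : DifferentiableAt ℝ a z) : DifferentiableAt ℝ (fun y => star (a y)) z :=
  ha.hasFDerivAt.star.differentiableAt

theorem hasFDerivAt_clm_apply {F F' : Type*} [NormedAddCommGroup F] [NormedSpace ℝ F]
    [NormedAddCommGroup F'] [NormedSpace ℝ F'] {c : E → F →L[ℝ] F'} {v : E → F}
    {c' : E →L[ℝ] F →L[ℝ] F'} {v' : E →L[ℝ] F} {z : E}
    (hc : HasFDerivAt c c' z) (hv : HasFDerivAt v v' z) :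
    ∃ d : E →L[ℝ] F', HasFDerivAt (fun y => c y (v y)) d z ∧ ∀ u, d u = c' u (v z) + c z (v' u) :=
  ⟨_, hc.clm_apply hv, fun u => by simp [add_comm]⟩

theorem hasFDerivAt_end_apply {n : ℕ} {c : E → EndC n} {v : E → Cn n}
    {c' : E →L[ℝ] EndC n} {v' : E →L[ℝ] Cn n} {z : E}
    (hc : HasFDerivAt c c' z) (hv : HasFDerivAt v v' z) :
    ∃ d : E →L[ℝ] Cn n, HasFDerivAt (fun y => c y (v y)) d z ∧ ∀ u, d u = c' u (v z) + c z (v' u) :=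
  hasFDerivAt_clm_apply
    ((ContinuousLinearMap.restrictScalarsL ℂ (Cn n) (Cn n) ℝ ℝ).hasFDerivAt.comp z hc) hv

end ProductRule

/-! ### The Chern connection form and its curvature -/

section Chern

variable {n : ℕ}

/-- The form `G⁻¹ ∂G`. -/
def chernOf (G : Cn n → EndC n) (z : Cn n) : Cn n →L[ℝ] EndC n :=
  (ContinuousLinearMap.mul ℝ (EndC n) (Ring.inverse (G z))).comp (delOp G z)

theorem chernOf_apply (G : Cn n → EndC n) (z u : Cn n) :
    chernOf G z u = Ring.inverse (G z) * delOp G z u := rfl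

theorem mul_chernOf {G : Cn n → EndC n} {z : Cn n} (h : IsUnit (G z)) (u : Cn n) :
    G z * chernOf G z u = delOp G z u := by
  rw [chernOf_apply, Ring.mul_inverse_cancel_left _ _ h]

theorem contDiffOn_ringInverse {E A : Type*} [NormedAddCommGroup E] [NormedSpace ℝ E] [NormedRing A]
    [NormedAlgebra ℝ A] [CompleteSpace A] {G : E → A} {U : Set E} (hG : ContDiffOn ℝ ∞ G U)
    (hu : ∀ z ∈ U, IsUnit (G z)) : ContDiffOn ℝ ∞ (fun z => Ring.inverse (G z)) U := by
  intro z hz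
  obtain ⟨g, hg⟩ := hu z hz
  have h := contDiffAt_ringInverse ℝ (n := ∞) g
  rw [hg] at h
  exact h.comp_contDiffWithinAt z (hG z hz)

theorem contDiffOn_inverse {G : Cn n → EndC n} {U : Set (Cn n)} (hG : ContDiffOn ℝ ∞ G U)
    (hu : ∀ z ∈ U, IsUnit (G z)) : ContDiffOn ℝ ∞ (fun z => Ring.inverse (G z)) U :=
  contDiffOn_ringInverse hG hu

theorem contDiffOn_chernOf {G : Cn n → EndC n} {U : Set (Cn n)} (hU : IsOpen U)
    (hG : ContDiffOn ℝ ∞ G U) (hu : ∀ z ∈ U, IsUnit (G z)) : ContDiffOn ℝ ∞ (chernOf G) U := by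
  unfold chernOf
  exact ((ContinuousLinearMap.mul ℝ (EndC n)).contDiff.comp_contDiffOn
    (contDiffOn_inverse hG hu)).clm_comp (contDiffOn_delOp hU hG)

theorem chernOf_smul_I (G : Cn n → EndC n) (z u : Cn n) :
    chernOf G z (Complex.I • u) = Complex.I • chernOf G z u := by
  rw [chernOf_apply, chernOf_apply, delOp_smul_I, mul_smul_comm]

/-- The Chern connection form transforms as a connection form under holomorphic maps. -/
theorem chernOf_pullback {f : Cn n → Cn n} {L G G' : Cn n → EndC n} {U : Set (Cn n)} {z : Cn n}
    (hf : HoloOn f L U) (hz : z ∈ U) (hG : DifferentiableAt ℝ G (f z)) (hGu : IsUnit (G (f z)))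
    (hL : IsUnit (L z)) (hG' : ∀ y ∈ U, G' y = star (L y) * G (f y) * L y) (u : Cn n) :
    L z * chernOf G' z u = chernOf G (f z) (L z u) * L z + fderiv ℝ L z u := by
  have hLd := (hf.hasFDerivAt_deriv hz).differentiableAt
  have hGf : HasFDerivAt (fun y => G (f y)) ((fderiv ℝ G (f z)).comp ((L z).restrictScalars ℝ)) z :=
    hG.hasFDerivAt.comp z (hf.hasFDerivAt z hz)
  have hd : ∀ w, fderiv ℝ G' z w = star (fderiv ℝ L z w) * G (f z) * L z
      + star (L z) * fderiv ℝ G (f z) (L z w) * L z + star (L z) * G (f z) * fderiv ℝ L z w := by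
    intro w
    have he : G' =ᶠ[𝓝 z] fun y => star (L y) * G (f y) * L y :=
      Filter.eventually_of_mem (hf.isOpen.mem_nhds hz) hG'
    have hs := differentiableAt_star hLd
    obtain ⟨c, hc, hc'⟩ := hasFDerivAt_mul_apply hs.hasFDerivAt hGf
    rw [he.fderiv_eq, fderiv_mul_apply hc.differentiableAt hLd, hc.fderiv, hc',
      fderiv_star_apply hLd, add_mul]
    rfl
  have hsu : IsUnit (star (L z)) := hL.star
  have hG'u : IsUnit (G' z) := by
    rw [hG' z hz]
    exact (hsu.mul hGu).mul hL
  -- Multiplying by `G' z` removes the inverse. In the (1,0)-part the terms with `star (fderiv ℝ L z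
  -- u)` cancel, because `star L` is antiholomorphic.
  have key : G' z * chernOf G' z u
      = star (L z) * G (f z) * (chernOf G (f z) (L z u) * L z + fderiv ℝ L z u) := by
    rw [mul_chernOf hG'u, mul_add, mul_assoc (star (L z)), ← mul_assoc (G (f z)), mul_chernOf hGu,
      delOp_apply, delOp_apply, hd, hd, hf.fderiv_smul_I hz, map_smul]
    simp only [star_smul, RCLike.star_def, Complex.conj_I, smul_mul_assoc, mul_smul_comm, mul_sub,
      sub_mul, smul_add, smul_smul, ← mul_assoc, mul_neg, Complex.I_mul_I, neg_neg, one_smul]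
    module
  rw [hG' z hz, mul_assoc (star (L z) * G (f z))] at key
  exact (hsu.mul hGu).mul_left_cancel key

end Chern

/-! ### Curvature of a connection form and its behaviour under gauge transformations. -/

section Curvature

variable {E A : Type*} [NormedAddCommGroup E] [NormedSpace ℝ E] [NormedRing A] [NormedAlgebra ℝ A]

/-- The form `dθ + θ ∧ θ`. -/
def curvOf (θ : E → E →L[ℝ] A) (z : E) : E [⋀^Fin 2]→L[ℝ] A :=
  extDeriv (fun z => ContinuousAlternatingMap.ofSubsingleton ℝ E A (0 : Fin 1) (θ z)) z
    + wedge rfl (ContinuousAlternatingMap.ofSubsingleton ℝ E A (0 : Fin 1) (θ z))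
      (ContinuousAlternatingMap.ofSubsingleton ℝ E A (0 : Fin 1) (θ z))

theorem wedge_ofSubsingleton_apply (a b : E →L[ℝ] A) (u w : E) :
    wedge (r := 2) rfl (ContinuousAlternatingMap.ofSubsingleton ℝ E A (0 : Fin 1) a)
      (ContinuousAlternatingMap.ofSubsingleton ℝ E A (0 : Fin 1) b) ![u, w]
      = a u * b w - a w * b u := by
  rw [wedge_apply, altSum_eq_sum_removeNth, Fin.sum_univ_two]
  have h : ∀ (v v' : E), altSum (fun w' : Fin 1 → E =>
      ContinuousAlternatingMap.ofSubsingleton ℝ E A (0 : Fin 1) a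
        (firstVec (p := 1) (q := 1) rfl (Fin.cons v w')) *
      ContinuousAlternatingMap.ofSubsingleton ℝ E A (0 : Fin 1) b
        (lastVec (p := 1) (q := 1) rfl (Fin.cons v w'))) (fun _ => v') = a v * b v' := by
    intro v v'
    simp [altSum, firstVec, lastVec]
  have h0 : Fin.removeNth 0 ![u, w] = fun _ => w := by funext i; fin_cases i; rfl
  have h1 : Fin.removeNth 1 ![u, w] = fun _ => u := by funext i; fin_cases i; rfl
  rw [h0, h1]
  have e0 := h u w
  have e1 := h w u
  simp only [Matrix.cons_val_zero, Matrix.cons_val_one]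
  rw [e0, e1]
  simp [sub_eq_add_neg]

theorem hasFDerivAt_ofSubsingleton {θ : E → E →L[ℝ] A} {z : E} (hθ : DifferentiableAt ℝ θ z) :
    ∃ D : E →L[ℝ] (E [⋀^Fin 1]→L[ℝ] A),
      HasFDerivAt (fun z => ContinuousAlternatingMap.ofSubsingleton ℝ E A (0 : Fin 1) (θ z)) D z ∧
      ∀ u, D u = ContinuousAlternatingMap.ofSubsingleton ℝ E A (0 : Fin 1) (fderiv ℝ θ z u) := by
  let T := (ContinuousAlternatingMap.ofSubsingletonLIE (𝕜 := ℝ) (E := E) (F := A)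
    (0 : Fin 1)).toContinuousLinearEquiv
  exact ⟨_, T.hasFDerivAt.comp z hθ.hasFDerivAt, fun u => rfl⟩

theorem curvOf_apply {θ : E → E →L[ℝ] A} {z : E} (hθ : DifferentiableAt ℝ θ z)
    (u w : E) : curvOf θ z ![u, w] = fderiv ℝ θ z u w - fderiv ℝ θ z w u
      + (θ z u * θ z w - θ z w * θ z u) := by
  rw [curvOf, ContinuousAlternatingMap.add_apply, wedge_ofSubsingleton_apply,
    extDeriv_oneForm_apply]
  obtain ⟨D, hD, hD'⟩ := hasFDerivAt_ofSubsingleton hθ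
  rw [hD.fderiv, hD', hD']
  rfl

/-- The algebra of the gauge law: `m` is the gauge with derivatives `mu`, `mw`; `a`, `b` and `p`,
`q` are the values of the two connection forms on the two vectors. The terms `s` and `x` come from
second derivatives of the map and of the gauge; being symmetric, they are the same in `e1` and `e2`
and drop out of the difference. -/
theorem gauge_identity {R : Type*} [Ring R] {m mu mw a b da db p q dp dq s x : R}
    (g1 : m * a = p * m + mu) (g2 : m * b = q * m + mw)
    (e1 : mu * b + m * da = (dp + s) * m + q * mu + x)
    (e2 : mw * a + m * db = (dq + s) * m + p * mw + x) :
    m * (da - db + (a * b - b * a)) = (dp - dq + (p * q - q * p)) * m := by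
  have hab : m * (a * b) = p * q * m + p * mw + mu * b := by
    rw [← mul_assoc, g1, add_mul, mul_assoc, g2, mul_add, mul_assoc]
  have hba : m * (b * a) = q * p * m + q * mu + mw * a := by
    rw [← mul_assoc, g2, add_mul, mul_assoc, g1, mul_add, mul_assoc]
  rw [mul_add, mul_sub, mul_sub, hab, hba, eq_sub_of_add_eq' e1, eq_sub_of_add_eq' e2]
  noncomm_ring

theorem fderiv_fderiv_symm {F : Type*} [NormedAddCommGroup F] [NormedSpace ℝ F]
    {g : E → F} {U : Set E} {z : E} (hg : ContDiffOn ℝ ∞ g U) (hU : IsOpen U) (hz : z ∈ U)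
    (u w : E) : fderiv ℝ (fderiv ℝ g) z u w = fderiv ℝ (fderiv ℝ g) z w u :=
  (hg.contDiffAt (hU.mem_nhds hz)).isSymmSndFDerivAt (by
    rw [minSmoothness_of_isRCLikeNormedField]; exact WithTop.coe_le_coe.mpr le_top) u w

/-- The curvature transforms as a tensor under changes of frame and pull-back. -/
theorem curvOf_gauge {f : E → E} {ℓ : E → E →L[ℝ] E} {M : E → A} {U : Set E} {z : E}
    {θ θ' : E → E →L[ℝ] A} (hU : IsOpen U) (hz : z ∈ U) (hf : ∀ y ∈ U, HasFDerivAt f (ℓ y) y)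
    (hℓ : ContDiffOn ℝ ∞ ℓ U)
    (hM : ContDiffOn ℝ ∞ M U) (hθ : DifferentiableAt ℝ θ (f z)) (hθ' : DifferentiableAt ℝ θ' z)
    (h : ∀ y ∈ U, ∀ u, M y * θ' y u = θ (f y) (ℓ y u) * M y + fderiv ℝ M y u) (u w : E) :
    M z * curvOf θ' z ![u, w] = curvOf θ (f z) ![ℓ z u, ℓ z w] * M z := by
  have hMd := hasFDerivAt_of_contDiffOn hM hU hz
  have hMdd : HasFDerivAt (fderiv ℝ M) (fderiv ℝ (fderiv ℝ M) z) z :=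
    hasFDerivAt_of_contDiffOn (hM.fderiv_of_isOpen hU (m := ∞) (by simp)) hU hz
  have hℓd := hasFDerivAt_of_contDiffOn hℓ hU hz
  have hd : ∀ u w, fderiv ℝ M z u * θ' z w + M z * fderiv ℝ θ' z u w
      = (fderiv ℝ θ (f z) (ℓ z u) (ℓ z w) + θ (f z) (fderiv ℝ ℓ z u w)) * M z
        + θ (f z) (ℓ z w) * fderiv ℝ M z u + fderiv ℝ (fderiv ℝ M) z u w := by
    intro u w
    obtain ⟨a₁, h₁, h₁'⟩ := hasFDerivAt_clm_apply hθ'.hasFDerivAt (hasFDerivAt_const w z)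
    obtain ⟨a₂, h₂, h₂'⟩ := hasFDerivAt_clm_apply hℓd (hasFDerivAt_const w z)
    have h₀ : HasFDerivAt (fun y => θ (f y)) ((fderiv ℝ θ (f z)).comp (ℓ z)) z :=
      hθ.hasFDerivAt.comp z (hf z hz)
    obtain ⟨a₃, h₃, h₃'⟩ := hasFDerivAt_clm_apply h₀ h₂
    obtain ⟨a₄, h₄, h₄'⟩ := hasFDerivAt_mul_apply h₃ hMd
    obtain ⟨a₅, h₅, h₅'⟩ := hasFDerivAt_clm_apply hMdd (hasFDerivAt_const w z)
    obtain ⟨a₆, h₆, h₆'⟩ := hasFDerivAt_mul_apply hMd h₁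
    have he : (fun y => M y * θ' y w) =ᶠ[𝓝 z] fun y => θ (f y) (ℓ y w) * M y + fderiv ℝ M y w :=
      Filter.eventually_of_mem (hU.mem_nhds hz) fun y hy => h y hy w
    have hu := congrArg (fun T : E →L[ℝ] A => T u)
      ((h₆.congr_of_eventuallyEq he.symm).unique (h₄.add h₅))
    simp only [add_apply, h₆', h₁', h₄', h₃', h₂', h₅', zero_apply, map_zero, add_zero] at hu
    exact hu
  have hs : fderiv ℝ ℓ z u w = fderiv ℝ ℓ z w u :=
    second_derivative_symmetric_of_eventually
      (Filter.eventually_of_mem (hU.mem_nhds hz) hf) hℓd u w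
  have e1 := hd u w
  have e2 := hd w u
  rw [fderiv_fderiv_symm hM hU hz w u, ← hs] at e2
  rw [curvOf_apply hθ', curvOf_apply hθ]
  exact gauge_identity (h z hz u) (h z hz w) e1 e2

end Curvature

end KahlerMoment
end

noncomputable section

namespace KahlerMoment

open Topology

/-! ### Differentiating the value of a form on fixed vectors. -/

section Eval

variable {E F : Type*} [NormedAddCommGroup E] [NormedSpace ℝ E] [NormedAddCommGroup F]
  [NormedSpace ℝ F] {p : ℕ}

/-- Evaluation of alternating forms at a tuple of vectors. -/
def evalForm (m : Fin p → E) : (E [⋀^Fin p]→L[ℝ] F) →L[ℝ] F :=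
  LinearMap.mkContinuous
    { toFun := fun a => a m
      map_add' := fun _ _ => rfl
      map_smul' := fun _ _ => rfl } (∏ i, ‖m i‖) fun a => by
        rw [mul_comm]; exact a.le_opNorm m

@[simp]
theorem evalForm_apply (m : Fin p → E) (a : E [⋀^Fin p]→L[ℝ] F) : evalForm m a = a m := rfl

theorem fderiv_form_apply {η : E → E [⋀^Fin p]→L[ℝ] F} {z : E} (hη : DifferentiableAt ℝ η z)
    (u : E) (m : Fin p → E) : fderiv ℝ (fun y => η y m) z u = fderiv ℝ η z u m := by
  have h : HasFDerivAt (fun y => η y m) ((evalForm m).comp (fderiv ℝ η z)) z :=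
    (evalForm (F := F) m).hasFDerivAt.comp z hη.hasFDerivAt
  rw [h.fderiv]
  rfl

end Eval

/-! ### The Gram operator of a Kähler form, and torsion-freeness. -/

section Kahler

variable {n : ℕ}

/-- The operator representing a Hermitian form, as a linear function of the form. -/
def gramL : (Cn n [⋀^Fin 2]→L[ℝ] ℝ) →L[ℝ] EndC n :=
  ∑ β : Fin n, ∑ γ : Fin n,
    ((1 / 2 : ℂ) • ((evalForm ![EuclideanSpace.single γ (1 : ℂ),
        Complex.I • EuclideanSpace.single β (1 : ℂ)]).smulRight
          (Matrix.toEuclideanCLM (𝕜 := ℂ) (Matrix.single β γ (1 : ℂ)) : EndC n)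
      - Complex.I • (evalForm ![EuclideanSpace.single γ (1 : ℂ),
        EuclideanSpace.single β (1 : ℂ)]).smulRight
          (Matrix.toEuclideanCLM (𝕜 := ℂ) (Matrix.single β γ (1 : ℂ)) : EndC n)))

theorem gramL_apply (a : Cn n [⋀^Fin 2]→L[ℝ] ℝ) : gramL a = gramOf a := by
  have h : (Matrix.of fun β γ : Fin n =>
      herm a (EuclideanSpace.single γ 1) (EuclideanSpace.single β 1))
      = ∑ β : Fin n, ∑ γ : Fin n, herm a (EuclideanSpace.single γ 1) (EuclideanSpace.single β 1) •
        Matrix.single β γ (1 : ℂ) := by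
    conv_lhs => rw [Matrix.matrix_eq_sum_single (Matrix.of fun β γ : Fin n =>
      herm a (EuclideanSpace.single γ 1) (EuclideanSpace.single β 1))]
    simp
  rw [gramOf, h, map_sum, gramL, sum_apply]
  refine Finset.sum_congr rfl fun β _ => ?_
  rw [map_sum, sum_apply]
  refine Finset.sum_congr rfl fun γ _ => ?_
  have hm : ∀ (x y : ℝ) (M : EndC n), ((1 / 2 : ℂ) * ((x : ℂ) - Complex.I * (y : ℂ))) • M
      = (1 / 2 : ℂ) • (x • M - Complex.I • y • M) := fun x y M => by
    refine ContinuousLinearMap.ext fun v => ?_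
    change ((1 / 2 : ℂ) * ((x : ℂ) - Complex.I * (y : ℂ))) • M v = (1 / 2 : ℂ) • (x • M v - Complex.I • y • M v)
    rw [← Complex.coe_smul x, ← Complex.coe_smul y]
    module
  rw [map_smul]
  exact (hm _ _ _).symm

theorem contDiffOn_gramOf {η : Cn n → Cn n [⋀^Fin 2]→L[ℝ] ℝ} {U : Set (Cn n)}
    (hη : ContDiffOn ℝ ∞ η U) : ContDiffOn ℝ ∞ (fun z => gramOf (η z)) U := by
  simp only [← gramL_apply]
  exact gramL.contDiff.comp_contDiffOn hη

variable {η : Cn n → Cn n [⋀^Fin 2]→L[ℝ] ℝ} {U : Set (Cn n)} {z : Cn n}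

theorem fderiv_gramOf (hη : DifferentiableAt ℝ η z) (u : Cn n) :
    fderiv ℝ (fun z => gramOf (η z)) z u = gramOf (fderiv ℝ η z u) := by
  have h : HasFDerivAt (fun z => gramL (η z)) (gramL.comp (fderiv ℝ η z)) z :=
    gramL.hasFDerivAt.comp z hη.hasFDerivAt
  simp only [gramL_apply] at h
  rw [h.fderiv, ContinuousLinearMap.comp_apply, gramL_apply]

theorem isOneOne_fderiv (hη : DifferentiableAt ℝ η z) (hU : IsOpen U) (hz : z ∈ U)
    (h : ∀ y ∈ U, IsOneOne (η y)) (u : Cn n) : IsOneOne (fderiv ℝ η z u) := by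
  intro v w
  rw [← fderiv_form_apply hη, ← fderiv_form_apply hη]
  have he : (fun y => η y ![Complex.I • v, Complex.I • w]) =ᶠ[𝓝 z] fun y => η y ![v, w] :=
    Filter.eventually_of_mem (hU.mem_nhds hz) fun y hy => h y hy v w
  rw [he.fderiv_eq]

/-- The Chern connection of a Kähler metric is torsion-free. -/
theorem chernOf_gramOf_symm (hη : DifferentiableAt ℝ η z) (hU : IsOpen U) (hz : z ∈ U)
    (h : ∀ y ∈ U, IsPositiveOneOne (η y)) (hd : extDeriv η z = 0) (u w : Cn n) :
    chernOf (fun z => gramOf (η z)) z u w = chernOf (fun z => gramOf (η z)) z w u := by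
  have hu := (h z hz).isUnit_gramOf
  have hD := isOneOne_fderiv hη hU hz (fun y hy => (h y hy).oneOne)
  have hinj : Function.Injective (gramOf (η z)) := by
    obtain ⟨M, hM⟩ := hu.exists_left_inv
    intro a b hab
    have := congrArg M hab
    have e : ∀ c, M (gramOf (η z) c) = c := fun c => congrArg (fun T : EndC n => T c) hM
    rwa [e, e] at this
  apply hinj
  refine ext_inner_left ℂ fun t => ?_
  have key : ∀ u w, inner ℂ t (gramOf (η z) (chernOf (fun z => gramOf (η z)) z u w))
      = (1 / 2 : ℂ) * (herm (fderiv ℝ η z u) w t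
        - Complex.I * herm (fderiv ℝ η z (Complex.I • u)) w t) := by
    intro u w
    have e : gramOf (η z) (chernOf (fun z => gramOf (η z)) z u w)
        = (gramOf (η z) * chernOf (fun z => gramOf (η z)) z u) w := rfl
    rw [e, mul_chernOf (G := fun z => gramOf (η z)) hu, delOp_apply, fderiv_gramOf hη,
      fderiv_gramOf hη]
    change inner ℂ t ((1 / 2 : ℂ) • (gramOf (fderiv ℝ η z u) w
      - Complex.I • gramOf (fderiv ℝ η z (Complex.I • u)) w)) = _
    rw [inner_smul_right, inner_sub_right, inner_smul_right, (hD _).inner_gramOf,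
      (hD _).inner_gramOf]
  have hc : ∀ a b c, fderiv ℝ η z a ![b, c] - fderiv ℝ η z b ![a, c] + fderiv ℝ η z c ![a, b] = 0 :=
    fun a b c => by rw [← extDeriv_twoForm_apply, hd]; rfl
  -- After pairing with `t`, only the component of dω which is complex-linear in `u` and `w` and
  -- conjugate-linear in `t` is needed. It is assembled from these four real values, rewritten using
  -- type (1,1).
  have c1 := hc u w (Complex.I • t)
  have c2 := hc u w t
  have c3 := hc (Complex.I • u) (Complex.I • w) t
  have c4 := hc (Complex.I • u) (Complex.I • w) (Complex.I • t)
  rw [(hD _).apply_I_left, (hD _).apply_I_left, (hD _)] at c3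
  rw [(hD _), (hD _), (hD _)] at c4
  rw [key, key]
  simp only [herm]
  have c1' := congrArg (fun x : ℝ => (x : ℂ)) c1
  have c2' := congrArg (fun x : ℝ => (x : ℂ)) c2
  have c3' := congrArg (fun x : ℝ => (x : ℂ)) c3
  have c4' := congrArg (fun x : ℝ => (x : ℂ)) c4
  push_cast at c1' c2' c3' c4'
  linear_combination (1 / 4 : ℂ) * c1' - (1 / 4 : ℂ) * Complex.I * c2'
    + (1 / 4 : ℂ) * Complex.I * c3' - (1 / 4 : ℂ) * c4' +
    (1 / 4 : ℂ) * ((fderiv ℝ η z (Complex.I • u) ![w, t] : ℂ)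
      - (fderiv ℝ η z (Complex.I • w) ![u, t] : ℂ)) * Complex.I_sq

/-- Torsion-freeness is invariant under holomorphic maps. -/
theorem chernOf_symm_pullback {f : Cn n → Cn n} {L G G' : Cn n → EndC n} {U : Set (Cn n)}
    {z : Cn n} (hf : HoloOn f L U) (hz : z ∈ U) (hG : DifferentiableAt ℝ G (f z))
    (hGu : IsUnit (G (f z))) (hL : IsUnit (L z))
    (hG' : ∀ y ∈ U, G' y = star (L y) * G (f y) * L y)
    (hs : ∀ u w, chernOf G (f z) u w = chernOf G (f z) w u) (u w : Cn n) :
    chernOf G' z u w = chernOf G' z w u := by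
  have key := chernOf_pullback hf hz hG hGu hL hG'
  have e : ∀ u w, L z (chernOf G' z u w) = chernOf G (f z) (L z u) (L z w) + fderiv ℝ L z u w :=
    fun u w => congrArg (fun T : EndC n => T w) (key u)
  obtain ⟨M, hM⟩ := hL.exists_left_inv
  have e' : ∀ c, M (L z c) = c := fun c => congrArg (fun T : EndC n => T c) hM
  rw [← e' (chernOf G' z u w), ← e' (chernOf G' z w u), e, e, hs, hf.symm hz]

end Kahler

/-! ### The complex Hessian -/

section Hessian

variable {n : ℕ}

/-- The operator representing the complex Hessian. -/
def hessOf (h : Cn n → ℝ) (z : Cn n) : EndC n :=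
  Matrix.toEuclideanCLM (𝕜 := ℂ) (Matrix.of fun β γ : Fin n =>
    delbarOp (fun z' => delOp (fun z'' => ((h z'' : ℝ) : ℂ)) z'
      (EuclideanSpace.single γ 1)) z (EuclideanSpace.single β 1))

/-- The complex Hessian `∂_t̄ ∂_s` in terms of the real Hessian `Q`. -/
def levi (Q : Cn n →L[ℝ] Cn n →L[ℝ] ℝ) (s t : Cn n) : ℂ :=
  (1 / 4 : ℂ) * ((Q t s : ℂ) - Complex.I * (Q t (Complex.I • s) : ℂ)
    + Complex.I * (Q (Complex.I • t) s : ℂ) + (Q (Complex.I • t) (Complex.I • s) : ℂ))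

theorem levi_add_left (Q : Cn n →L[ℝ] Cn n →L[ℝ] ℝ) (s s' t : Cn n) :
    levi Q (s + s') t = levi Q s t + levi Q s' t := by
  simp only [levi, smul_add, map_add]
  push_cast
  ring

theorem levi_add_right (Q : Cn n →L[ℝ] Cn n →L[ℝ] ℝ) (s t t' : Cn n) :
    levi Q s (t + t') = levi Q s t + levi Q s t' := by
  simp only [levi, smul_add, map_add, add_apply]
  push_cast
  ring

theorem levi_smul_left (Q : Cn n →L[ℝ] Cn n →L[ℝ] ℝ) (c : ℂ) (s t : Cn n) :
    levi Q (c • s) t = c * levi Q s t := by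
  have hI : ∀ (r : ℝ) (x : Cn n), Complex.I • r • x = r • Complex.I • x :=
    fun r x => smul_comm _ _ _
  rw [smul_eq_re_add_im]
  conv_rhs => rw [← Complex.re_add_im c]
  simp only [levi, smul_add, map_add, hI, smul_smul Complex.I Complex.I,
    Complex.I_mul_I, neg_one_smul, map_smul, map_neg, smul_eq_mul]
  push_cast
  linear_combination (1 / 4 : ℂ) * c.im * (Q t (Complex.I • s)
    - Q (Complex.I • t) s) * Complex.I_sq

theorem levi_smul_right (Q : Cn n →L[ℝ] Cn n →L[ℝ] ℝ) (c : ℂ) (s t : Cn n) :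
    levi Q s (c • t) = starRingEnd ℂ c * levi Q s t := by
  rw [smul_eq_re_add_im]
  have hc : starRingEnd ℂ c = c.re - c.im * Complex.I := by
    apply Complex.ext <;> simp
  have hI : ∀ (r : ℝ) (x : Cn n), Complex.I • r • x = r • Complex.I • x :=
    fun r x => smul_comm _ _ _
  rw [hc]
  simp only [levi, smul_add, map_add, hI, smul_smul Complex.I Complex.I,
    Complex.I_mul_I, neg_one_smul, map_smul, map_neg, smul_eq_mul, add_apply, neg_apply, smul_apply]
  push_cast
  linear_combination (1 / 4 : ℂ) * c.im * (- Q t (Complex.I • s)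
    + Q (Complex.I • t) s) * Complex.I_sq

theorem conj_levi {Q : Cn n →L[ℝ] Cn n →L[ℝ] ℝ} (hQ : ∀ u w, Q u w = Q w u) (s t : Cn n) :
    starRingEnd ℂ (levi Q s t) = levi Q t s := by
  simp only [levi, map_mul, map_sub, map_add, Complex.conj_ofReal, Complex.conj_I,
    map_div₀, map_one, map_ofNat]
  rw [hQ s t, hQ s (Complex.I • t), hQ (Complex.I • s) t, hQ (Complex.I • s) (Complex.I • t)]
  ring

variable {h : Cn n → ℝ} {U : Set (Cn n)} {z : Cn n}

theorem hasFDerivAt_ofReal {g : Cn n → ℝ} {g' : Cn n →L[ℝ] ℝ} (hg : HasFDerivAt g g' z) :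
    HasFDerivAt (fun y => (g y : ℂ)) (Complex.ofRealCLM.comp g') z :=
  Complex.ofRealCLM.hasFDerivAt.comp z hg

theorem delOp_ofReal {g : Cn n → ℝ} {g' : Cn n →L[ℝ] ℝ} (hg : HasFDerivAt g g' z) (s : Cn n) :
    delOp (fun y => (g y : ℂ)) z s
      = (1 / 2 : ℂ) * ((g' s : ℂ) - Complex.I * (g' (Complex.I • s) : ℂ)) := by
  rw [delOp_apply, (hasFDerivAt_ofReal hg).fderiv]
  rfl

theorem hasFDerivAt_fderiv_apply (hh : ContDiffOn ℝ ∞ h U) (hU : IsOpen U) (hz : z ∈ U)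
    (s : Cn n) : HasFDerivAt (fun y => fderiv ℝ h y s) ((fderiv ℝ (fderiv ℝ h) z).flip s) z := by
  have h1 : HasFDerivAt (fderiv ℝ h) (fderiv ℝ (fderiv ℝ h) z) z :=
    hasFDerivAt_of_contDiffOn (hh.fderiv_of_isOpen hU (m := ∞) (by simp)) hU hz
  obtain ⟨d, hd, hd'⟩ := hasFDerivAt_clm_apply h1 (hasFDerivAt_const s z)
  have : d = (fderiv ℝ (fderiv ℝ h) z).flip s := by
    ext u
    simp [hd']
  rwa [this] at hd

theorem delbarOp_delOp (hh : ContDiffOn ℝ ∞ h U) (hU : IsOpen U) (hz : z ∈ U) (s t : Cn n) :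
    delbarOp (fun z' => delOp (fun z'' => ((h z'' : ℝ) : ℂ)) z' s) z t
      = levi (fderiv ℝ (fderiv ℝ h) z) s t := by
  have h1 : (fun z' => delOp (fun z'' => ((h z'' : ℝ) : ℂ)) z' s) =ᶠ[𝓝 z] fun z' =>
      (1 / 2 : ℂ) * ((fderiv ℝ h z' s : ℂ) - Complex.I * (fderiv ℝ h z' (Complex.I • s) : ℂ)) :=
    Filter.eventually_of_mem (hU.mem_nhds hz) fun y hy =>
      delOp_ofReal (hasFDerivAt_of_contDiffOn hh hU hy) s
  have h2 := hasFDerivAt_ofReal (hasFDerivAt_fderiv_apply hh hU hz s)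
  have h3 := hasFDerivAt_ofReal (hasFDerivAt_fderiv_apply hh hU hz (Complex.I • s))
  have h4 := (h2.fun_sub (h3.const_mul Complex.I)).const_mul (1 / 2 : ℂ)
  rw [delbarOp_apply, h1.fderiv_eq, h4.fderiv]
  simp [levi]
  linear_combination (1 / 4 : ℂ) * -(fderiv ℝ (fderiv ℝ h) z (Complex.I • t) (Complex.I • s)) *
    Complex.I_sq

theorem inner_hessOf (hh : ContDiffOn ℝ ∞ h U) (hU : IsOpen U) (hz : z ∈ U) (s t : Cn n) :
    inner ℂ t (hessOf h z s) = levi (fderiv ℝ (fderiv ℝ h) z) s t := by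
  have e : hessOf h z = Matrix.toEuclideanCLM (𝕜 := ℂ) (Matrix.of fun β γ : Fin n =>
      levi (fderiv ℝ (fderiv ℝ h) z) (EuclideanSpace.single γ 1) (EuclideanSpace.single β 1)) := by
    rw [hessOf]
    congr 2
    funext β γ
    exact delbarOp_delOp hh hU hz _ _
  rw [e]
  exact inner_matrix_sesquilinear (levi _) (levi_add_left _) (levi_smul_left _)
    (levi_add_right _) (levi_smul_right _) s t

theorem star_hessOf (hh : ContDiffOn ℝ ∞ h U) (hU : IsOpen U) (hz : z ∈ U) :
    star (hessOf h z) = hessOf h z := by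
  refine ext_inner_end fun s t => ?_
  rw [ContinuousLinearMap.star_eq_adjoint, ContinuousLinearMap.adjoint_inner_right,
    inner_hessOf hh hU hz, ← inner_conj_symm, inner_hessOf hh hU hz,
    conj_levi (fderiv_fderiv_symm hh hU hz)]

/-- The complex Hessian is natural under holomorphic maps. -/
theorem hessOf_pullback {f : Cn n → Cn n} {L : Cn n → EndC n} {V : Set (Cn n)}
    (hf : HoloOn f L V) (hz : z ∈ V) (hh : ContDiffOn ℝ ∞ h U) (hU : IsOpen U)
    (hfU : Set.MapsTo f V U) :
    hessOf (fun y => h (f y)) z = star (L z) * hessOf h (f z) * L z := by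
  have hhf : ContDiffOn ℝ ∞ (fun y => h (f y)) V := hh.comp hf.contDiffOn hfU
  have hQ : ∀ u w, fderiv ℝ (fderiv ℝ (fun y => h (f y))) z u w
      = fderiv ℝ (fderiv ℝ h) (f z) (L z u) (L z w) + fderiv ℝ h (f z) (fderiv ℝ L z u w) := by
    intro u w
    have h1 := hasFDerivAt_fderiv_apply hhf hf.isOpen hz w
    have h2 : (fun y => fderiv ℝ (fun y => h (f y)) y w) =ᶠ[𝓝 z] fun y =>
        fderiv ℝ h (f y) (L y w) :=
      Filter.eventually_of_mem (hf.isOpen.mem_nhds hz) fun y hy => by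
        have := (hasFDerivAt_of_contDiffOn hh hU (hfU hy)).comp y (hf.hasFDerivAt y hy)
        change fderiv ℝ (h ∘ f) y w = _
        rw [this.fderiv]
        rfl
    obtain ⟨d, hd, hd'⟩ := hasFDerivAt_end_apply (hf.hasFDerivAt_deriv hz) (hasFDerivAt_const w z)
    have h3 : HasFDerivAt (fderiv ℝ h) (fderiv ℝ (fderiv ℝ h) (f z)) (f z) :=
      hasFDerivAt_of_contDiffOn (hh.fderiv_of_isOpen hU (m := ∞) (by simp)) hU (hfU hz)
    have h4 : HasFDerivAt (fun y => fderiv ℝ h (f y))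
        ((fderiv ℝ (fderiv ℝ h) (f z)).comp ((L z).restrictScalars ℝ)) z :=
      h3.comp z (hf.hasFDerivAt z hz)
    obtain ⟨e, he, he'⟩ := hasFDerivAt_clm_apply h4 hd
    have := congrArg (fun T : Cn n →L[ℝ] ℝ => T u)
      ((h1.congr_of_eventuallyEq h2.symm).unique he)
    simpa [he', hd'] using this
  refine ext_inner_end fun s t => ?_
  rw [inner_hessOf hhf hf.isOpen hz, mul_assoc]
  change _ = inner ℂ t (star (L z) (hessOf h (f z) (L z s)))
  rw [ContinuousLinearMap.star_eq_adjoint, ContinuousLinearMap.adjoint_inner_right,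
    inner_hessOf hh hU (hfU hz)]
  -- The chain rule leaves a term with the first derivative of `h` applied to the second derivative
  -- of `f`. The latter is complex-bilinear, so its contributions to the four summands of `levi`
  -- cancel in pairs.
  simp only [levi, hQ, map_smul, hf.fderiv_smul_I hz, smul_apply, smul_smul, Complex.I_mul_I,
    neg_one_smul, map_neg]
  push_cast
  ring

end Hessian

end KahlerMoment
end

noncomputable section

namespace KahlerMoment

open Topology

/-! ### The moment map identity in a chart -/

section Identities

variable {R : Type*} [Ring R]

/-- With `θs`, `hs`, `dhs` read as adjoints, `m1` is metric compatibility, `s1` is skewness of `h`,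
and `s2` is the derivative of `s1`. Eliminating `dg` makes the covariant derivative appear. -/
theorem skew_moment_identity {g dg θ θs h hs dh dhs : R} (m1 : dg = g * θ + θs * g)
    (s1 : hs * g = -(g * h)) (s2 : dhs * g + hs * dg = -(dg * h + g * dh)) :
    g * (dh + (θ * h - h * θ)) + (dhs + (hs * θs - θs * hs)) * g = 0 := by
  have e : dhs * g = -(dg * h + g * dh) - hs * dg := eq_sub_of_add_eq s2
  have e2 : hs * dg = -(g * h) * θ + hs * θs * g := by
    rw [m1, mul_add, ← mul_assoc, s1, mul_assoc]
  have e3 : θs * hs * g = -(θs * g * h) := by rw [mul_assoc, s1, mul_neg, mul_assoc]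
  rw [add_mul, sub_mul, e, e2, e3, m1]
  noncomm_ring

/-- The equation `e` equates the two mixed second derivatives of the metric, each computed from
metric compatibility. Substituting `hu` and `hw` leaves exactly the skewness of the curvature. -/
theorem skew_curvature_identity {g du dw x y xs ys a b as bs : R} (hu : du = g * a + as * g)
    (hw : dw = g * b + bs * g)
    (e : dw * a + g * x + (xs * g + as * dw) = du * b + g * y + (ys * g + bs * du)) :
    g * (x - y + (b * a - a * b)) + (xs - ys + (as * bs - bs * as)) * g = 0 := by
  rw [hu, hw] at e
  have e' := sub_eq_zero.mpr e
  rw [← e']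
  noncomm_ring

theorem star_add_commutator [StarRing R] (c a b : R) :
    star (c + (a * b - b * a)) = star c + (star b * star a - star a * star b) := by
  simp only [star_add, star_sub, star_mul]

theorem star_sub_add_commutator [StarRing R] (x y a b : R) :
    star (x - y + (b * a - a * b))
      = star x - star y + (star a * star b - star b * star a) := by
  simp only [star_add, star_sub, star_mul]

theorem skew_add [StarRing R] {g a b : R} (ha : g * a + star a * g = 0)
    (hb : g * b + star b * g = 0) : g * (a + b) + star (a + b) * g = 0 := by
  rw [star_add, mul_add, add_mul, add_add_add_comm, ha, hb, add_zero]

theorem star_half_sub_I [StarRing R] [Algebra ℂ R] [StarModule ℂ R] (a b : R) :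
    star ((1 / 2 : ℂ) • (a - Complex.I • b))
      = (1 / 2 : ℂ) • (star a + Complex.I • star b) := by
  rw [star_smul, star_sub, star_smul]
  simp

end Identities

/-! ### Hamiltonian holomorphic vector fields in a chart. -/

section LocalMoment

variable {n : ℕ} {U : Set (Cn n)} {z : Cn n}

theorem star_fderiv_eq {G : Cn n → EndC n} (hU : IsOpen U) (hz : z ∈ U)
    (hG : DifferentiableAt ℝ G z) (hs : ∀ y ∈ U, star (G y) = G y) (u : Cn n) :
    star (fderiv ℝ G z u) = fderiv ℝ G z u := by
  rw [← fderiv_star_apply hG]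
  have he : (fun y => star (G y)) =ᶠ[𝓝 z] G := Filter.eventually_of_mem (hU.mem_nhds hz) hs
  rw [he.fderiv_eq]

/-- The Chern connection is compatible with the metric. -/
theorem fderiv_eq_mul_chernOf {G : Cn n → EndC n} (hU : IsOpen U) (hz : z ∈ U)
    (hG : DifferentiableAt ℝ G z) (hs : ∀ y ∈ U, star (G y) = G y) (hu : IsUnit (G z)) (u : Cn n) :
    fderiv ℝ G z u = G z * chernOf G z u + star (chernOf G z u) * G z := by
  have h1 : star (chernOf G z u) * G z = star (delOp G z u) := by
    rw [← mul_chernOf hu, star_mul, hs z hz]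
  rw [h1, mul_chernOf hu, fderiv_eq_delOp_add_delbarOp]
  congr 1
  rw [delOp_apply, delbarOp_apply]
  refine Eq.trans ?_ (star_half_sub_I _ _).symm
  rw [star_fderiv_eq hU hz hG hs, star_fderiv_eq hU hz hG hs]

/-- The curvature of the Chern connection is skew-adjoint. -/
theorem curvOf_chernOf_skew {G : Cn n → EndC n} (hU : IsOpen U) (hz : z ∈ U)
    (hG : ContDiffOn ℝ ∞ G U) (hs : ∀ y ∈ U, star (G y) = G y) (hu : ∀ y ∈ U, IsUnit (G y))
    (w u : Cn n) :
    G z * curvOf (chernOf G) z ![w, u] + star (curvOf (chernOf G) z ![w, u]) * G z = 0 := by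
  have hGd := fun y hy => (hasFDerivAt_of_contDiffOn hG hU (z := y) hy).differentiableAt
  have hθ := hasFDerivAt_of_contDiffOn (contDiffOn_chernOf hU hG hu) hU hz
  have hm := fun y hy => fderiv_eq_mul_chernOf hU hy (hGd y hy) hs (hu y hy)
  have hGdd : HasFDerivAt (fderiv ℝ G) (fderiv ℝ (fderiv ℝ G) z) z :=
    hasFDerivAt_of_contDiffOn (hG.fderiv_of_isOpen hU (m := ∞) (by simp)) hU hz
  have hd : ∀ w u, fderiv ℝ (fderiv ℝ G) z w u =
      fderiv ℝ G z w * chernOf G z u + G z * fderiv ℝ (chernOf G) z w u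
      + (star (fderiv ℝ (chernOf G) z w u) * G z + star (chernOf G z u) * fderiv ℝ G z w) := by
    intro w u
    obtain ⟨a₁, h₁, h₁'⟩ := hasFDerivAt_clm_apply hGdd (hasFDerivAt_const u z)
    obtain ⟨a₂, h₂, h₂'⟩ := hasFDerivAt_clm_apply hθ (hasFDerivAt_const u z)
    obtain ⟨a₃, h₃, h₃'⟩ := hasFDerivAt_mul_apply (hGd z hz).hasFDerivAt h₂
    have h₄ := (differentiableAt_star h₂.differentiableAt).hasFDerivAt
    obtain ⟨a₅, h₅, h₅'⟩ := hasFDerivAt_mul_apply h₄ (hGd z hz).hasFDerivAt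
    have he : (fun y => fderiv ℝ G y u) =ᶠ[𝓝 z] fun y =>
        G y * chernOf G y u + star (chernOf G y u) * G y :=
      Filter.eventually_of_mem (hU.mem_nhds hz) fun y hy => hm y hy u
    have hT := congrArg (fun T : Cn n →L[ℝ] EndC n => T w)
      ((h₁.congr_of_eventuallyEq he.symm).unique (h₃.fun_add h₅))
    simp only [add_apply, h₁', h₃', h₅', h₂', fderiv_star_apply h₂.differentiableAt, h₂.fderiv,
      zero_apply, map_zero, add_zero] at hT
    exact hT
  have hsymm := fderiv_fderiv_symm hG hU hz w u
  rw [hd, hd] at hsymm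
  rw [curvOf_apply hθ.differentiableAt]
  have := skew_curvature_identity (hm z hz u) (hm z hz w) hsymm
  rw [star_sub_add_commutator]
  exact this

/-- The data of a Hamiltonian holomorphic vector field `V` in a chart of a Kähler manifold. -/
structure LocalMoment (η : Cn n → Cn n [⋀^Fin 2]→L[ℝ] ℝ) (h : Cn n → ℝ) (V : Cn n → Cn n)
    (DV : Cn n → EndC n) (U : Set (Cn n)) : Prop where
  holo : HoloOn V DV U
  smooth_form : ContDiffOn ℝ ∞ η U
  positive : ∀ y ∈ U, IsPositiveOneOne (η y)
  torsion_free : ∀ y ∈ U, ∀ u w,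
    chernOf (fun z => gramOf (η z)) y u w = chernOf (fun z => gramOf (η z)) y w u
  smooth_fun : ContDiffOn ℝ ∞ h U
  hamiltonian : ∀ y ∈ U, ∀ u, fderiv ℝ h y u = -η y ![V y, u]

variable {η : Cn n → Cn n [⋀^Fin 2]→L[ℝ] ℝ} {h : Cn n → ℝ} {V : Cn n → Cn n}
  {DV : Cn n → EndC n}

/-- The complex form g(V,t) = i ∂̄_t h of the Hamilton equation; one more derivative produces the
complex Hessian. -/
theorem LocalMoment.inner_gramOf (H : LocalMoment η h V DV U) {y : Cn n} (hy : y ∈ U) (t : Cn n) :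
    inner ℂ t (gramOf (η y) (V y)) = Complex.I * ((1 / 2 : ℂ) *
      ((fderiv ℝ h y t : ℂ) + Complex.I * (fderiv ℝ h y (Complex.I • t) : ℂ))) := by
  rw [(H.positive y hy).oneOne.inner_gramOf, herm, H.hamiltonian y hy, H.hamiltonian y hy]
  push_cast
  linear_combination (1 / 2 : ℂ) * (η y ![V y, Complex.I • t] : ℂ) * Complex.I_sq

theorem hasFDerivAt_inner {v : Cn n → Cn n} {v' : Cn n →L[ℝ] Cn n} (hv : HasFDerivAt v v' z)
    (t : Cn n) : ∃ d : Cn n →L[ℝ] ℂ, HasFDerivAt (fun y => inner ℂ t (v y)) d z ∧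
      ∀ u, d u = inner ℂ t (v' u) := by
  let T : Cn n →L[ℝ] ℂ := (innerSL ℂ t).restrictScalars ℝ
  exact ⟨T.comp v', T.hasFDerivAt.comp z hv, fun u => rfl⟩

/-- The section `g⁻¹ i ∂̄∂ h` is the covariant derivative of the Hamiltonian vector field. -/
theorem LocalMoment.hessian_eq (H : LocalMoment η h V DV U) (hz : z ∈ U) :
    Complex.I • (Ring.inverse (gramOf (η z)) * hessOf h z)
      = chernOf (fun z => gramOf (η z)) z (V z) + DV z := by
  have hU := H.holo.isOpen
  have hu := (H.positive z hz).isUnit_gramOf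
  have hG := hasFDerivAt_of_contDiffOn (contDiffOn_gramOf H.smooth_form) hU hz
  have hd : ∀ t s, inner ℂ t (fderiv ℝ (fun z => gramOf (η z)) z s (V z) + gramOf (η z) (DV z s))
      = Complex.I * ((1 / 2 : ℂ) * ((fderiv ℝ (fderiv ℝ h) z s t : ℂ)
        + Complex.I * (fderiv ℝ (fderiv ℝ h) z s (Complex.I • t) : ℂ))) := by
    intro t s
    obtain ⟨a₁, h₁, h₁'⟩ := hasFDerivAt_end_apply hG (H.holo.hasFDerivAt z hz)
    obtain ⟨a₂, h₂, h₂'⟩ := hasFDerivAt_inner h₁ t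
    have h3 := hasFDerivAt_ofReal (hasFDerivAt_fderiv_apply H.smooth_fun hU hz t)
    have h4 := hasFDerivAt_ofReal (hasFDerivAt_fderiv_apply H.smooth_fun hU hz (Complex.I • t))
    have h5 := ((h3.fun_add (h4.const_mul Complex.I)).const_mul (1 / 2 : ℂ)).const_mul Complex.I
    have he : (fun y => inner ℂ t (gramOf (η y) (V y))) =ᶠ[𝓝 z] fun y => Complex.I * ((1 / 2 : ℂ) *
      ((fderiv ℝ h y t : ℂ) + Complex.I * (fderiv ℝ h y (Complex.I • t) : ℂ))) :=
      Filter.eventually_of_mem (hU.mem_nhds hz) fun y hy => H.inner_gramOf hy t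
    have hT := congrArg (fun T : Cn n →L[ℝ] ℂ => T s)
      ((h₂.congr_of_eventuallyEq he.symm).unique h5)
    simp only [h₂', h₁'] at hT
    exact hT
  have key : gramOf (η z) * (chernOf (fun z => gramOf (η z)) z (V z) + DV z)
      = Complex.I • hessOf h z := by
    refine ext_inner_end fun s t => ?_
    have e1 : (gramOf (η z) * (chernOf (fun z => gramOf (η z)) z (V z) + DV z)) s
        = (gramOf (η z) * chernOf (fun z => gramOf (η z)) z s) (V z) + gramOf (η z) (DV z s) := by
      change gramOf (η z) (chernOf (fun z => gramOf (η z)) z (V z) s + DV z s) = _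
      -- Torsion-freeness exchanges `V z` and `s`, so that the connection form is evaluated on `s`
      -- and G Θ = ∂G applies.
      rw [H.torsion_free z hz, map_add]
      rfl
    -- This is the (1,0)-part in `s` of the derivative computed in `hd`. The term with `DV z s` is
    -- already complex-linear, so it survives unchanged.
    have e2 : inner ℂ t ((gramOf (η z) * chernOf (fun z => gramOf (η z)) z s) (V z)
        + gramOf (η z) (DV z s)) = (1 / 2 : ℂ) *
        (inner ℂ t (fderiv ℝ (fun z => gramOf (η z)) z s (V z) + gramOf (η z) (DV z s))
        - Complex.I * inner ℂ t (fderiv ℝ (fun z => gramOf (η z)) z (Complex.I • s) (V z)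
          + gramOf (η z) (DV z (Complex.I • s)))) := by
      rw [mul_chernOf (G := fun z => gramOf (η z)) hu, delOp_apply]
      change inner ℂ t ((1 / 2 : ℂ) • (fderiv ℝ (fun z => gramOf (η z)) z s (V z)
        - Complex.I • fderiv ℝ (fun z => gramOf (η z)) z (Complex.I • s) (V z)) + _) = _
      simp only [map_smul, inner_add_right, inner_smul_right, inner_sub_right]
      linear_combination (1 / 2 : ℂ) * inner ℂ t (gramOf (η z) (DV z s)) * Complex.I_sq
    rw [e1, e2, hd, hd]
    change _ = inner ℂ t (Complex.I • hessOf h z s)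
    rw [inner_smul_right, inner_hessOf H.smooth_fun hU hz, levi]
    have hQ := fderiv_fderiv_symm H.smooth_fun hU hz
    rw [hQ t s, hQ t (Complex.I • s), hQ (Complex.I • t) s, hQ (Complex.I • t) (Complex.I • s)]
    linear_combination -(1 / 4 : ℂ) * Complex.I *
      (fderiv ℝ (fderiv ℝ h) z (Complex.I • s) (Complex.I • t) : ℂ) * Complex.I_sq
  rw [← mul_smul_comm, ← key, Ring.inverse_mul_cancel_left _ _ hu]

theorem LocalMoment.contDiffOn_chernOf (H : LocalMoment η h V DV U) :
    ContDiffOn ℝ ∞ (chernOf fun z => gramOf (η z)) U :=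
  KahlerMoment.contDiffOn_chernOf H.holo.isOpen (contDiffOn_gramOf H.smooth_form)
    fun y hy => (H.positive y hy).isUnit_gramOf

theorem LocalMoment.contDiffOn_hessian (H : LocalMoment η h V DV U) :
    ContDiffOn ℝ ∞ (fun z => Complex.I • (Ring.inverse (gramOf (η z)) * hessOf h z)) U := by
  refine ContDiffOn.congr ?_ fun z hz => H.hessian_eq hz
  exact (H.contDiffOn_chernOf.clm_apply H.holo.contDiffOn).add H.holo.smooth

theorem fderiv_smul_I_apply {θ : Cn n → Cn n →L[ℝ] EndC n} (hθ : DifferentiableAt ℝ θ z)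
    (h : ∀ y u, θ y (Complex.I • u) = Complex.I • θ y u) (v u : Cn n) :
    fderiv ℝ θ z v (Complex.I • u) = Complex.I • fderiv ℝ θ z v u := by
  obtain ⟨a₁, h₁, h₁'⟩ := hasFDerivAt_clm_apply hθ.hasFDerivAt (hasFDerivAt_const u z)
  obtain ⟨a₂, h₂, h₂'⟩ := hasFDerivAt_clm_apply hθ.hasFDerivAt
    (hasFDerivAt_const (Complex.I • u) z)
  simp only [h] at h₂
  have hT := congrArg (fun T : Cn n →L[ℝ] EndC n => T v) (h₂.unique (h₁.const_smul Complex.I))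
  simp only [smul_apply, h₁', h₂', zero_apply, map_zero, add_zero] at hT
  exact hT

theorem moment_expand {R : Type*} [Ring R] (x y a b c d e : R) :
    x - y + (a * b - b * a) + (y + c + d + (b * (a + e) - (a + e) * b))
      = x + c + d + (b * e - e * b) := by
  noncomm_ring


/-! ### The moment equation from complex-linearity and skewness. -/

section Abstract

variable {G K : Cn n → EndC n}

/-- With `K = θ(V) + DV`, the derivative of `θ` in the direction `u` and the commutator with `θ(V)`
both cancel against the curvature. What remains is the Lie derivative of the connection along `V`,
in a form whose complex-linearity in `u` is visible. -/
theorem curvOf_add_covariant (hU : IsOpen U) (hz : z ∈ U) (hV : HoloOn V DV U)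
    {θ : Cn n → Cn n →L[ℝ] EndC n} (hθ : DifferentiableAt ℝ θ z)
    (hKe : ∀ y ∈ U, K y = θ y (V y) + DV y) (u : Cn n) :
    curvOf θ z ![V z, u] + (fderiv ℝ K z u + (θ z u * K z - K z * θ z u))
      = fderiv ℝ θ z (V z) u + θ z (DV z u) + fderiv ℝ DV z u
        + (θ z u * DV z - DV z * θ z u) := by
  have hKD : fderiv ℝ K z u = fderiv ℝ θ z u (V z) + θ z (DV z u) + fderiv ℝ DV z u := by
    obtain ⟨a₁, h₁, h₁'⟩ := hasFDerivAt_clm_apply hθ.hasFDerivAt (hV.hasFDerivAt z hz)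
    have he : K =ᶠ[𝓝 z] fun y => θ y (V y) + DV y :=
      Filter.eventually_of_mem (hU.mem_nhds hz) hKe
    rw [he.fderiv_eq, (h₁.fun_add (hV.hasFDerivAt_deriv hz)).fderiv]
    simp only [add_apply, h₁']
    rfl
  rw [curvOf_apply hθ, hKD, hKe z hz]
  exact moment_expand _ _ _ _ _ _ _

/-- A metric connection preserves the bundle of skew-adjoint endomorphisms: differentiate the
skewness relation and use compatibility with `G`. -/
theorem covariant_skew (hU : IsOpen U) (hz : z ∈ U) (hG : DifferentiableAt ℝ G z)
    (hGs : ∀ y ∈ U, star (G y) = G y) (hGu : IsUnit (G z)) (hK : DifferentiableAt ℝ K z)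
    (hKs : ∀ y ∈ U, star (K y) * G y = -(G y * K y)) (u : Cn n) :
    G z * (fderiv ℝ K z u + (chernOf G z u * K z - K z * chernOf G z u))
      + star (fderiv ℝ K z u + (chernOf G z u * K z - K z * chernOf G z u)) * G z = 0 := by
  have hKs' : star (fderiv ℝ K z u) * G z + star (K z) * fderiv ℝ G z u
      = -(fderiv ℝ G z u * K z + G z * fderiv ℝ K z u) := by
    have h₁ := (differentiableAt_star hK).hasFDerivAt
    obtain ⟨a₂, h₂, h₂'⟩ := hasFDerivAt_mul_apply h₁ hG.hasFDerivAt
    obtain ⟨a₃, h₃, h₃'⟩ := hasFDerivAt_mul_apply hG.hasFDerivAt hK.hasFDerivAt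
    have he : (fun y => star (K y) * G y) =ᶠ[𝓝 z] fun y => -(G y * K y) :=
      Filter.eventually_of_mem (hU.mem_nhds hz) hKs
    have hT := congrArg (fun T : Cn n →L[ℝ] EndC n => T u)
      ((h₂.congr_of_eventuallyEq he.symm).unique h₃.fun_neg)
    simp only [neg_apply, h₂', h₃', fderiv_star_apply hK] at hT
    exact hT
  rw [star_add_commutator]
  exact skew_moment_identity (fderiv_eq_mul_chernOf hU hz hG hGs hGu u) (hKs z hz) hKs'

/-- If `E` is skew-adjoint then `i E` is self-adjoint. If `i E` is also skew-adjoint, then `2i g E =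
0`. -/
theorem eq_zero_of_skew {g E : EndC n} (hg : IsUnit g) (h1 : g * E + star E * g = 0)
    (h2 : g * (Complex.I • E) + star (Complex.I • E) * g = 0) : E = 0 := by
  rw [star_smul, mul_smul_comm, smul_mul_assoc] at h2
  have h3 : star E * g = -(g * E) := by rw [eq_neg_iff_add_eq_zero, add_comm]; exact h1
  rw [h3] at h2
  have h4 : (2 * Complex.I) • (g * E) = 0 := by
    rw [← h2]
    simp only [RCLike.star_def, Complex.conj_I]
    module
  have h5 : g * E = 0 := (smul_eq_zero.mp h4).resolve_left (by simp [Complex.I_ne_zero])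
  obtain ⟨M, hM⟩ := hg.exists_left_inv
  rw [← one_mul E, ← hM, mul_assoc, h5, mul_zero]

/-- The sum of the curvature term and the covariant derivative is skew-adjoint for every real
vector, in particular for `u` and for `i u`. Complex-linearity makes its value at `i u` equal to `i`
times its value at `u`, so it vanishes. -/
theorem curvOf_chernOf_moment (hU : IsOpen U) (hz : z ∈ U) (hV : HoloOn V DV U)
    (hG : ContDiffOn ℝ ∞ G U) (hGs : ∀ y ∈ U, star (G y) = G y) (hGu : ∀ y ∈ U, IsUnit (G y))
    (hK : ContDiffOn ℝ ∞ K U) (hKs : ∀ y ∈ U, star (K y) * G y = -(G y * K y))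
    (hKe : ∀ y ∈ U, K y = chernOf G y (V y) + DV y) (u : Cn n) :
    curvOf (chernOf G) z ![V z, u]
      = -(fderiv ℝ K z u + (chernOf G z u * K z - K z * chernOf G z u)) := by
  have hGd := (hasFDerivAt_of_contDiffOn hG hU hz).differentiableAt
  have hθ := (hasFDerivAt_of_contDiffOn (KahlerMoment.contDiffOn_chernOf hU hG hGu) hU
    hz).differentiableAt
  have hKd := (hasFDerivAt_of_contDiffOn hK hU hz).differentiableAt
  have hE := curvOf_add_covariant hU hz hV hθ hKe
  have hEI : curvOf (chernOf G) z ![V z, Complex.I • u] + (fderiv ℝ K z (Complex.I • u)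
      + (chernOf G z (Complex.I • u) * K z - K z * chernOf G z (Complex.I • u)))
      = Complex.I • (curvOf (chernOf G) z ![V z, u] + (fderiv ℝ K z u
      + (chernOf G z u * K z - K z * chernOf G z u))) := by
    rw [hE, hE, fderiv_smul_I_apply hθ (chernOf_smul_I G), map_smul,
      chernOf_smul_I, chernOf_smul_I, hV.fderiv_smul_I hz]
    simp only [smul_add, smul_sub, smul_mul_assoc, mul_smul_comm]
  have hskew : ∀ u, G z * (curvOf (chernOf G) z ![V z, u] + (fderiv ℝ K z u
      + (chernOf G z u * K z - K z * chernOf G z u)))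
      + star (curvOf (chernOf G) z ![V z, u] + (fderiv ℝ K z u
      + (chernOf G z u * K z - K z * chernOf G z u))) * G z = 0 := by
    intro u
    exact skew_add (curvOf_chernOf_skew hU hz hG hGs hGu _ _)
      (covariant_skew hU hz hGd hGs (hGu z hz) hKd hKs u)
  rw [eq_neg_iff_add_eq_zero]
  have h2 := hskew (Complex.I • u)
  rw [hEI] at h2
  exact eq_zero_of_skew (hGu z hz) (hskew u) h2

end Abstract

/-- The moment map equation `ι_V R = -D H`. -/
theorem LocalMoment.moment (H : LocalMoment η h V DV U) (hz : z ∈ U) (u : Cn n) :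
    curvOf (chernOf fun z => gramOf (η z)) z ![V z, u]
      = -(fderiv ℝ (fun z => Complex.I • (Ring.inverse (gramOf (η z)) * hessOf h z)) z u
        + (chernOf (fun z => gramOf (η z)) z u *
            (Complex.I • (Ring.inverse (gramOf (η z)) * hessOf h z))
          - (Complex.I • (Ring.inverse (gramOf (η z)) * hessOf h z)) *
            chernOf (fun z => gramOf (η z)) z u)) := by
  refine curvOf_chernOf_moment (G := fun z => gramOf (η z))
    (K := fun z => Complex.I • (Ring.inverse (gramOf (η z)) * hessOf h z))
    H.holo.isOpen hz H.holo (contDiffOn_gramOf H.smooth_form)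
    (fun y hy => (H.positive y hy).oneOne.star_gramOf)
    (fun y hy => (H.positive y hy).isUnit_gramOf) H.contDiffOn_hessian
    (fun y hy => ?_) (fun y hy => H.hessian_eq hy) u
  -- Skewness of the metric Hessian: multiplied by the metric it is `i` times the complex Hessian,
  -- which is Hermitian.
  have e : gramOf (η y) * (Complex.I • (Ring.inverse (gramOf (η y)) * hessOf h y))
      = Complex.I • hessOf h y := by
    rw [mul_smul_comm, Ring.mul_inverse_cancel_left _ _ (H.positive y hy).isUnit_gramOf]
  have e2 : star (Complex.I • (Ring.inverse (gramOf (η y)) * hessOf h y)) * gramOf (η y)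
      = star (gramOf (η y) * (Complex.I • (Ring.inverse (gramOf (η y)) * hessOf h y))) := by
    rw [star_mul, (H.positive y hy).oneOne.star_gramOf]
  rw [e2, e, star_smul, star_hessOf H.smooth_fun H.holo.isOpen hy, RCLike.star_def,
    Complex.conj_I]
  exact neg_smul Complex.I (hessOf h y)

end LocalMoment

end KahlerMoment
end

noncomputable section

namespace KahlerMoment

open Topology

/-! ### Closedness of invariant polynomials in the equivariant curvature -/

section ChernWeil

variable {E A : Type*} [NormedAddCommGroup E] [NormedSpace ℝ E] [NormedRing A] [NormedAlgebra ℝ A]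
  {U : Set E} {z : E} {p : ℕ}

theorem extDeriv_comp_left {B : Type*} [NormedAddCommGroup B] [NormedSpace ℝ B] (T : A →L[ℝ] B)
    {a : E → E [⋀^Fin p]→L[ℝ] A} (ha : DifferentiableAt ℝ a z) :
    extDeriv (fun y => T.compContinuousAlternatingMap (a y)) z
      = T.compContinuousAlternatingMap (extDeriv a z) := by
  have h := (ContinuousLinearMap.compContinuousAlternatingMapCLM ℝ E A B (ι := Fin p) T).hasFDerivAt.comp
    z ha.hasFDerivAt
  have h' : HasFDerivAt (fun y => T.compContinuousAlternatingMap (a y)) _ z := h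
  ext w
  change _ = T (extDeriv a z w)
  rw [extDeriv, extDeriv, ContinuousAlternatingMap.alternatizeUncurryFin_apply,
    ContinuousAlternatingMap.alternatizeUncurryFin_apply, map_sum, h'.fderiv]
  refine Finset.sum_congr rfl fun i _ => ?_
  rw [map_zsmul]
  rfl

theorem contDiffOn_ofSubsingleton {θ : E → E →L[ℝ] A} {m : WithTop ℕ∞} (hθ : ContDiffOn ℝ m θ U) :
    ContDiffOn ℝ m
      (fun z => ContinuousAlternatingMap.ofSubsingleton ℝ E A (0 : Fin 1) (θ z)) U :=
  (ContinuousAlternatingMap.ofSubsingletonLIE (𝕜 := ℝ) (E := E) (F := A)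
    (0 : Fin 1)).toContinuousLinearEquiv.contDiff.comp_contDiffOn hθ

theorem contDiffOn_clm_comp {P Q : Type*} [NormedAddCommGroup P] [NormedSpace ℝ P]
    [NormedAddCommGroup Q] [NormedSpace ℝ Q] {m : WithTop ℕ∞} {f : E → P} (T : P →L[ℝ] Q)
    (hf : ContDiffOn ℝ m f U) : ContDiffOn ℝ m (fun y => T (f y)) U :=
  T.contDiff.comp_contDiffOn hf

theorem contDiffOn_extDeriv {B : Type*} [NormedAddCommGroup B] [NormedSpace ℝ B]
    {a : E → E [⋀^Fin p]→L[ℝ] B} (hU : IsOpen U) (ha : ContDiffOn ℝ ∞ a U) :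
    ContDiffOn ℝ ∞ (extDeriv a) U := by
  have h : ContDiffOn ℝ ∞ (fderiv ℝ a) U := ha.fderiv_of_isOpen hU (by simp)
  exact contDiffOn_clm_comp (ContinuousAlternatingMap.alternatizeUncurryFinCLM ℝ E B (n := p)) h

theorem contDiffOn_curvOf {θ : E → E →L[ℝ] A} (hU : IsOpen U) (hθ : ContDiffOn ℝ ∞ θ U) :
    ContDiffOn ℝ ∞ (curvOf θ) U := by
  have h := contDiffOn_ofSubsingleton hθ
  refine (contDiffOn_extDeriv hU h).add fun y hy => ContDiffAt.contDiffWithinAt ?_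
  have h' := h.contDiffAt (hU.mem_nhds hy)
  exact contDiffAt_wedge rfl h' h'

/-- The Bianchi identity at a point where the connection form vanishes. -/
theorem extDeriv_curvOf {θ : E → E →L[ℝ] A} (hU : IsOpen U) (hz : z ∈ U)
    (hθ : ContDiffOn ℝ ∞ θ U) (h0 : θ z = 0) : extDeriv (curvOf θ) z = 0 := by
  have h := (contDiffOn_ofSubsingleton hθ).contDiffAt (hU.mem_nhds hz)
  have h1 := (contDiffOn_extDeriv hU (contDiffOn_ofSubsingleton hθ)).contDiffAt (hU.mem_nhds hz)
  have h2 := contDiffAt_wedge rfl h h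
  have hs : curvOf θ = extDeriv (fun z => ContinuousAlternatingMap.ofSubsingleton ℝ E A (0 : Fin 1)
      (θ z)) + fun z => wedge rfl (ContinuousAlternatingMap.ofSubsingleton ℝ E A (0 : Fin 1) (θ z))
      (ContinuousAlternatingMap.ofSubsingleton ℝ E A (0 : Fin 1) (θ z)) := rfl
  have h00 : ContinuousAlternatingMap.ofSubsingleton ℝ E A (0 : Fin 1) (θ z) = 0 := by
    rw [h0]; ext w; rfl
  -- The first term dies by d² = 0. In the derivative of `θ ∧ θ` each term keeps an undifferentiated
  -- factor `θ z`, which is zero.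
  rw [hs, extDeriv_add (h1.differentiableAt (by simp)) (h2.differentiableAt (by simp)),
    extDeriv_extDeriv_apply h (by
      rw [minSmoothness_of_isRCLikeNormedField]; exact WithTop.coe_le_coe.mpr le_top),
    extDeriv_wedge rfl rfl rfl (h.differentiableAt (by simp)) (h.differentiableAt (by simp)),
    h00, wedge_zero_left, wedge_zero_right]
  simp

/-- The inhomogeneous form with components `H` in degree zero and `R` in degree two. -/
def mixedOf (H : A) (R : E [⋀^Fin 2]→L[ℝ] A) : (p : ℕ) → E [⋀^Fin p]→L[ℝ] A
  | 0 => ContinuousAlternatingMap.constOfIsEmpty ℝ E (Fin 0) H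
  | 2 => R
  | _ => 0

theorem isEvenMixed_mixedOf (H : A) (R : E [⋀^Fin 2]→L[ℝ] A) : IsEvenMixed (mixedOf H R)
  | 0, h => absurd h (by decide)
  | 1, _ => rfl
  | 2, h => absurd h (by decide)
  | _ + 3, _ => rfl

theorem contDiffAt_mixedOf {m : WithTop ℕ∞} {H : E → A} {R : E → E [⋀^Fin 2]→L[ℝ] A}
    (hH : ContDiffAt ℝ m H z) (hR : ContDiffAt ℝ m R z) :
    ∀ p, ContDiffAt ℝ m (fun y => mixedOf (H y) (R y) p) z
  | 0 => (ContinuousAlternatingMap.constOfIsEmptyLIE ℝ E A (Fin 0)).toContinuousLinearEquiv.contDiff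
      |>.contDiffAt.comp z hH
  | 1 => contDiffAt_const
  | 2 => hR
  | _ + 3 => contDiffAt_const

theorem transport_mixedOf {E' : Type*} [NormedAddCommGroup E'] [NormedSpace ℝ E'] (g : E' →L[ℝ] E)
    (c d : A) (H : A) (R : E [⋀^Fin 2]→L[ℝ] A) :
    ∀ p, transport g c d (mixedOf H R p) = mixedOf (c * H * d) (transport g c d R) p
  | 0 => by ext w; rfl
  | 1 => by ext w; simp [mixedOf]
  | 2 => rfl
  | _ + 3 => by ext w; simp [mixedOf]

/-- Only two degrees carry information: degree one is dH + ι_v R and degree three is dR. -/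
theorem eqDAt_mixedOf {v : E} {H : E → A} {R : E → E [⋀^Fin 2]→L[ℝ] A}
    (h1 : ∀ u, fderiv ℝ H z u + R z ![v, u] = 0) (hR : extDeriv R z = 0) :
    ∀ p, eqDAt v (fun y => mixedOf (H y) (R y)) z p = 0
  | 0 => by ext w; rfl
  | 1 => by
    ext w
    have e : (extDeriv (fun y => mixedOf (H y) (R y) 0) z) w = fderiv ℝ H z (w 0) := by
      have := extDeriv_constOfIsEmpty (𝕜 := ℝ) H z
      change extDeriv (fun y => ContinuousAlternatingMap.constOfIsEmpty ℝ E (Fin 0) (H y)) z w = _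
      rw [this]
      rfl
    have e2 : Matrix.vecCons v w = ![v, w 0] := by
      ext i
      fin_cases i <;> rfl
    change (extDeriv (fun y => mixedOf (H y) (R y) 0) z) w + R z (Matrix.vecCons v w) = 0
    rw [e, e2, h1]
  | 2 => by
    change extDeriv (fun _ => 0) z + (0 : E [⋀^Fin 3]→L[ℝ] A).curryLeft v = 0
    ext w
    simp [extDeriv, ContinuousAlternatingMap.alternatizeUncurryFin_apply]
  | 3 => by
    change extDeriv R z + (0 : E [⋀^Fin 4]→L[ℝ] A).curryLeft v = 0
    rw [hR]
    ext w
    simp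
  | _ + 4 => by
    change extDeriv (fun _ => 0) z + (0 : E [⋀^Fin _]→L[ℝ] A).curryLeft v = 0
    ext w
    simp [extDeriv, ContinuousAlternatingMap.alternatizeUncurryFin_apply]

theorem eqDAt_comp_left {B : Type*} [NormedRing B] [NormedAlgebra ℝ B] (T : A →L[ℝ] B) {v : E}
    {P : E → (p : ℕ) → E [⋀^Fin p]→L[ℝ] A} (hP : ∀ p, DifferentiableAt ℝ (fun y => P y p) z)
    (h : ∀ p, eqDAt v P z p = 0) :
    ∀ p, eqDAt v (fun y q => T.compContinuousAlternatingMap (P y q)) z p = 0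
  | 0 => by
    have := congrArg T.compContinuousAlternatingMap (h 0)
    ext w
    exact (congrArg (fun a => a w) this).trans (map_zero T)
  | p + 1 => by
    have := congrArg T.compContinuousAlternatingMap (h (p + 1))
    rw [eqDAt, extDeriv_comp_left T (hP p)]
    ext w
    refine Eq.trans ?_ ((congrArg (fun a => a w) this).trans (map_zero T))
    exact (map_add T _ _).symm

theorem eqDAt_congr {P Q : E → (p : ℕ) → E [⋀^Fin p]→L[ℝ] A} (h : P =ᶠ[𝓝 z] Q) (v : E) :
    ∀ p, eqDAt v P z p = eqDAt v Q z p
  | 0 => by rw [eqDAt, eqDAt, h.eq_of_nhds]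
  | p + 1 => by
    have e : (fun y => P y p) =ᶠ[𝓝 z] fun y => Q y p := h.mono fun y hy => congrFun hy p
    rw [eqDAt, eqDAt, e.extDeriv_eq, h.eq_of_nhds]

/-- Powers of the equivariant curvature, with the curvature multiplied by `S`, give closed forms
after applying a linear functional invariant under conjugation. -/
theorem eqDAt_powMixed_curvOf [CompleteSpace A] {B : Type*} [NormedRing B] [NormedAlgebra ℝ B]
    {θ : E → E →L[ℝ] A} {H : E → A} (hU : IsOpen U) (hz : z ∈ U) (hθ : ContDiffOn ℝ ∞ θ U)
    (hH : ContDiffOn ℝ ∞ H U) {v : E}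
    (hm : ∀ u, curvOf θ z ![v, u] = -(fderiv ℝ H z u + (θ z u * H z - H z * θ z u)))
    {S : A →L[ℝ] A} (hSl : ∀ x y, S (x * y) = x * S y) (hSr : ∀ x y, S (x * y) = S x * y)
    {τ : A →L[ℝ] B} (hτ : ∀ c x d, c * d = 1 → d * c = 1 → τ (c * x * d) = τ x) (k p : ℕ) :
    eqDAt v (fun y q => τ.compContinuousAlternatingMap
      (powMixed (fun q => S.compContinuousAlternatingMap (mixedOf (H y) (curvOf θ y) q)) k q)) z p
      = 0 := by
  -- The gauge is chosen with value `1` and derivative `θ z` at `z`. Its inverse `M` then has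
  -- derivative `-θ z`, and the transformed connection form `g (θ M + dM)` vanishes at `z`.
  -- Invertibility is available only near `z`, hence the smaller set `W`.
  set g : E → A := fun y => 1 + θ z (y - z) with hg
  have hgs : ContDiff ℝ ∞ g :=
    contDiff_const.add ((θ z).contDiff.comp (contDiff_id.sub contDiff_const))
  have hgz : g z = 1 := by simp [hg]
  have hgd : ∀ y, HasFDerivAt g (θ z) y := fun y => by
    have := ((θ z).hasFDerivAt.comp y ((hasFDerivAt_id y).sub_const z)).const_add 1
    exact this
  set W : Set E := U ∩ {y | IsUnit (g y)} with hW
  have hWo : IsOpen W := hU.inter (Units.isOpen.preimage hgs.continuous)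
  have hzW : z ∈ W := ⟨hz, by simp [hgz]⟩
  set M : E → A := fun y => Ring.inverse (g y) with hM
  have hMs : ContDiffOn ℝ ∞ M W := contDiffOn_ringInverse hgs.contDiffOn fun y hy => hy.2
  have hgM : ∀ y ∈ W, g y * M y = 1 := fun y hy => Ring.mul_inverse_cancel _ hy.2
  have hMg : ∀ y ∈ W, M y * g y = 1 := fun y hy => Ring.inverse_mul_cancel _ hy.2
  have hMz : M z = 1 := by simp [hM, hgz]
  have hMd := hasFDerivAt_of_contDiffOn hMs hWo hzW
  have hHd := hasFDerivAt_of_contDiffOn hH hU hz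
  have hMd' : ∀ u, fderiv ℝ M z u = -θ z u := by
    intro u
    obtain ⟨a, ha, ha'⟩ := hasFDerivAt_mul_apply hMd (hgd z)
    have he : (fun y => M y * g y) =ᶠ[𝓝 z] fun _ => 1 :=
      Filter.eventually_of_mem (hWo.mem_nhds hzW) hMg
    have h0 := (ha.congr_of_eventuallyEq he.symm).unique (hasFDerivAt_const 1 z)
    have h1 := ha' u
    rw [h0, hgz, hMz, mul_one, one_mul, zero_apply] at h1
    exact eq_neg_of_add_eq_zero_left h1.symm
  set θ' : E → E →L[ℝ] A := fun y =>
    (ContinuousLinearMap.mul ℝ A (g y)).comp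
      ((((ContinuousLinearMap.mul ℝ A).flip (M y)).comp (θ y)) + fderiv ℝ M y) with hθ'
  have hθ'a : ∀ y u, θ' y u = g y * (θ y u * M y + fderiv ℝ M y u) := fun y u => rfl
  have hθ's : ContDiffOn ℝ ∞ θ' W := by
    have h1 : ContDiffOn ℝ ∞ (fun y => ContinuousLinearMap.mul ℝ A (g y)) W :=
      ((ContinuousLinearMap.mul ℝ A).contDiff.comp hgs).contDiffOn
    have h2 : ContDiffOn ℝ ∞ (fun y => (ContinuousLinearMap.mul ℝ A).flip (M y)) W :=
      (ContinuousLinearMap.mul ℝ A).flip.contDiff.comp_contDiffOn hMs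
    exact h1.clm_comp ((h2.clm_comp (hθ.mono Set.inter_subset_left)).add
      (hMs.fderiv_of_isOpen hWo (m := ∞) (by simp)))
  have hθ'z : θ' z = 0 := by
    ext u
    rw [hθ'a, hgz, hMz, hMd']
    simp
  have hR : ∀ y ∈ W, transport (ContinuousLinearMap.id ℝ E) (g y) (M y) (curvOf θ y)
      = curvOf θ' y := by
    intro y hy
    have hgauge := curvOf_gauge (f := id) (ℓ := fun _ => ContinuousLinearMap.id ℝ E) (θ := θ)
      (θ' := θ') hWo hy (fun y _ => hasFDerivAt_id y) contDiffOn_const hMs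
      (hasFDerivAt_of_contDiffOn hθ hU hy.1).differentiableAt
      (hasFDerivAt_of_contDiffOn hθ's hWo hy).differentiableAt
      (fun x hx u => by rw [hθ'a, ← mul_assoc, hMg x hx, one_mul]; rfl)
    refine ext_twoForm fun u w => ?_
    have e := congrArg (fun T => g y * T) (hgauge u w)
    simp only [← mul_assoc, hgM y hy, one_mul] at e
    rw [e, transport_apply]
    congr 2
  set H' : E → A := fun y => g y * H y * M y with hH'
  have hH's : ContDiffOn ℝ ∞ H' W :=
    (hgs.contDiffOn.mul (hH.mono Set.inter_subset_left)).mul hMs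
  -- In this gauge the ordinary derivative at `z` is the covariant derivative, so `hm` becomes dH' +
  -- ι_v R = 0.
  have hH'd : ∀ u, fderiv ℝ H' z u = θ z u * H z + fderiv ℝ H z u - H z * θ z u := by
    intro u
    obtain ⟨a, ha, ha'⟩ := hasFDerivAt_mul_apply (hgd z) hHd
    obtain ⟨b, hb, hb'⟩ := hasFDerivAt_mul_apply ha hMd
    rw [hb.fderiv, hb', ha', hgz, hMz, hMd']
    noncomm_ring
  have hclosed : ∀ p, eqDAt v (fun y => mixedOf (H' y) (curvOf θ' y)) z p = 0 := by
    refine eqDAt_mixedOf (fun u => ?_) (extDeriv_curvOf hWo hzW hθ's hθ'z)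
    rw [hH'd, ← hR z hzW, transport_apply, hgz, hMz]
    have : curvOf θ z (fun i => ContinuousLinearMap.id ℝ E (![v, u] i)) = curvOf θ z ![v, u] := rfl
    rw [this, hm]
    noncomm_ring
  have hmixs : ∀ p, ContDiffAt ℝ ∞ (fun y => mixedOf (H' y) (curvOf θ' y) p) z :=
    contDiffAt_mixedOf (hH's.contDiffAt (hWo.mem_nhds hzW))
      ((contDiffOn_curvOf hWo hθ's).contDiffAt (hWo.mem_nhds hzW))
  have hS : ∀ p, ContDiffAt ℝ ∞
      (fun y => S.compContinuousAlternatingMap (mixedOf (H' y) (curvOf θ' y) p)) z := fun p =>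
    (ContinuousLinearMap.compContinuousAlternatingMapCLM ℝ E A A (ι := Fin p) S).contDiff.contDiffAt.comp
      z (hmixs p)
  have hSc := eqDAt_comp_left S (fun p => (hmixs p).differentiableAt (by simp)) hclosed
  have hpow := eqDAt_powMixed (k := k) (fun p hp => by
      rw [isEvenMixed_mixedOf _ _ p hp]; ext w; simp) (fun p => (hS p).of_le (by simp)) hSc
  have hfin := eqDAt_comp_left τ (fun p =>
    (contDiffAt_powMixed hS k p).differentiableAt (by simp)) hpow p
  -- Near `z` the original and the gauged expressions agree: the powers are conjugate, since `S`
  -- commutes with left and right multiplication, and `τ` ignores conjugation.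
  refine (eqDAt_congr ?_ v p).trans hfin
  refine Filter.eventually_of_mem (hWo.mem_nhds hzW) fun y hy => funext fun q => ?_
  have e : ∀ q, S.compContinuousAlternatingMap (mixedOf (H' y) (curvOf θ' y) q)
      = transport (ContinuousLinearMap.id ℝ E) (g y) (M y)
        (S.compContinuousAlternatingMap (mixedOf (H y) (curvOf θ y) q)) := by
    intro q
    rw [← hR y hy, hH', ← transport_mixedOf]
    ext w
    change S (g y * _ * M y) = g y * S _ * M y
    rw [hSr, hSl]
    rfl
  simp only [e]
  rw [← transport_powMixed _ (hgM y hy) (hMg y hy)]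
  ext w
  exact (hτ _ _ _ (hgM y hy) (hMg y hy)).symm

end ChernWeil

end KahlerMoment
end

noncomputable section

namespace KahlerMoment

open Topology

/-! ### Charts of a complex manifold -/

section Charts

variable {n : ℕ} {X : Type*} [TopologicalSpace X] [ChartedSpace (Cn n) X]

theorem isManifold_real [IsManifold 𝓘(ℂ, Cn n) ∞ X] : IsManifold 𝓘(ℝ, Cn n) ∞ X := by
  refine isManifold_of_contDiffOn _ _ _ fun e e' he he' => ?_
  have h := (contDiffGroupoid ∞ 𝓘(ℂ, Cn n)).compatible he he'
  rw [contDiffGroupoid, mem_groupoid_of_pregroupoid] at h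
  have h' : ContDiffOn ℂ ∞ (𝓘(ℂ, Cn n) ∘ e.symm ≫ₕ e' ∘ 𝓘(ℂ, Cn n).symm)
    (𝓘(ℂ, Cn n).symm ⁻¹' (e.symm ≫ₕ e').source ∩ Set.range 𝓘(ℂ, Cn n)) := h.1
  exact h'.restrict_scalars ℝ

theorem hasMFDerivAt_real {X' : Type*} [TopologicalSpace X'] [ChartedSpace (Cn n) X'] {f : X → X'}
    {x : X} {d : EndC n} (h : HasMFDerivAt 𝓘(ℂ, Cn n) 𝓘(ℂ, Cn n) f x d) :
    HasMFDerivAt 𝓘(ℝ, Cn n) 𝓘(ℝ, Cn n) f x (d.restrictScalars ℝ) := by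
  obtain ⟨h1, h2⟩ := h
  refine ⟨h1, ?_⟩
  have := HasFDerivWithinAt.restrictScalars ℝ h2
  exact this

variable [IsManifold 𝓘(ℂ, Cn n) ∞ X]

theorem hasMFDerivAt_chart_symm (x₀ : X) {z : Cn n} (hz : z ∈ (chartAt (Cn n) x₀).target) :
    HasMFDerivAt 𝓘(ℝ, Cn n) 𝓘(ℝ, Cn n) (chartAt (Cn n) x₀).symm z
      ((frame x₀ z).restrictScalars ℝ) := by
  have : IsManifold 𝓘(ℂ, Cn n) 1 X := IsManifold.of_le (n := ∞) (by simp)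
  exact hasMFDerivAt_real
    (mdifferentiableAt_atlas_symm (I := 𝓘(ℂ, Cn n)) (chart_mem_atlas _ x₀) hz).hasMFDerivAt

theorem hasMFDerivAt_chart (x₀ : X) {z : Cn n} (hz : z ∈ (chartAt (Cn n) x₀).target) :
    HasMFDerivAt 𝓘(ℝ, Cn n) 𝓘(ℝ, Cn n) (chartAt (Cn n) x₀) ((chartAt (Cn n) x₀).symm z)
      ((coframe x₀ z).restrictScalars ℝ) := by
  have : IsManifold 𝓘(ℂ, Cn n) 1 X := IsManifold.of_le (n := ∞) (by simp)
  exact hasMFDerivAt_real (mdifferentiableAt_atlas (I := 𝓘(ℂ, Cn n)) (chart_mem_atlas _ x₀)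
    ((chartAt (Cn n) x₀).map_target hz)).hasMFDerivAt

theorem coframe_mul_frame (x₀ : X) {z : Cn n} (hz : z ∈ (chartAt (Cn n) x₀).target) :
    coframe x₀ z * frame x₀ z = 1 := by
  have : IsManifold 𝓘(ℂ, Cn n) 1 X := IsManifold.of_le (n := ∞) (by simp)
  exact (mdifferentiable_chart (I := 𝓘(ℂ, Cn n)) x₀).comp_symm_deriv hz

theorem frame_mul_coframe (x₀ : X) {z : Cn n} (hz : z ∈ (chartAt (Cn n) x₀).target) :
    frame x₀ z * coframe x₀ z = 1 := by
  have : IsManifold 𝓘(ℂ, Cn n) 1 X := IsManifold.of_le (n := ∞) (by simp)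
  have h := (mdifferentiable_chart (I := 𝓘(ℂ, Cn n)) x₀).symm_comp_deriv
    ((chartAt (Cn n) x₀).map_target hz)
  rw [(chartAt (Cn n) x₀).right_inv hz] at h
  exact h

/-- The fibre at `x` is identified with the model space through the preferred chart at `x` itself.
Hence tensors and their expressions in that chart agree at its base point. -/
theorem coframe_self (x : X) : coframe x (chartAt (Cn n) x x) = 1 := by
  have : IsManifold 𝓘(ℂ, Cn n) 1 X := IsManifold.of_le (n := ∞) (by simp)
  have h := mfderiv_chartAt_eq_tangentCoordChange (I := 𝓘(ℂ, Cn n)) (mem_chart_source (Cn n) x)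
  rw [coframe, (chartAt (Cn n) x).left_inv (mem_chart_source _ x)]
  ext1 v
  exact (congrArg (fun T : EndC n => T v) h).trans
    (tangentCoordChange_self (I := 𝓘(ℂ, Cn n)) (mem_extChartAt_source x))

theorem frame_self (x : X) : frame x (chartAt (Cn n) x x) = 1 := by
  have h := frame_mul_coframe x (mem_chart_target (Cn n) x)
  rwa [coframe_self, mul_one] at h

theorem formInChart_self {p : ℕ} {F : Type*} [NormedAddCommGroup F] [NormedSpace ℝ F]
    (a : X → Cn n [⋀^Fin p]→L[ℝ] F) (x : X) : formInChart a x (chartAt (Cn n) x x) = a x := by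
  rw [formInChart, frame_self, (chartAt (Cn n) x).left_inv (mem_chart_source _ x)]
  rfl

theorem vectorInChart_self (s : X → Cn n) (x : X) :
    vectorInChart s x (chartAt (Cn n) x x) = s x := by
  rw [vectorInChart, coframe_self, (chartAt (Cn n) x).left_inv (mem_chart_source _ x)]
  rfl

theorem endInChart_self (σ : X → EndC n) (x : X) :
    endInChart σ x (chartAt (Cn n) x x) = σ x := by
  rw [endInChart, coframe_self, frame_self, (chartAt (Cn n) x).left_inv (mem_chart_source _ x),
    one_mul, mul_one]

end Charts

/-! ### Holomorphy from the Cauchy–Riemann equations. -/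

section Holomorphic

variable {n : ℕ}

theorem holoOn_of_fderiv_smul_I {f : Cn n → Cn n} {U : Set (Cn n)} (hU : IsOpen U)
    (hf : ContDiffOn ℝ ∞ f U)
    (hI : ∀ z ∈ U, ∀ u, fderiv ℝ f z (Complex.I • u) = Complex.I • fderiv ℝ f z u) :
    ∃ L, HoloOn f L U := by
  let T : EndC n →ₗ[ℝ] (Cn n →L[ℝ] Cn n) :=
    (ContinuousLinearMap.restrictScalarsL ℂ (Cn n) (Cn n) ℝ ℝ).toLinearMap
  have hT : LinearMap.ker T = ⊥ := LinearMap.ker_eq_bot.mpr fun a b hab => by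
    ext1 v
    exact congrArg (fun T : Cn n →L[ℝ] Cn n => T v) hab
  -- A linear left inverse of restriction of scalars, continuous by finite dimension, gives the
  -- complex-linear derivative as a smooth function of the real one.
  obtain ⟨S, hS⟩ := T.exists_leftInverse_of_injective hT
  have hS' : ContDiff ℝ ∞ S := (LinearMap.toContinuousLinearMap S).contDiff
  refine ⟨fun z => S (fderiv ℝ f z), hU, ?_, fun z hz => ?_⟩
  · exact hS'.comp_contDiffOn (hf.fderiv_of_isOpen hU (by simp))
  · let L : EndC n := ⟨⟨(fderiv ℝ f z).toAddHom,
      map_complex_smul_of_map_I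
        (L := (fderiv ℝ f z).toLinearMap.toAddMonoidHom) (fun r u => map_smul (fderiv ℝ f z) r u)
        (hI z hz)⟩, (fderiv ℝ f z).cont⟩
    have hL : T L = fderiv ℝ f z := rfl
    have h2 : S (fderiv ℝ f z) = L := by
      rw [← hL]
      exact congrArg (fun T => T L) hS
    rw [h2]
    exact hasFDerivAt_of_contDiffOn hf hU hz

end Holomorphic

end KahlerMoment
end

noncomputable section

namespace KahlerMoment

open Topology

/-! ### Automorphisms of a Kähler manifold in charts -/

section ChartMaps

variable {n : ℕ} {X : Type*} [TopologicalSpace X] [ChartedSpace (Cn n) X]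

/-- The real differential of a map. -/
def realD (φ : X → X) (x : X) : Cn n →L[ℝ] Cn n := mfderiv 𝓘(ℝ, Cn n) 𝓘(ℝ, Cn n) φ x

/-- The expression of a map in the preferred charts at `x` and `y`. -/
def chartMap (φ : X → X) (x y : X) (z : Cn n) : Cn n :=
  chartAt (Cn n) y (φ ((chartAt (Cn n) x).symm z))

/-- The domain of `chartMap φ x y`. -/
def chartDom (φ : X → X) (x y : X) : Set (Cn n) :=
  (chartAt (Cn n) x).target ∩ (chartAt (Cn n) x).symm ⁻¹' (φ ⁻¹' (chartAt (Cn n) y).source)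

theorem mem_chartDom {φ : X → X} {x y : X} {z : Cn n} (hz : z ∈ (chartAt (Cn n) x).target)
    (h : φ ((chartAt (Cn n) x).symm z) ∈ (chartAt (Cn n) y).source) : z ∈ chartDom φ x y :=
  ⟨hz, h⟩

theorem chartMap_mem_target {φ : X → X} {x y : X} {z : Cn n} (hz : z ∈ chartDom φ x y) :
    chartMap φ x y z ∈ (chartAt (Cn n) y).target :=
  (chartAt (Cn n) y).map_source hz.2

theorem symm_chartMap {φ : X → X} {x y : X} {z : Cn n} (hz : z ∈ chartDom φ x y) :
    (chartAt (Cn n) y).symm (chartMap φ x y z) = φ ((chartAt (Cn n) x).symm z) :=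
  (chartAt (Cn n) y).left_inv hz.2

theorem isOpen_chartDom {φ : X → X} (hφ : Continuous φ) (x y : X) :
    IsOpen (chartDom (n := n) φ x y) :=
  (chartAt (Cn n) x).isOpen_inter_preimage_symm ((chartAt (Cn n) y).open_source.preimage hφ)

variable [IsManifold 𝓘(ℂ, Cn n) ∞ X]

theorem contDiffOn_chartMap {φ : X → X} (hφ : ContMDiff 𝓘(ℝ, Cn n) 𝓘(ℝ, Cn n) ∞ φ) (x y : X) :
    ContDiffOn ℝ ∞ (chartMap (n := n) φ x y) (chartDom φ x y) := by
  have : IsManifold 𝓘(ℝ, Cn n) ∞ X := isManifold_real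
  have h1 := (contMDiffOn_chart_symm (I := 𝓘(ℝ, Cn n)) (n := ∞) (x := x))
  have h2 := (contMDiffOn_chart (I := 𝓘(ℝ, Cn n)) (n := ∞) (x := y))
  rw [← contMDiffOn_iff_contDiffOn]
  exact h2.comp (hφ.comp_contMDiffOn (h1.mono Set.inter_subset_left)) fun z hz => hz.2

theorem hasFDerivAt_chartMap {φ : X → X} (hφ : ContMDiff 𝓘(ℝ, Cn n) 𝓘(ℝ, Cn n) ∞ φ) {x y : X}
    {z : Cn n} (hz : z ∈ chartDom φ x y) :
    HasFDerivAt (chartMap φ x y) (((coframe y (chartMap φ x y z)).restrictScalars ℝ).comp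
      ((realD φ ((chartAt (Cn n) x).symm z)).comp
        ((frame x z).restrictScalars ℝ))) z := by
  have h1 := hasMFDerivAt_chart_symm x hz.1
  have h2 := (hφ.mdifferentiableAt (by simp) (x := (chartAt (Cn n) x).symm z)).hasMFDerivAt
  have h3 := hasMFDerivAt_chart y (chartMap_mem_target hz)
  rw [symm_chartMap hz] at h3
  exact (HasMFDerivAt.comp z h3 (HasMFDerivAt.comp z h2 h1)).hasFDerivAt

/-- A smooth map preserving the complex structure and the Kähler form. -/
structure IsKahlerMap (Ω : X → Cn n [⋀^Fin 2]→L[ℝ] ℝ) (φ : X → X) : Prop where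
  smooth : ContMDiff 𝓘(ℝ, Cn n) 𝓘(ℝ, Cn n) ∞ φ
  map_I : ∀ x (u : Cn n), realD φ x (Complex.I • u)
    = Complex.I • realD φ x u
  form : ∀ x, (Ω (φ x)).compContinuousLinearMap (realD φ x) = Ω x

omit [IsManifold 𝓘(ℂ, Cn n) ∞ X] in
theorem realD_id (x : X) : realD (n := n) (id : X → X) x = ContinuousLinearMap.id ℝ (Cn n) :=
  mfderiv_id

omit [IsManifold 𝓘(ℂ, Cn n) ∞ X] in
theorem isKahlerMap_id (Ω : X → Cn n [⋀^Fin 2]→L[ℝ] ℝ) : IsKahlerMap Ω id := by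
  refine ⟨contMDiff_id, fun x u => ?_, fun x => ?_⟩
  · rw [realD_id]; rfl
  · rw [realD_id]; rfl

theorem isUnit_of_injective {T : EndC n} (h : Function.Injective T) : IsUnit T := by
  have h' : Function.Injective (T : Cn n →ₗ[ℂ] Cn n) := h
  let e := (LinearEquiv.ofInjectiveEndo _ h').toContinuousLinearEquiv
  refine ⟨⟨T, e.symm, ?_, ?_⟩, rfl⟩
  · exact ContinuousLinearMap.ext fun u => e.apply_symm_apply u
  · exact ContinuousLinearMap.ext fun u => e.symm_apply_apply u

omit [IsManifold 𝓘(ℂ, Cn n) ∞ X] in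
theorem IsKahlerForm.isPositiveOneOne {Ω : X → Cn n [⋀^Fin 2]→L[ℝ] ℝ} (hΩ : IsKahlerForm Ω)
    (x : X) : IsPositiveOneOne (Ω x) := ⟨hΩ.type_one_one x, hΩ.pos x⟩

theorem isUnit_frame (x : X) {z : Cn n} (hz : z ∈ (chartAt (Cn n) x).target) :
    IsUnit (frame x z) :=
  ⟨⟨frame x z, coframe x z, frame_mul_coframe x hz, coframe_mul_frame x hz⟩, rfl⟩

theorem IsKahlerForm.formInChart_isPositiveOneOne {Ω : X → Cn n [⋀^Fin 2]→L[ℝ] ℝ}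
    (hΩ : IsKahlerForm Ω) (x : X) {z : Cn n} (hz : z ∈ (chartAt (Cn n) x).target) :
    IsPositiveOneOne (formInChart Ω x z) :=
  (hΩ.isPositiveOneOne _).comp (isUnit_frame x hz)

/-- A kernel vector of the map would pair to zero under the pulled-back form, against positivity. So
preserving a Kähler form already forces an invertible differential. -/
theorem IsPositiveOneOne.injective_of_comp {a b : Cn n [⋀^Fin 2]→L[ℝ] ℝ}
    (hb : IsPositiveOneOne b) {T : Cn n →L[ℝ] Cn n} (h : a.compContinuousLinearMap T = b) :
    Function.Injective T := by
  rw [injective_iff_map_eq_zero]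
  intro u hu
  by_contra hne
  have hp := hb.pos u hne
  rw [← h, ContinuousAlternatingMap.compContinuousLinearMap_apply] at hp
  rw [a.map_coord_zero 0 (by simpa using hu)] at hp
  exact lt_irrefl _ hp

/-- `f`, with derivative `L`, expresses in the charts at `x` and `y` an automorphism of the Kähler
manifold. -/
structure IsKahlerChartMap (Ω : X → Cn n [⋀^Fin 2]→L[ℝ] ℝ) (x y : X) (f : Cn n → Cn n)
    (L : Cn n → EndC n) (U : Set (Cn n)) : Prop where
  holo : HoloOn f L U
  subset : U ⊆ (chartAt (Cn n) x).target
  mapsTo : Set.MapsTo f U (chartAt (Cn n) y).target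
  isUnit : ∀ z ∈ U, IsUnit (L z)
  form : ∀ z ∈ U, formInChart Ω x z
    = (formInChart Ω y (f z)).compContinuousLinearMap ((L z).restrictScalars ℝ)

/-- The common source of coordinate changes, where φ is the identity, and of the group action, where
φ is multiplication by an element. -/
theorem IsKahlerMap.exists_isKahlerChartMap {Ω : X → Cn n [⋀^Fin 2]→L[ℝ] ℝ} (hΩ : IsKahlerForm Ω)
    {φ : X → X} (hφ : IsKahlerMap Ω φ) (x y : X) :
    ∃ L, IsKahlerChartMap Ω x y (chartMap φ x y) L (chartDom φ x y) ∧
      ∀ z ∈ chartDom φ x y, ∀ u, L z u = coframe y (chartMap φ x y z)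
        (realD φ ((chartAt (Cn n) x).symm z) (frame x z u)) := by
  have hd : ∀ z ∈ chartDom φ x y, ∀ u, fderiv ℝ (chartMap φ x y) z u
      = coframe y (chartMap φ x y z)
        (realD φ ((chartAt (Cn n) x).symm z) (frame x z u)) := fun z hz u => by
    rw [(hasFDerivAt_chartMap hφ.smooth hz).fderiv]
    rfl
  obtain ⟨L, hL⟩ := holoOn_of_fderiv_smul_I (isOpen_chartDom hφ.smooth.continuous x y)
    (contDiffOn_chartMap hφ.smooth x y) (fun z hz u => by
      rw [hd z hz, hd z hz, map_smul, hφ.map_I, map_smul])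
  have hL' := fun z hz u => (hL.fderiv_apply hz u).symm.trans (hd z hz u)
  have hform : ∀ z ∈ chartDom φ x y, formInChart Ω x z
      = (formInChart Ω y (chartMap φ x y z)).compContinuousLinearMap ((L z).restrictScalars ℝ) := by
    intro z hz
    rw [formInChart, ← hφ.form, formInChart, symm_chartMap hz]
    ext w
    simp only [ContinuousAlternatingMap.compContinuousLinearMap_apply]
    congr 1
    funext i
    change _ = frame y (chartMap φ x y z) (L z (w i))
    rw [hL' z hz]
    exact (congrArg (fun T : EndC n => T _)
      (frame_mul_coframe y (chartMap_mem_target hz))).symm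
  refine ⟨L, ⟨hL, Set.inter_subset_left, fun z hz => chartMap_mem_target hz, fun z hz => ?_, hform⟩,
    hL'⟩
  exact isUnit_of_injective
    ((hΩ.formInChart_isPositiveOneOne x hz.1).injective_of_comp (hform z hz).symm)

end ChartMaps

end KahlerMoment
end

noncomputable section

namespace KahlerMoment

open Topology

/-! ### Naturality of the Chern connection, its curvature, and the metric Hessian -/

section Naturality

variable {n : ℕ} {X : Type*} [TopologicalSpace X] [ChartedSpace (Cn n) X]
  {Ω : X → Cn n [⋀^Fin 2]→L[ℝ] ℝ} {x y : X} {f : Cn n → Cn n} {L : Cn n → EndC n}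
  {U : Set (Cn n)} {z : Cn n}

theorem delOp_congr {F : Type*} [NormedAddCommGroup F] [NormedSpace ℂ F] {g g' : Cn n → F}
    (h : g =ᶠ[𝓝 z] g') : delOp g z = delOp g' z := by
  rw [delOp, delOp, h.fderiv_eq]

theorem delbarOp_congr {F : Type*} [NormedAddCommGroup F] [NormedSpace ℂ F] {g g' : Cn n → F}
    (h : g =ᶠ[𝓝 z] g') : delbarOp g z = delbarOp g' z := by
  rw [delbarOp, delbarOp, h.fderiv_eq]

theorem hessOf_congr {h h' : Cn n → ℝ} (he : h =ᶠ[𝓝 z] h') : hessOf h z = hessOf h' z := by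
  have e : ∀ᶠ w in 𝓝 z, delOp (fun w => (h w : ℂ)) w = delOp (fun w => (h' w : ℂ)) w :=
    he.eventually_nhds.mono fun w hw => delOp_congr <|
      Filter.Eventually.mono hw fun y (hy : h y = h' y) => by simp only [hy]
  unfold hessOf
  congr 2
  funext β γ
  rw [delbarOp_congr (e.mono fun w hw => by rw [hw])]

theorem IsKahlerForm.contDiffOn_gram (hΩ : IsKahlerForm Ω) (x : X) :
    ContDiffOn ℝ ∞ (gram Ω x) (chartAt (Cn n) x).target :=
  contDiffOn_gramOf (hΩ.smooth x)

theorem IsKahlerForm.isUnit_gram [IsManifold 𝓘(ℂ, Cn n) ∞ X] (hΩ : IsKahlerForm Ω) (x : X)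
    (hz : z ∈ (chartAt (Cn n) x).target) : IsUnit (gram Ω x z) :=
  (hΩ.formInChart_isPositiveOneOne x hz).isUnit_gramOf

theorem IsKahlerForm.contDiffOn_chern [IsManifold 𝓘(ℂ, Cn n) ∞ X] (hΩ : IsKahlerForm Ω) (x : X) :
    ContDiffOn ℝ ∞ (chernConnection Ω x) (chartAt (Cn n) x).target :=
  contDiffOn_chernOf (chartAt (Cn n) x).open_target (hΩ.contDiffOn_gram x)
    fun _ hz => hΩ.isUnit_gram x hz

section

variable [IsManifold 𝓘(ℂ, Cn n) ∞ X] (hΩ : IsKahlerForm Ω) (h : IsKahlerChartMap Ω x y f L U)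
include hΩ h

/-- The transformation law of the Gram operator; those of the connection, the curvature and the
metric Hessian follow from it. -/
theorem IsKahlerChartMap.gram_eq (hz : z ∈ U) :
    gram Ω x z = star (L z) * gram Ω y (f z) * L z := by
  have e := (hΩ.formInChart_isPositiveOneOne y (h.mapsTo hz)).oneOne.gramOf_comp (L z)
  rw [← h.form z hz] at e
  exact e

theorem IsKahlerChartMap.chern_eq (hz : z ∈ U) (u : Cn n) :
    L z * chernConnection Ω x z u
      = chernConnection Ω y (f z) (L z u) * L z + fderiv ℝ L z u :=
  chernOf_pullback (G := gram Ω y) (G' := gram Ω x) h.holo hz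
    (hasFDerivAt_of_contDiffOn (hΩ.contDiffOn_gram y) (chartAt (Cn n) y).open_target
      (h.mapsTo hz)).differentiableAt (hΩ.isUnit_gram y (h.mapsTo hz)) (h.isUnit z hz)
    (fun _ hw => h.gram_eq hΩ hw) u

theorem IsKahlerChartMap.chern_symm (hz : z ∈ U)
    (hs : ∀ u w, chernConnection Ω y (f z) u w = chernConnection Ω y (f z) w u) (u w : Cn n) :
    chernConnection Ω x z u w = chernConnection Ω x z w u :=
  chernOf_symm_pullback (G := gram Ω y) (G' := gram Ω x) h.holo hz
    (hasFDerivAt_of_contDiffOn (hΩ.contDiffOn_gram y) (chartAt (Cn n) y).open_target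
      (h.mapsTo hz)).differentiableAt (hΩ.isUnit_gram y (h.mapsTo hz)) (h.isUnit z hz)
    (fun _ hw => h.gram_eq hΩ hw) hs u w

theorem IsKahlerChartMap.curvOf_eq (hz : z ∈ U) (u w : Cn n) :
    L z * curvOf (chernConnection Ω x) z ![u, w]
      = curvOf (chernConnection Ω y) (f z) ![L z u, L z w] * L z := by
  have hℓ : ContDiffOn ℝ ∞ (fun z => (L z).restrictScalars ℝ) U :=
    (ContinuousLinearMap.restrictScalarsL ℂ (Cn n) (Cn n) ℝ ℝ).contDiff.comp_contDiffOn
      h.holo.smooth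
  exact curvOf_gauge h.holo.isOpen hz h.holo.hasFDerivAt hℓ h.holo.smooth
    (hasFDerivAt_of_contDiffOn (hΩ.contDiffOn_chern y) (chartAt (Cn n) y).open_target
      (h.mapsTo hz)).differentiableAt
    (hasFDerivAt_of_contDiffOn (hΩ.contDiffOn_chern x) (chartAt (Cn n) x).open_target
      (h.subset hz)).differentiableAt (fun _ hw u => h.chern_eq hΩ hw u) u w

/-- Gram operator and complex Hessian both transform as Hermitian forms, by `star L` on the left and
`L` on the right. In the quotient the `star L` factors cancel and a conjugation remains. -/
theorem IsKahlerChartMap.hessian_eq {hx hy : Cn n → ℝ}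
    (hs : ContDiffOn ℝ ∞ hy (chartAt (Cn n) y).target) (he : ∀ w ∈ U, hx w = hy (f w))
    (hz : z ∈ U) :
    L z * (Complex.I • (Ring.inverse (gram Ω x z) * hessOf hx z))
      = (Complex.I • (Ring.inverse (gram Ω y (f z)) * hessOf hy (f z))) * L z := by
  have e1 : hessOf hx z = star (L z) * hessOf hy (f z) * L z := by
    rw [← hessOf_pullback h.holo hz hs (chartAt (Cn n) y).open_target h.mapsTo]
    exact hessOf_congr (Filter.eventually_of_mem (h.holo.isOpen.mem_nhds hz) he)
  have hG := hΩ.isUnit_gram y (h.mapsTo hz)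
  obtain ⟨ℓ, hℓ⟩ := h.isUnit z hz
  obtain ⟨g, hg⟩ := hG
  have e2 : Ring.inverse (star (L z) * gram Ω y (f z) * L z) =
      Ring.inverse (L z) * Ring.inverse (gram Ω y (f z)) * Ring.inverse (star (L z)) := by
    rw [← hℓ, ← hg, ← Units.coe_star, ← Units.val_mul, ← Units.val_mul, Ring.inverse_unit,
      Ring.inverse_unit, Ring.inverse_unit, Ring.inverse_unit, mul_inv_rev, mul_inv_rev,
      Units.val_mul, Units.val_mul, mul_assoc]
  have hs' : IsUnit (star (L z)) := (h.isUnit z hz).star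
  rw [h.gram_eq hΩ hz, e1, e2, mul_smul_comm, smul_mul_assoc]
  congr 1
  rw [mul_assoc (star (L z)), mul_assoc _ (Ring.inverse (star (L z))),
    Ring.inverse_mul_cancel_left _ _ hs', mul_assoc (Ring.inverse (L z)),
    Ring.mul_inverse_cancel_left _ _ (h.isUnit z hz), mul_assoc]

end

variable [IsManifold 𝓘(ℂ, Cn n) ∞ X]

/-- The change of charts from the preferred chart at `x` to the preferred chart at a point with
coordinates `z`. -/
theorem IsKahlerForm.exists_transition (hΩ : IsKahlerForm Ω) (x : X)
    (hz : z ∈ (chartAt (Cn n) x).target) :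
    ∃ f L U, IsKahlerChartMap Ω x ((chartAt (Cn n) x).symm z) f L U ∧ z ∈ U ∧
      f z = chartAt (Cn n) ((chartAt (Cn n) x).symm z) ((chartAt (Cn n) x).symm z) ∧
      L z = frame x z ∧ ∀ w ∈ U, (chartAt (Cn n) ((chartAt (Cn n) x).symm z)).symm (f w)
        = (chartAt (Cn n) x).symm w := by
  obtain ⟨L, hL, hL'⟩ := (isKahlerMap_id Ω).exists_isKahlerChartMap hΩ x
    ((chartAt (Cn n) x).symm z)
  have hzU : z ∈ chartDom id x ((chartAt (Cn n) x).symm z) :=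
    mem_chartDom hz (mem_chart_source _ _)
  refine ⟨_, L, _, hL, hzU, rfl, ContinuousLinearMap.ext fun u => ?_, fun w hw => symm_chartMap hw⟩
  rw [hL' z hzU, realD_id]
  change coframe _ (chartAt (Cn n) ((chartAt (Cn n) x).symm z) ((chartAt (Cn n) x).symm z)) _ = _
  rw [coframe_self]
  rfl

/-- A Kähler metric is torsion free. -/
theorem IsKahlerForm.chern_symm (hΩ : IsKahlerForm Ω) (x : X)
    (hz : z ∈ (chartAt (Cn n) x).target) (u w : Cn n) :
    chernConnection Ω x z u w = chernConnection Ω x z w u := by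
  -- Closedness is given at each point only in the preferred chart of that point. Torsion-freeness
  -- is proved there and carried back by the coordinate change.
  obtain ⟨f, L, U, h, hzU, hfz, -, -⟩ := hΩ.exists_transition x hz
  refine h.chern_symm hΩ hzU (fun u w => ?_) u w
  rw [hfz]
  set y := (chartAt (Cn n) x).symm z
  exact chernOf_gramOf_symm (hasFDerivAt_of_contDiffOn (hΩ.smooth y)
    (chartAt (Cn n) y).open_target (mem_chart_target _ y)).differentiableAt
    (chartAt (Cn n) y).open_target (mem_chart_target _ y)
    (fun w hw => hΩ.formInChart_isPositiveOneOne y hw) (hΩ.closed y) u w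

theorem contDiffOn_comp_chart_symm {h : X → ℝ} (hh : ContMDiff 𝓘(ℝ, Cn n) 𝓘(ℝ, ℝ) ∞ h) (x : X) :
    ContDiffOn ℝ ∞ (fun w => h ((chartAt (Cn n) x).symm w)) (chartAt (Cn n) x).target := by
  have : IsManifold 𝓘(ℝ, Cn n) ∞ X := isManifold_real
  rw [← contMDiffOn_iff_contDiffOn]
  exact hh.comp_contMDiffOn (contMDiffOn_chart_symm (I := 𝓘(ℝ, Cn n)))

/-- The section is defined at each point through a different chart, so its expression in one fixed
chart requires the transformation law. This is what allows it to be differentiated. -/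
theorem IsKahlerForm.endInChart_metricHessian (hΩ : IsKahlerForm Ω) {h : X → ℝ}
    (hh : ContMDiff 𝓘(ℝ, Cn n) 𝓘(ℝ, ℝ) ∞ h) (x : X) (hz : z ∈ (chartAt (Cn n) x).target) :
    endInChart (metricHessian Ω h) x z = Complex.I • (Ring.inverse (gram Ω x z)
      * hessOf (fun w => h ((chartAt (Cn n) x).symm w)) z) := by
  obtain ⟨f, L, U, hU, hzU, hfz, hLz, hf⟩ := hΩ.exists_transition x hz
  have e := hU.hessian_eq hΩ (hx := fun w => h ((chartAt (Cn n) x).symm w))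
    (contDiffOn_comp_chart_symm hh _) (fun w hw => by rw [hf w hw]) hzU
  rw [hLz, hfz] at e
  have e' := congrArg (fun T => coframe x z * T) e
  simp only [← mul_assoc, coframe_mul_frame x hz, one_mul] at e'
  exact e'.symm

/-- The components of the curvature in a chart. -/
theorem IsKahlerForm.curvOf_chern (hΩ : IsKahlerForm Ω) (x : X)
    (hz : z ∈ (chartAt (Cn n) x).target) :
    transport ((frame x z).restrictScalars ℝ) (coframe x z) (frame x z)
      (curvature (chernConnection Ω) ((chartAt (Cn n) x).symm z))
      = curvOf (chernConnection Ω x) z := by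
  obtain ⟨f, L, U, hU, hzU, hfz, hLz, hf⟩ := hΩ.exists_transition x hz
  refine ext_twoForm fun u w => ?_
  have e := hU.curvOf_eq hΩ hzU u w
  rw [hLz, hfz] at e
  have e' := congrArg (fun T => coframe x z * T) e
  simp only [← mul_assoc, coframe_mul_frame x hz, one_mul] at e'
  rw [e', transport_apply]
  congr 3
  funext i
  fin_cases i <;> rfl

end Naturality

end KahlerMoment
end

noncomputable section

namespace KahlerMoment

open Topology

/-! ### Lie group actions by Kähler automorphisms -/

section Action

variable {EK : Type*} [NormedAddCommGroup EK] [NormedSpace ℝ EK]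
  {K : Type*} [TopologicalSpace K] [ChartedSpace EK K] [Group K]
  {n : ℕ} {X : Type*} [TopologicalSpace X] [ChartedSpace (Cn n) X] [MulAction K X]

theorem contMDiff_smul_left
    (hact : ContMDiff ((𝓘(ℝ, EK)).prod 𝓘(ℝ, Cn n)) 𝓘(ℝ, Cn n) ∞ (fun p : K × X => p.1 • p.2))
    (k : K) : ContMDiff 𝓘(ℝ, Cn n) 𝓘(ℝ, Cn n) ∞ (fun x : X => k • x) :=
  hact.comp (contMDiff_const.prodMk contMDiff_id)

theorem contMDiff_smul_right
    (hact : ContMDiff ((𝓘(ℝ, EK)).prod 𝓘(ℝ, Cn n)) 𝓘(ℝ, Cn n) ∞ (fun p : K × X => p.1 • p.2))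
    (x : X) : ContMDiff 𝓘(ℝ, EK) 𝓘(ℝ, Cn n) ∞ (fun k : K => k • x) :=
  hact.comp (contMDiff_id.prodMk contMDiff_const)

omit [TopologicalSpace K] in
theorem actD_inv_actD (hk : ∀ k : K, ContMDiff 𝓘(ℝ, Cn n) 𝓘(ℝ, Cn n) ∞ (fun x : X => k • x))
    (k : K) (x : X) (u : Cn n) : actD k⁻¹ (k • x) (actD k x u) = u := by
  have h1 := ((hk k).mdifferentiableAt (by simp) (x := x)).hasMFDerivAt
  have h2 := ((hk k⁻¹).mdifferentiableAt (by simp) (x := k • x)).hasMFDerivAt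
  have h3 := HasMFDerivAt.comp x h2 h1
  have e : (fun x : X => k⁻¹ • x) ∘ (fun x : X => k • x) = id := funext fun x => inv_smul_smul k x
  rw [e] at h3
  have h4 := hasMFDerivAt_unique h3 (hasMFDerivAt_id x)
  exact congrArg (fun T : Cn n →L[ℝ] Cn n => T u) h4

omit [TopologicalSpace K] in
/-- Isometries preserving the Kähler form are holomorphic. -/
theorem isKahlerMap_smul {Ω : X → Cn n [⋀^Fin 2]→L[ℝ] ℝ} (hΩ : IsKahlerForm Ω)
    (hk : ∀ k : K, ContMDiff 𝓘(ℝ, Cn n) 𝓘(ℝ, Cn n) ∞ (fun x : X => k • x))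
    (hsymplectic : ∀ (k : K) (x : X) (u w : Cn n),
      Ω (k • x) ![actD k x u, actD k x w] = Ω x ![u, w])
    (hisometry : ∀ (k : K) (x : X) (u w : Cn n),
      Ω (k • x) ![actD k x u, Complex.I • actD k x w] = Ω x ![u, Complex.I • w]) (k : K) :
    IsKahlerMap Ω (fun x => k • x) := by
  refine ⟨hk k, fun x w => ?_, fun x => ?_⟩
  · change actD k x (Complex.I • w) = Complex.I • actD k x w
    have hsurj : ∀ c, ∃ u, actD k x u = c := fun c => ⟨actD k⁻¹ (k • x) c, by
      have := actD_inv_actD hk k⁻¹ (k • x) c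
      rw [inv_inv, inv_smul_smul] at this
      exact this⟩
    rw [← sub_eq_zero]
    -- The failure to commute with `i` is orthogonal, for the Kähler form, to the image of the
    -- differential by the two invariance hypotheses. That image is everything, so positivity forces
    -- it to vanish.
    set c := actD k x (Complex.I • w) - Complex.I • actD k x w with hc
    have h0 : ∀ u, Ω (k • x) ![u, c] = 0 := by
      intro u
      obtain ⟨u, rfl⟩ := hsurj u
      rw [hc, sub_eq_add_neg, twoForm_add_right, twoForm_neg_right, hsymplectic, hisometry]
      ring
    by_contra hne
    have := hΩ.pos (k • x) c hne
    have h1 := h0 (Complex.I • c)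
    rw [twoForm_swap] at h1
    linarith
  · refine ext_twoForm fun u w => ?_
    rw [← hsymplectic k x u w, ContinuousAlternatingMap.compContinuousLinearMap_apply]
    congr 1
    funext i
    fin_cases i <;> rfl

end Action

/-! ### Holomorphy of the generating vector fields. -/

section Fundamental

variable {EK : Type*} [NormedAddCommGroup EK] [NormedSpace ℝ EK]
  {K : Type*} [TopologicalSpace K] [ChartedSpace EK K] [Group K] [LieGroup 𝓘(ℝ, EK) ∞ K]
  {n : ℕ} {X : Type*} [TopologicalSpace X] [ChartedSpace (Cn n) X] [MulAction K X]

theorem hasMFDerivAt_chart_symm_self {H : Type*} [TopologicalSpace H] [ChartedSpace EK H]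
    [IsManifold 𝓘(ℝ, EK) 1 H] (k : H) :
    HasMFDerivAt 𝓘(ℝ, EK) 𝓘(ℝ, EK) (chartAt EK k).symm (chartAt EK k k)
      (ContinuousLinearMap.id ℝ EK) := by
  have h1 := (mdifferentiableAt_atlas_symm (I := 𝓘(ℝ, EK)) (chart_mem_atlas _ k)
    (mem_chart_target EK k)).hasMFDerivAt
  have h2 := (mdifferentiable_chart (I := 𝓘(ℝ, EK)) k).symm_comp_deriv (mem_chart_source EK k)
  have h3 : mfderiv 𝓘(ℝ, EK) 𝓘(ℝ, EK) (chartAt EK k) k = ContinuousLinearMap.id ℝ EK := by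
    refine (mfderiv_chartAt_eq_tangentCoordChange (I := 𝓘(ℝ, EK)) (mem_chart_source EK k)).trans ?_
    ext1 v
    exact tangentCoordChange_self (I := 𝓘(ℝ, EK)) (mem_extChartAt_source k)
  have h4 : mfderiv 𝓘(ℝ, EK) 𝓘(ℝ, EK) (chartAt EK k).symm (chartAt EK k k)
      = ContinuousLinearMap.id ℝ EK := by
    ext1 v
    refine Eq.trans ?_ (congrArg (fun T : EK →L[ℝ] EK => T v) h2)
    change _ = mfderiv 𝓘(ℝ, EK) 𝓘(ℝ, EK) (chartAt EK k).symm (chartAt EK k k)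
      (mfderiv 𝓘(ℝ, EK) 𝓘(ℝ, EK) (chartAt EK k) k v)
    rw [h3]
    rfl
  rw [h4] at h1
  exact h1

/-- The action in charts at `1` and `x`. -/
def actionMap (K : Type*) [TopologicalSpace K] [ChartedSpace EK K] [Group K] [MulAction K X]
    (x : X) (q : EK × Cn n) : Cn n :=
  chartAt (Cn n) x ((chartAt EK (1 : K)).symm q.1 • (chartAt (Cn n) x).symm q.2)

/-- The domain of `actionMap`. -/
def actionDom (K : Type*) [TopologicalSpace K] [ChartedSpace EK K] [Group K] [MulAction K X]
    (x : X) : Set (EK × Cn n) :=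
  ((chartAt EK (1 : K)).target ×ˢ (chartAt (Cn n) x).target) ∩
    (fun q : EK × Cn n => (chartAt EK (1 : K)).symm q.1 • (chartAt (Cn n) x).symm q.2) ⁻¹'
      (chartAt (Cn n) x).source

omit [NormedSpace ℝ EK] [LieGroup 𝓘(ℝ, EK) ∞ K] in
theorem mem_actionDom {x : X} {z : Cn n} (hz : z ∈ (chartAt (Cn n) x).target) :
    ((chartAt EK (1 : K) 1, z) : EK × Cn n) ∈ actionDom K x := by
  refine ⟨⟨mem_chart_target _ _, hz⟩, ?_⟩
  change (chartAt EK (1 : K)).symm (chartAt EK (1 : K) 1) • (chartAt (Cn n) x).symm z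
    ∈ (chartAt (Cn n) x).source
  rw [(chartAt EK (1 : K)).left_inv (mem_chart_source _ _), one_smul]
  exact (chartAt (Cn n) x).map_target hz

variable [IsManifold 𝓘(ℂ, Cn n) ∞ X]

theorem contMDiffOn_smul_chart
    (hact : ContMDiff ((𝓘(ℝ, EK)).prod 𝓘(ℝ, Cn n)) 𝓘(ℝ, Cn n) ∞ (fun p : K × X => p.1 • p.2))
    (x : X) : ContMDiffOn 𝓘(ℝ, EK × Cn n) 𝓘(ℝ, Cn n) ∞
      (fun q : EK × Cn n => (chartAt EK (1 : K)).symm q.1 • (chartAt (Cn n) x).symm q.2)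
      ((chartAt EK (1 : K)).target ×ˢ (chartAt (Cn n) x).target) := by
  have : IsManifold 𝓘(ℝ, Cn n) ∞ X := isManifold_real
  have h1 := contMDiffOn_chart_symm (I := 𝓘(ℝ, EK)) (n := ∞) (x := (1 : K))
  have h2 := contMDiffOn_chart_symm (I := 𝓘(ℝ, Cn n)) (n := ∞) (x := x)
  have h3 := hact.comp_contMDiffOn ((h1.comp (contMDiff_fst (I := 𝓘(ℝ, EK)) (J := 𝓘(ℝ, Cn n))).contMDiffOn
    (s := ((chartAt EK (1 : K)).target ×ˢ (chartAt (Cn n) x).target)) fun q hq => hq.1).prodMk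
    (h2.comp (contMDiff_snd (I := 𝓘(ℝ, EK)) (J := 𝓘(ℝ, Cn n))).contMDiffOn fun q hq => hq.2))
  rw [← modelWithCornersSelf_prod, chartedSpaceSelf_prod] at h3
  exact h3

theorem isOpen_actionDom
    (hact : ContMDiff ((𝓘(ℝ, EK)).prod 𝓘(ℝ, Cn n)) 𝓘(ℝ, Cn n) ∞ (fun p : K × X => p.1 • p.2))
    (x : X) : IsOpen (actionDom (EK := EK) (n := n) K x) :=
  (contMDiffOn_smul_chart hact x).continuousOn.isOpen_inter_preimage
    ((chartAt EK (1 : K)).open_target.prod (chartAt (Cn n) x).open_target)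
    (chartAt (Cn n) x).open_source

theorem contDiffOn_actionMap
    (hact : ContMDiff ((𝓘(ℝ, EK)).prod 𝓘(ℝ, Cn n)) 𝓘(ℝ, Cn n) ∞ (fun p : K × X => p.1 • p.2))
    (x : X) : ContDiffOn ℝ ∞ (actionMap (EK := EK) (n := n) K x) (actionDom K x) := by
  have : IsManifold 𝓘(ℝ, Cn n) ∞ X := isManifold_real
  have h2 := contMDiffOn_chart (I := 𝓘(ℝ, Cn n)) (n := ∞) (x := x)
  rw [← contMDiffOn_iff_contDiffOn]
  exact h2.comp ((contMDiffOn_smul_chart hact x).mono Set.inter_subset_left) fun q hq => hq.2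

theorem fderiv_actionMap_snd
    (hact : ContMDiff ((𝓘(ℝ, EK)).prod 𝓘(ℝ, Cn n)) 𝓘(ℝ, Cn n) ∞ (fun p : K × X => p.1 • p.2))
    {x : X} {q : EK × Cn n} (hq : q ∈ actionDom K x) (u : Cn n) :
    fderiv ℝ (actionMap K x) q (0, u)
      = fderiv ℝ (chartMap (fun y => (chartAt EK (1 : K)).symm q.1 • y) x x) q.2 u := by
  have h1 := hasFDerivAt_of_contDiffOn (contDiffOn_actionMap hact x) (isOpen_actionDom hact x) hq
  have h2 : HasFDerivAt (fun z : Cn n => (q.1, z)) (ContinuousLinearMap.inr ℝ EK (Cn n)) q.2 :=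
    hasFDerivAt_prodMk_right q.1 q.2
  have h3 : HasFDerivAt (chartMap (fun y => (chartAt EK (1 : K)).symm q.1 • y) x x)
    ((fderiv ℝ (actionMap K x) q).comp (ContinuousLinearMap.inr ℝ EK (Cn n))) q.2 :=
    HasFDerivAt.comp q.2 (g := actionMap K x) h1 h2
  rw [h3.fderiv]
  rfl

/-- The generating vector fields in a chart. -/
theorem vectorInChart_fund
    (hact : ContMDiff ((𝓘(ℝ, EK)).prod 𝓘(ℝ, Cn n)) 𝓘(ℝ, Cn n) ∞ (fun p : K × X => p.1 • p.2))
    (v : LieAlg (EK := EK) K) {x : X} {z : Cn n} (hz : z ∈ (chartAt (Cn n) x).target) :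
    vectorInChart (fund v) x z
      = fderiv ℝ (actionMap (EK := EK) K x) (chartAt EK (1 : K) 1, z) ((v : EK), 0) := by
  have : IsManifold 𝓘(ℝ, EK) 1 K := IsManifold.of_le (n := ∞) (by simp)
  have h1 := hasFDerivAt_of_contDiffOn (contDiffOn_actionMap hact x) (isOpen_actionDom hact x)
    (mem_actionDom (K := K) hz)
  have h2 : HasFDerivAt (fun a : EK => (a, z)) (ContinuousLinearMap.inl ℝ EK (Cn n))
    (chartAt EK (1 : K) 1) := hasFDerivAt_prodMk_left _ z
  have h3 := HasFDerivAt.comp (chartAt EK (1 : K) 1) (g := actionMap K x)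
    (f := fun a : EK => (a, z)) h1 h2
  have e1 := hasMFDerivAt_chart_symm_self (EK := EK) (1 : K)
  have e2 := ((contMDiff_smul_right hact ((chartAt (Cn n) x).symm z)).mdifferentiableAt (by simp)
    (x := (1 : K))).hasMFDerivAt
  have e3 := hasMFDerivAt_chart x hz
  have he : (chartAt EK (1 : K)).symm (chartAt EK (1 : K) 1) = 1 :=
    (chartAt EK (1 : K)).left_inv (mem_chart_source _ _)
  rw [← he] at e2
  have e4 := HasMFDerivAt.comp _ e2 e1
  have he' : (chartAt (Cn n) x).symm z = (((fun k : K => k • (chartAt (Cn n) x).symm z) ∘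
      (chartAt EK (1 : K)).symm) (chartAt EK (1 : K) 1)) := by
    rw [Function.comp_apply, he, one_smul]
  rw [he'] at e3
  have e5 : HasFDerivAt (fun a : EK => actionMap K x (a, z))
      ((((coframe x z).restrictScalars ℝ : Cn n →L[ℝ] Cn n).comp
        ((mfderiv 𝓘(ℝ, EK) 𝓘(ℝ, Cn n) (fun k : K => k • (chartAt (Cn n) x).symm z)
          ((chartAt EK (1 : K)).symm (chartAt EK (1 : K) 1)) : EK →L[ℝ] Cn n).comp
          (ContinuousLinearMap.id ℝ EK)))) (chartAt EK (1 : K) 1) :=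
    (HasMFDerivAt.comp _ e3 e4).hasFDerivAt
  have hT := congrArg (fun T : EK →L[ℝ] Cn n => T v) (e5.unique h3)
  refine Eq.trans ?_ hT
  rw [he]
  rfl

/-- The generating vector fields are holomorphic. -/
theorem exists_holoOn_fund
    (hact : ContMDiff ((𝓘(ℝ, EK)).prod 𝓘(ℝ, Cn n)) 𝓘(ℝ, Cn n) ∞ (fun p : K × X => p.1 • p.2))
    (hI : ∀ (k : K) (x : X) (u : Cn n), actD k x (Complex.I • u) = Complex.I • actD k x u)
    (v : LieAlg (EK := EK) K) (x : X) :
    ∃ DV, HoloOn (vectorInChart (fund v) x) DV (chartAt (Cn n) x).target := by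
  have hV := fun z hz => vectorInChart_fund hact v (x := x) (z := z) hz
  have hF := contDiffOn_actionMap hact x
  have hD := isOpen_actionDom hact x
  have hF' : ContDiffOn ℝ ∞ (fderiv ℝ (actionMap K x)) (actionDom K x) :=
    hF.fderiv_of_isOpen hD (by simp)
  have hT := (chartAt (Cn n) x).open_target
  have hpair : ContDiff ℝ ∞ (fun z : Cn n => ((chartAt EK (1 : K) 1, z) : EK × Cn n)) :=
    contDiff_const.prodMk contDiff_id
  have hVs : ContDiffOn ℝ ∞ (fun z => fderiv ℝ (actionMap (EK := EK) K x)
      (chartAt EK (1 : K) 1, z) ((v : EK), 0)) (chartAt (Cn n) x).target :=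
    (hF'.comp hpair.contDiffOn fun z hz => mem_actionDom hz).clm_apply contDiffOn_const
  refine holoOn_of_fderiv_smul_I hT (hVs.congr hV) fun z hz u => ?_
  have hq := mem_actionDom (K := K) (EK := EK) hz
  have hF'd := hasFDerivAt_of_contDiffOn hF' hD hq
  -- The generating field is the group derivative of the action map, so its derivative along X is a
  -- mixed second derivative. Symmetry puts the manifold direction innermost.
  have hder : ∀ u, fderiv ℝ (vectorInChart (fund v) x) z u
      = fderiv ℝ (fderiv ℝ (actionMap (EK := EK) K x)) (chartAt EK (1 : K) 1, z) ((v : EK), 0)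
        (0, u) := by
    intro u
    have he : vectorInChart (fund v) x =ᶠ[𝓝 z] fun z => fderiv ℝ (actionMap (EK := EK) K x)
      (chartAt EK (1 : K) 1, z) ((v : EK), 0) := Filter.eventually_of_mem (hT.mem_nhds hz) hV
    have h2 : HasFDerivAt (fun z : Cn n => ((chartAt EK (1 : K) 1, z) : EK × Cn n))
      (ContinuousLinearMap.inr ℝ EK (Cn n)) z := hasFDerivAt_prodMk_right _ z
    obtain ⟨a, ha, ha'⟩ := hasFDerivAt_clm_apply (hF'd.comp z h2)
      (hasFDerivAt_const ((v : EK), (0 : Cn n)) z)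
    have ha2 : fderiv ℝ (vectorInChart (fund v) x) z = a := by
      rw [he.fderiv_eq]
      exact ha.fderiv
    rw [ha2, ha', fderiv_fderiv_symm hF hD hq]
    exact (congrArg₂ (· + ·) rfl (map_zero _)).trans (add_zero _)
  -- For each fixed group element the action is holomorphic. This holds on an open set of
  -- parameters, so the identity can be differentiated in the direction `v`.
  have hlin : ∀ q ∈ actionDom (EK := EK) (n := n) K x, fderiv ℝ (actionMap K x) q (0, Complex.I • u)
      = Complex.I • fderiv ℝ (actionMap K x) q (0, u) := by
    intro q hq
    have hq' : q.2 ∈ chartDom (fun y => (chartAt EK (1 : K)).symm q.1 • y) x x :=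
      mem_chartDom hq.1.2 hq.2
    have hd := (hasFDerivAt_chartMap
      (contMDiff_smul_left hact ((chartAt EK (1 : K)).symm q.1)) hq').fderiv
    rw [fderiv_actionMap_snd hact hq, fderiv_actionMap_snd hact hq, hd]
    have := hI ((chartAt EK (1 : K)).symm q.1) ((chartAt (Cn n) x).symm q.2) (frame x q.2 u)
    change coframe x _ (actD _ _ (frame x q.2 (Complex.I • u)))
      = Complex.I • coframe x _ (actD _ _ (frame x q.2 u))
    rw [map_smul, this, map_smul]
  obtain ⟨a, ha, ha'⟩ := hasFDerivAt_clm_apply hF'd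
    (hasFDerivAt_const ((0 : EK), Complex.I • u) (chartAt EK (1 : K) 1, z))
  obtain ⟨b, hb, hb'⟩ := hasFDerivAt_clm_apply hF'd
    (hasFDerivAt_const ((0 : EK), u) (chartAt EK (1 : K) 1, z))
  have hlin' : (fun q => fderiv ℝ (actionMap (EK := EK) K x) q (0, Complex.I • u))
      =ᶠ[𝓝 (chartAt EK (1 : K) 1, z)] fun q => Complex.I • fderiv ℝ (actionMap K x) q (0, u) :=
    Filter.eventually_of_mem (hD.mem_nhds hq) hlin
  have he := (ha.congr_of_eventuallyEq hlin'.symm).unique (hb.const_smul Complex.I)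
  have he' := congrArg (fun T : EK × Cn n →L[ℝ] Cn n => T ((v : EK), 0)) he
  simp only [smul_apply, ha', hb', zero_apply, map_zero, add_zero] at he'
  rw [hder, hder]
  exact he'

end Fundamental

end KahlerMoment
end

noncomputable section

namespace KahlerMoment

open Topology

/-! ### The moment map of the tangent bundle -/

section HessianLinear

variable {n : ℕ} {U : Set (Cn n)} {z : Cn n} {h h' : Cn n → ℝ}

theorem hessOf_add (hh : ContDiffOn ℝ ∞ h U) (hh' : ContDiffOn ℝ ∞ h' U) (hU : IsOpen U)
    (hz : z ∈ U) : hessOf (fun y => h y + h' y) z = hessOf h z + hessOf h' z := by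
  have e : fderiv ℝ (fderiv ℝ fun y => h y + h' y) z
      = fderiv ℝ (fderiv ℝ h) z + fderiv ℝ (fderiv ℝ h') z := by
    have e1 : fderiv ℝ (fun y => h y + h' y) =ᶠ[𝓝 z] fun y => fderiv ℝ h y + fderiv ℝ h' y :=
      Filter.eventually_of_mem (hU.mem_nhds hz) fun y hy =>
        ((hasFDerivAt_of_contDiffOn hh hU hy).fun_add (hasFDerivAt_of_contDiffOn hh' hU hy)).fderiv
    rw [e1.fderiv_eq]
    exact ((hasFDerivAt_of_contDiffOn (hh.fderiv_of_isOpen hU (m := ∞) (by simp)) hU hz).fun_add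
      (hasFDerivAt_of_contDiffOn (hh'.fderiv_of_isOpen hU (m := ∞) (by simp)) hU hz)).fderiv
  refine ext_inner_end fun s t => ?_
  rw [add_apply, inner_add_right, inner_hessOf (hh.add hh') hU hz, inner_hessOf hh hU hz,
    inner_hessOf hh' hU hz, e]
  simp only [levi, add_apply]
  push_cast
  ring

theorem hessOf_smul (hh : ContDiffOn ℝ ∞ h U) (c : ℝ) (hU : IsOpen U)
    (hz : z ∈ U) : hessOf (fun y => c * h y) z = (c : ℂ) • hessOf h z := by
  have e : fderiv ℝ (fderiv ℝ fun y => c * h y) z = c • fderiv ℝ (fderiv ℝ h) z := by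
    have e1 : fderiv ℝ (fun y => c * h y) =ᶠ[𝓝 z] fun y => c • fderiv ℝ h y :=
      Filter.eventually_of_mem (hU.mem_nhds hz) fun y hy =>
        ((hasFDerivAt_of_contDiffOn hh hU hy).const_mul c).fderiv
    rw [e1.fderiv_eq]
    exact ((hasFDerivAt_of_contDiffOn (hh.fderiv_of_isOpen hU (m := ∞) (by simp)) hU
      hz).const_smul c).fderiv
  refine ext_inner_end fun s t => ?_
  have hc : ContDiffOn ℝ ∞ (fun y => c * h y) U := contDiffOn_const.mul hh
  rw [smul_apply, inner_smul_right, inner_hessOf hc hU hz, inner_hessOf hh hU hz, e]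
  simp only [levi, smul_apply, smul_eq_mul]
  push_cast
  ring

end HessianLinear

/-! ### Invariance of the connection, and the bundle moment map. -/

section Moment

variable {EK : Type*} [NormedAddCommGroup EK] [NormedSpace ℝ EK]
  {K : Type*} [TopologicalSpace K] [ChartedSpace EK K] [Group K]
  {n : ℕ} {X : Type*} [TopologicalSpace X] [ChartedSpace (Cn n) X]
  [IsManifold 𝓘(ℂ, Cn n) ∞ X] [MulAction K X] {Ω : X → Cn n [⋀^Fin 2]→L[ℝ] ℝ}

theorem metricHessian_add {h h' : X → ℝ} (hh : ContMDiff 𝓘(ℝ, Cn n) 𝓘(ℝ, ℝ) ∞ h)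
    (hh' : ContMDiff 𝓘(ℝ, Cn n) 𝓘(ℝ, ℝ) ∞ h') (x : X) :
    metricHessian Ω (fun y => h y + h' y) x = metricHessian Ω h x + metricHessian Ω h' x := by
  have e := hessOf_add (contDiffOn_comp_chart_symm hh x) (contDiffOn_comp_chart_symm hh' x)
    (chartAt (Cn n) x).open_target (mem_chart_target _ x)
  change Complex.I • (_ * hessOf _ _) = Complex.I • (_ * hessOf _ _) + Complex.I • (_ * hessOf _ _)
  rw [e, mul_add, smul_add]

theorem metricHessian_smul {h : X → ℝ} (hh : ContMDiff 𝓘(ℝ, Cn n) 𝓘(ℝ, ℝ) ∞ h) (c : ℝ) (x : X) :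
    metricHessian Ω (fun y => c * h y) x = (c : ℂ) • metricHessian Ω h x := by
  have e := hessOf_smul (contDiffOn_comp_chart_symm hh x) c
    (chartAt (Cn n) x).open_target (mem_chart_target _ x)
  change Complex.I • (_ * hessOf _ _) = (c : ℂ) • (Complex.I • (_ * hessOf _ _))
  rw [e, mul_smul_comm, smul_comm]

theorem exists_localMoment [LieGroup 𝓘(ℝ, EK) ∞ K] (hΩ : IsKahlerForm Ω)
    (hact : ContMDiff ((𝓘(ℝ, EK)).prod 𝓘(ℝ, Cn n)) 𝓘(ℝ, Cn n) ∞ (fun p : K × X => p.1 • p.2))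
    (hI : ∀ (k : K) (x : X) (u : Cn n), actD k x (Complex.I • u) = Complex.I • actD k x u)
    {μ : X → Module.Dual ℝ (LieAlg (EK := EK) K)} (hμ : IsMomentMap Ω μ)
    (v : LieAlg (EK := EK) K) (x : X) :
    ∃ DV, LocalMoment (formInChart Ω x) (fun w => μ ((chartAt (Cn n) x).symm w) v)
      (vectorInChart (fund v) x) DV (chartAt (Cn n) x).target := by
  obtain ⟨DV, hDV⟩ := exists_holoOn_fund hact hI v x
  refine ⟨DV, hDV, hΩ.smooth x, fun y hy => hΩ.formInChart_isPositiveOneOne x hy,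
    fun y hy u w => hΩ.chern_symm x hy u w, contDiffOn_comp_chart_symm (hμ.smooth v) x,
    fun y hy u => ?_⟩
  have h1 := hasMFDerivAt_chart_symm x hy
  obtain ⟨T, h2, hT⟩ : ∃ T : Cn n →L[ℝ] ℝ, HasMFDerivAt 𝓘(ℝ, Cn n) 𝓘(ℝ, ℝ) (fun y => μ y v)
      ((chartAt (Cn n) x).symm y) T ∧ ∀ u, T u = -Ω _ ![fund v ((chartAt (Cn n) x).symm y), u] :=
    ⟨_, ((hμ.smooth v).mdifferentiableAt (by simp)
      (x := (chartAt (Cn n) x).symm y)).hasMFDerivAt, hμ.hamiltonian v _⟩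
  have h3 : HasFDerivAt (fun w => μ ((chartAt (Cn n) x).symm w) v)
      (T.comp ((frame x y).restrictScalars ℝ)) y :=
    (HasMFDerivAt.comp y h2 h1).hasFDerivAt
  rw [h3.fderiv]
  refine (hT (frame x y u)).trans ?_
  rw [formInChart, ContinuousAlternatingMap.compContinuousLinearMap_apply]
  congr 2
  funext i
  fin_cases i
  · exact (congrArg (fun T : EndC n => T (fund v ((chartAt (Cn n) x).symm y)))
      (frame_mul_coframe x hy)).symm
  · rfl

omit [TopologicalSpace K] in
/-- The action of `k` in the preferred charts at `x` and `k • x`. -/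
theorem exists_smul_chartMap (hΩ : IsKahlerForm Ω) {k : K}
    (hk : IsKahlerMap Ω (fun x : X => k • x)) (x : X) :
    ∃ f L U, IsKahlerChartMap Ω x (k • x) f L U ∧ chartAt (Cn n) x x ∈ U ∧
      f (chartAt (Cn n) x x) = chartAt (Cn n) (k • x) (k • x) ∧
      (∀ u, L (chartAt (Cn n) x x) u = actD k x u) ∧
      (∀ w ∈ U, (chartAt (Cn n) (k • x)).symm (f w) = k • (chartAt (Cn n) x).symm w) ∧
      ∀ w ∈ U, ∀ u, L w u = coframe (k • x) (f w)
        (actD k ((chartAt (Cn n) x).symm w) (frame x w u)) := by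
  obtain ⟨L, hL, hL'⟩ := hk.exists_isKahlerChartMap hΩ x (k • x)
  have hx : (chartAt (Cn n) x).symm (chartAt (Cn n) x x) = x :=
    (chartAt (Cn n) x).left_inv (mem_chart_source _ x)
  have hzU : chartAt (Cn n) x x ∈ chartDom (fun x : X => k • x) x (k • x) :=
    mem_chartDom (mem_chart_target _ x) (by rw [hx]; exact mem_chart_source _ _)
  have hf : chartMap (fun x : X => k • x) x (k • x) (chartAt (Cn n) x x)
      = chartAt (Cn n) (k • x) (k • x) := by rw [chartMap, hx]
  refine ⟨_, L, _, hL, hzU, hf, fun u => ?_, fun w hw => symm_chartMap hw, hL'⟩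
  rw [hL' _ hzU, hf, coframe_self, frame_self, hx]
  rfl

omit [TopologicalSpace K] in
theorem IsKahlerChartMap.vectorInChart_smul {x : X} {k : K} {f : Cn n → Cn n}
    {L : Cn n → EndC n} {U : Set (Cn n)} (h : IsKahlerChartMap Ω x (k • x) f L U)
    (hf : ∀ w ∈ U, (chartAt (Cn n) (k • x)).symm (f w) = k • (chartAt (Cn n) x).symm w)
    (hL : ∀ w ∈ U, ∀ u, L w u = coframe (k • x) (f w)
        (actD k ((chartAt (Cn n) x).symm w) (frame x w u)))
    {s s' : X → Cn n} (hs : ∀ y, s' (k • y) = actD k y (s y)) {w : Cn n} (hw : w ∈ U) :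
    vectorInChart s' (k • x) (f w) = L w (vectorInChart s x w) := by
  rw [hL w hw, vectorInChart, hf w hw, hs, vectorInChart]
  congr 2
  exact (congrArg (fun T : EndC n => T (s ((chartAt (Cn n) x).symm w)))
    (frame_mul_coframe x (h.subset hw))).symm

-- Acting by `k⁻¹` near `k • x` expresses the translated section as the inverse differential applied
-- to the smooth section `s` composed with a smooth chart map. Without this the covariant derivative
-- of the translate would have no product rule.
omit [TopologicalSpace K] in
theorem differentiableAt_vectorInChart_smul (hΩ : IsKahlerForm Ω)
    (hk : ∀ k : K, IsKahlerMap Ω (fun x : X => k • x)) {k : K} {s s' : X → Cn n}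
    (hs : IsSmoothVector s) (hss' : ∀ y, s' (k • y) = actD k y (s y)) (x : X) :
    DifferentiableAt ℝ (vectorInChart s' (k • x)) (chartAt (Cn n) (k • x) (k • x)) := by
  obtain ⟨f, L, U, h, hzU, hfz, hLz, hf, hL⟩ := exists_smul_chartMap hΩ (hk k⁻¹) (k • x)
  have hss : ∀ y, s (k⁻¹ • y) = actD k⁻¹ y (s' y) := fun y => by
    have h1 := actD_inv_actD (fun k => (hk k).smooth) k (k⁻¹ • y) (s (k⁻¹ • y))
    rw [← hss', smul_inv_smul] at h1
    exact h1.symm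
  have hS := fun w hw => h.vectorInChart_smul hf hL hss (w := w) hw
  have h1 : ContDiffOn ℝ ∞ (fun w => Ring.inverse (L w)) U :=
    contDiffOn_inverse h.holo.smooth h.isUnit
  have h2 : ContDiffOn ℝ ∞ (fun w => vectorInChart s (k⁻¹ • k • x) (f w)) U :=
    (hs _).comp h.holo.contDiffOn h.mapsTo
  have h3 : ContDiffOn ℝ ∞ (fun w => (Ring.inverse (L w)).restrictScalars ℝ) U :=
    (ContinuousLinearMap.restrictScalarsL ℂ (Cn n) (Cn n) ℝ ℝ).contDiff.comp_contDiffOn h1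
  have hc : ContDiffOn ℝ ∞ (vectorInChart s' (k • x)) U := by
    refine (h3.clm_apply h2).congr fun w hw => ?_
    rw [hS w hw]
    exact (congrArg (fun T : EndC n => T (vectorInChart s' (k • x) w))
      (Ring.inverse_mul_cancel _ (h.isUnit w hw))).symm
  exact (hasFDerivAt_of_contDiffOn hc h.holo.isOpen hzU).differentiableAt

/-- The derivative of `L` in the product rule for `L (S)` is compensated by the inhomogeneous term
in the transformation law of the connection form. -/
theorem IsKahlerChartMap.covariant_smul {x y : X} {f : Cn n → Cn n}
    {L : Cn n → EndC n} {U : Set (Cn n)} {z : Cn n} (hΩ : IsKahlerForm Ω)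
    (h : IsKahlerChartMap Ω x y f L U) (hz : z ∈ U) {S S' : Cn n → Cn n}
    (hS : DifferentiableAt ℝ S z) (hS' : DifferentiableAt ℝ S' (f z))
    (he : ∀ w ∈ U, S' (f w) = L w (S w)) (u : Cn n) :
    fderiv ℝ S' (f z) (L z u) + chernConnection Ω y (f z) (L z u) (L z (S z))
      = L z (fderiv ℝ S z u + chernConnection Ω x z u (S z)) := by
  obtain ⟨a, ha, ha'⟩ := hasFDerivAt_end_apply (h.holo.hasFDerivAt_deriv hz) hS.hasFDerivAt
  have hcomp : HasFDerivAt (fun w => S' (f w))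
      ((fderiv ℝ S' (f z)).comp ((L z).restrictScalars ℝ)) z :=
    hS'.hasFDerivAt.comp z (h.holo.hasFDerivAt z hz)
  have he' : (fun w => S' (f w)) =ᶠ[𝓝 z] fun w => L w (S w) :=
    Filter.eventually_of_mem (h.holo.isOpen.mem_nhds hz) he
  have hder := congrArg (fun T : Cn n →L[ℝ] Cn n => T u)
    (hcomp.unique (ha.congr_of_eventuallyEq he'))
  have hder' : fderiv ℝ S' (f z) (L z u) = fderiv ℝ L z u (S z) + L z (fderiv ℝ S z u) :=
    hder.trans (ha' u)
  have hchern : L z (chernConnection Ω x z u (S z)) = chernConnection Ω y (f z) (L z u) (L z (S z))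
    + fderiv ℝ L z u (S z) := congrArg (fun T : EndC n => T (S z)) (h.chern_eq hΩ hz u)
  rw [hder', map_add, hchern]
  abel

/-- The Chern connection of an invariant Kähler metric is invariant. -/
theorem isInvariantConnection_chern (hΩ : IsKahlerForm Ω)
    (hk : ∀ k : K, IsKahlerMap Ω (fun x : X => k • x)) :
    IsInvariantConnection K (chernConnection Ω) := by
  intro k s hs x u
  obtain ⟨s', hs'⟩ : ∃ s' : X → Cn n, s' = fun y => actD k (k⁻¹ • y) (s (k⁻¹ • y)) := ⟨_, rfl⟩
  have hss' : ∀ y, s' (k • y) = actD k y (s y) := fun y => by simp only [hs', inv_smul_smul]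
  rw [← hs']
  obtain ⟨f, L, U, h, hzU, hfz, hLz, hf, hL⟩ := exists_smul_chartMap hΩ (hk k) x
  have hS := fun w hw => h.vectorInChart_smul hf hL hss' (w := w) hw
  have hSd := (hasFDerivAt_of_contDiffOn (hs x) (chartAt (Cn n) x).open_target
    (mem_chart_target _ x)).differentiableAt
  have hS'd := differentiableAt_vectorInChart_smul hΩ hk hs hss' x
  rw [← hfz] at hS'd
  have e := h.covariant_smul hΩ hzU hSd hS'd hS u
  rw [covDeriv, covDeriv, hss', ← hfz, ← hLz, ← hLz, ← hLz]
  rw [vectorInChart_self] at e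
  exact e

/-- The metric Hessians of the components of a moment map form a moment map of the tangent bundle. -/
theorem isBundleMomentMap_metricHessian [LieGroup 𝓘(ℝ, EK) ∞ K] (hΩ : IsKahlerForm Ω)
    (hact : ContMDiff ((𝓘(ℝ, EK)).prod 𝓘(ℝ, Cn n)) 𝓘(ℝ, Cn n) ∞ (fun p : K × X => p.1 • p.2))
    (hk : ∀ k : K, IsKahlerMap Ω (fun x : X => k • x))
    {μ : X → Module.Dual ℝ (LieAlg (EK := EK) K)} (hμ : IsMomentMap Ω μ) :
    IsBundleMomentMap (chernConnection Ω)
      (fun v : LieAlg (EK := EK) K => metricHessian Ω (fun x => μ x v)) := by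
  have hloc := exists_localMoment hΩ hact (fun k x u => (hk k).map_I x u) hμ
  refine ⟨fun v w x => ?_, fun c v x => ?_, fun v x => ?_, fun k v x u => ?_, fun v x u => ?_⟩
  · simp only [map_add]
    exact metricHessian_add (hμ.smooth v) (hμ.smooth w) x
  · simp only [map_smul, smul_eq_mul]
    exact metricHessian_smul (hμ.smooth v) c x
  · obtain ⟨DV, h⟩ := hloc v x
    exact h.contDiffOn_hessian.congr fun z hz => hΩ.endInChart_metricHessian (hμ.smooth v) x hz
  -- Equivariance of μ says that the component along `Ad k v`, pulled back by `k`, is the component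
  -- along `v`. Naturality of the metric Hessian does the rest.
  · obtain ⟨f, L, U, h, hzU, hfz, hLz, hf, -⟩ := exists_smul_chartMap hΩ (hk k) x
    have e := h.hessian_eq hΩ (hx := fun w => μ ((chartAt (Cn n) x).symm w) v)
      (hy := fun w => μ ((chartAt (Cn n) (k • x)).symm w) (Ad k v))
      (contDiffOn_comp_chart_symm (hμ.smooth _) _)
      (fun w hw => by rw [hf w hw, hμ.equivariant]) hzU
    rw [hfz] at e
    have e' := congrArg (fun T : EndC n => T u) e
    change L _ (metricHessian Ω (fun x => μ x v) x u)
      = metricHessian Ω (fun x => μ x (Ad k v)) (k • x) (L _ u) at e'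
    rw [hLz, hLz] at e'
    exact e'.symm
  · obtain ⟨DV, h⟩ := hloc v x
    have hz := mem_chart_target (Cn n) x
    have e := h.moment hz u
    rw [vectorInChart_self] at e
    have he : endInChart (metricHessian Ω fun x => μ x v) x =ᶠ[𝓝 (chartAt (Cn n) x x)]
        fun z => Complex.I • (Ring.inverse (gramOf (formInChart Ω x z))
          * hessOf (fun w => μ ((chartAt (Cn n) x).symm w) v) z) :=
      Filter.eventually_of_mem ((chartAt (Cn n) x).open_target.mem_nhds hz) fun z hz =>
        hΩ.endInChart_metricHessian (hμ.smooth v) x hz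
    rw [covDerivEnd, he.fderiv_eq]
    exact e

end Moment

end KahlerMoment
end

noncomputable section

namespace KahlerMoment

open Topology

/-! ### The equivariant Chern character -/

section ChernForm

variable {E A B : Type*} [NormedAddCommGroup E] [NormedSpace ℝ E] [NormedRing A] [NormedAlgebra ℝ A]
  [NormedRing B] [NormedAlgebra ℝ B]

/-- The components of `τ ((S (H + R)) ^ k)`. -/
def chernForm (τ : A →L[ℝ] B) (S : A →L[ℝ] A) (H : A) (R : E [⋀^Fin 2]→L[ℝ] A) (k p : ℕ) :
    E [⋀^Fin p]→L[ℝ] B :=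
  τ.compContinuousAlternatingMap
    (powMixed (fun q => S.compContinuousAlternatingMap (mixedOf H R q)) k p)

/-- Conjugation passes through `S` and the powers and is then removed by `τ`; only the pull-back is
left. Independence of the frame and K-equivariance are both instances. -/
theorem chernForm_transport {E' : Type*} [NormedAddCommGroup E'] [NormedSpace ℝ E']
    {τ : A →L[ℝ] B} {S : A →L[ℝ] A} (hSl : ∀ x y, S (x * y) = x * S y)
    (hSr : ∀ x y, S (x * y) = S x * y) (hτ : ∀ c x d, c * d = 1 → d * c = 1 → τ (c * x * d) = τ x)
    (g : E' →L[ℝ] E) {c d : A} (hcd : c * d = 1) (hdc : d * c = 1) (H : A)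
    (R : E [⋀^Fin 2]→L[ℝ] A) (k p : ℕ) :
    chernForm τ S (c * H * d) (transport g c d R) k p
      = (chernForm τ S H R k p).compContinuousLinearMap g := by
  have e : ∀ q, S.compContinuousAlternatingMap (mixedOf (c * H * d) (transport g c d R) q)
      = transport g c d (S.compContinuousAlternatingMap (mixedOf H R q)) := by
    intro q
    rw [← transport_mixedOf]
    ext w
    change S (c * _ * d) = c * S _ * d
    rw [hSr, hSl]
    rfl
  rw [chernForm]
  simp only [e]
  rw [← transport_powMixed g hcd hdc]
  ext w
  exact hτ _ _ _ hcd hdc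

theorem contDiffAt_chernForm {τ : A →L[ℝ] B} {S : A →L[ℝ] A} {H : E → A}
    {R : E → E [⋀^Fin 2]→L[ℝ] A} {z : E} {m : WithTop ℕ∞} (hH : ContDiffAt ℝ m H z)
    (hR : ContDiffAt ℝ m R z) (k p : ℕ) :
    ContDiffAt ℝ m (fun y => chernForm τ S (H y) (R y) k p) z := by
  have hS : ∀ p, ContDiffAt ℝ m
      (fun y => S.compContinuousAlternatingMap (mixedOf (H y) (R y) p)) z := fun p =>
    (ContinuousLinearMap.compContinuousAlternatingMapCLM ℝ E A A (ι := Fin p)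
      S).contDiff.contDiffAt.comp z (contDiffAt_mixedOf hH hR p)
  exact (ContinuousLinearMap.compContinuousAlternatingMapCLM ℝ E A B (ι := Fin p)
      τ).contDiff.contDiffAt.comp z (contDiffAt_powMixed hS k p)

theorem contDiffOn_chernForm_curvOf {τ : A →L[ℝ] B} {S : A →L[ℝ] A} {H : E → A}
    {θ : E → E →L[ℝ] A} {U : Set E} (hU : IsOpen U) (hH : ContDiffOn ℝ ∞ H U)
    (hθ : ContDiffOn ℝ ∞ θ U) (k p : ℕ) :
    ContDiffOn ℝ ∞ (fun y => chernForm τ S (H y) (curvOf θ y) k p) U := fun _ hz =>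
  (contDiffAt_chernForm (hH.contDiffAt (hU.mem_nhds hz))
    ((contDiffOn_curvOf hU hθ).contDiffAt (hU.mem_nhds hz)) k p).contDiffWithinAt

theorem mixedOf_add (H : A) (R : E [⋀^Fin 2]→L[ℝ] A) :
    ∀ p, mixedOf H R p = mixedOf 0 R p + mixedOf H (0 : E [⋀^Fin 2]→L[ℝ] A) p
  | 0 => by ext w; simp [mixedOf]
  | 1 => by ext w; simp [mixedOf]
  | 2 => by ext w; simp [mixedOf]
  | _ + 3 => by ext w; simp [mixedOf]

theorem mixedOf_add_left (H H' : A) :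
    ∀ p, mixedOf (H + H') (0 : E [⋀^Fin 2]→L[ℝ] A) p = mixedOf H 0 p + mixedOf H' 0 p
  | 0 => by ext w; simp [mixedOf]
  | 1 => by ext w; simp [mixedOf]
  | 2 => by ext w; simp [mixedOf]
  | _ + 3 => by ext w; simp [mixedOf]

theorem mixedOf_smul_left (c : ℝ) (H : A) :
    ∀ p, mixedOf (c • H) (0 : E [⋀^Fin 2]→L[ℝ] A) p = c • mixedOf H 0 p
  | 0 => by ext w; simp [mixedOf]
  | 1 => by ext w; simp [mixedOf]
  | 2 => by ext w; simp [mixedOf]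
  | _ + 3 => by ext w; simp [mixedOf]

/-- The form `S (H v + R)` is affine in `v`, with constant part `c` and linear part `L`, so
induction on the power with `IsPolynomialMap.mul_affine` applies. The point and the degree stay
inside the target space, so a single polynomial serves for all of them. -/
theorem isPolynomialMap_chernForm {V Y : Type*} [AddCommGroup V] [Module ℝ V] (τ : A →L[ℝ] B)
    (S : A →L[ℝ] A) (H : V →ₗ[ℝ] (Y → A)) (R : Y → E [⋀^Fin 2]→L[ℝ] A) (k : ℕ) :
    IsPolynomialMap (fun (v : V) (p : ℕ) (y : Y) => chernForm τ S (H v y) (R y) k p) := by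
  let T : (Y → (p : ℕ) → E [⋀^Fin p]→L[ℝ] A) →ₗ[ℝ] ((p : ℕ) → Y → E [⋀^Fin p]→L[ℝ] B) :=
    { toFun := fun a p y => τ.compContinuousAlternatingMap (a y p)
      map_add' := fun a b => by funext p y; ext w; exact map_add τ _ _
      map_smul' := fun c a => by funext p y; ext w; exact map_smul τ _ _ }
  let Bm : (Y → (p : ℕ) → E [⋀^Fin p]→L[ℝ] A) →ₗ[ℝ] (Y → (p : ℕ) → E [⋀^Fin p]→L[ℝ] A) →ₗ[ℝ]
      (Y → (p : ℕ) → E [⋀^Fin p]→L[ℝ] A) :=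
    LinearMap.mk₂ ℝ (fun a b y => mulMixedL (a y) (b y))
      (fun a a' b => by funext y; simp) (fun c a b => by funext y; simp)
      (fun a b b' => by funext y; simp) (fun c a b => by funext y; simp)
  let c : Y → (p : ℕ) → E [⋀^Fin p]→L[ℝ] A := fun y p =>
    S.compContinuousAlternatingMap (mixedOf 0 (R y) p)
  let L : V →ₗ[ℝ] (Y → (p : ℕ) → E [⋀^Fin p]→L[ℝ] A) :=
    { toFun := fun v y p => S.compContinuousAlternatingMap (mixedOf (H v y) 0 p)
      map_add' := fun v v' => by
        funext y p
        rw [map_add, Pi.add_apply, mixedOf_add_left]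
        ext w
        exact map_add S _ _
      map_smul' := fun r v => by
        funext y p
        rw [map_smul, Pi.smul_apply, mixedOf_smul_left]
        ext w
        exact map_smul S _ _ }
  have hcL : ∀ v y q, (c + L v) y q = S.compContinuousAlternatingMap (mixedOf (H v y) (R y) q) := by
    intro v y q
    rw [mixedOf_add]
    ext w
    exact (map_add S _ _).symm
  have hpow : IsPolynomialMap (fun (v : V) (y : Y) =>
      powMixed (fun q => S.compContinuousAlternatingMap (mixedOf (H v y) (R y) q)) k) := by
    induction k with
    | zero =>
      exact isPolynomialMap_const (V := V) (W := Y → (p : ℕ) → E [⋀^Fin p]→L[ℝ] A)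
        fun _ => powMixed (fun _ => 0) 0
    | succ k ih =>
      have h := ih.mul_affine Bm c L
      have e : (fun v => Bm (fun y => powMixed (fun q =>
          S.compContinuousAlternatingMap (mixedOf (H v y) (R y) q)) k) (c + L v))
          = fun (v : V) (y : Y) => powMixed (fun q =>
            S.compContinuousAlternatingMap (mixedOf (H v y) (R y) q)) (k + 1) := by
        funext v y
        change mulMixed _ ((c + L v) y) = mulMixed _ _
        rw [funext (hcL v y)]
      rw [← e]
      exact h
  exact hpow.comp_linear T

end ChernForm

/-! ### The scalar i/2π and the normalised trace. -/

section Scalar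

variable {n : ℕ}

/-- Multiplication by `i / 2π`. -/
def scaleCLM (n : ℕ) : EndC n →L[ℝ] EndC n :=
  (Complex.I / (2 * Real.pi) : ℂ) • ContinuousLinearMap.id ℝ (EndC n)

theorem scaleCLM_mul_left (x y : EndC n) : scaleCLM n (x * y) = x * scaleCLM n y :=
  (mul_smul_comm (Complex.I / (2 * Real.pi) : ℂ) x y).symm

theorem scaleCLM_mul_right (x y : EndC n) : scaleCLM n (x * y) = scaleCLM n x * y :=
  (smul_mul_assoc (Complex.I / (2 * Real.pi) : ℂ) x y).symm

/-- The trace divided by `k!`. -/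
def traceFactorial (n k : ℕ) : EndC n →L[ℝ] ℂ := (1 / (k.factorial : ℂ)) • traceCLM n

theorem traceCLM_conj (c x d : EndC n) (hdc : d * c = 1) :
    traceCLM n (c * x * d) = traceCLM n x := by
  have h : ∀ a b : EndC n, traceCLM n (a * b) = traceCLM n (b * a) := fun a b =>
    LinearMap.trace_mul_comm ℂ (a : Cn n →ₗ[ℂ] Cn n) (b : Cn n →ₗ[ℂ] Cn n)
  rw [h, ← mul_assoc, hdc, one_mul]

theorem traceFactorial_conj (k : ℕ) (c x d : EndC n) (_ : c * d = 1) (hdc : d * c = 1) :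
    traceFactorial n k (c * x * d) = traceFactorial n k x :=
  congrArg (fun a => (1 / (k.factorial : ℂ)) • a) (traceCLM_conj c x d hdc)

theorem traceCLM_smul (c : ℂ) (x : EndC n) : traceCLM n (c • x) = c • traceCLM n x :=
  map_smul (LinearMap.trace ℂ (Cn n)) c (x : Cn n →ₗ[ℂ] Cn n)

end Scalar

/-! ### The equivariant Chern character on the manifold. -/

section Manifold

variable {EK : Type*} [NormedAddCommGroup EK] [NormedSpace ℝ EK]
  {K : Type*} [TopologicalSpace K] [ChartedSpace EK K] [Group K]
  {n : ℕ} {X : Type*} [TopologicalSpace X] [ChartedSpace (Cn n) X] [MulAction K X]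

omit [TopologicalSpace X] [ChartedSpace (Cn n) X] in
theorem curvPlus_eq (R : X → Cn n [⋀^Fin 2]→L[ℝ] EndC n) (H : X → EndC n) (x : X) :
    ∀ p, curvPlus R H x p = mixedOf (H x) (R x) p
  | 0 => rfl
  | 1 => rfl
  | 2 => rfl
  | _ + 3 => rfl

omit [MulAction K X] in
theorem eqChernCharacter_eq (Θ : X → Cn n → Cn n →L[ℝ] EndC n)
    (σ : LieAlg (EK := EK) K → X → EndC n) (k : ℕ) (v : LieAlg (EK := EK) K) (p : ℕ) (x : X) :
    eqChernCharacter Θ σ k v p x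
      = chernForm (traceFactorial n k) (scaleCLM n) (σ v x) (curvature Θ x) k p := by
  have e : (fun q => (Complex.I / (2 * Real.pi) : ℂ) • curvPlus (curvature Θ) (σ v) x q)
      = fun q => (scaleCLM n).compContinuousAlternatingMap (mixedOf (σ v x) (curvature Θ x) q) := by
    funext q
    rw [curvPlus_eq]
    rfl
  rw [eqChernCharacter, e]
  ext w
  exact traceCLM_smul _ _

variable [IsManifold 𝓘(ℂ, Cn n) ∞ X] {Ω : X → Cn n [⋀^Fin 2]→L[ℝ] ℝ}
  {σ : LieAlg (EK := EK) K → X → EndC n}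

omit [MulAction K X] in
theorem formInChart_eqChernCharacter (hΩ : IsKahlerForm Ω) (k : ℕ) (v : LieAlg (EK := EK) K)
    (p : ℕ) (x : X) {z : Cn n} (hz : z ∈ (chartAt (Cn n) x).target) :
    formInChart (eqChernCharacter (chernConnection Ω) σ k v p) x z
      = chernForm (traceFactorial n k) (scaleCLM n) (endInChart (σ v) x z)
        (curvOf (chernConnection Ω x) z) k p := by
  rw [formInChart, eqChernCharacter_eq, ← hΩ.curvOf_chern x hz, endInChart,
    chernForm_transport scaleCLM_mul_left scaleCLM_mul_right (traceFactorial_conj k) _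
      (coframe_mul_frame x hz) (frame_mul_coframe x hz)]

theorem isSmoothForm_eqChernCharacter (hΩ : IsKahlerForm Ω)
    (hσ : IsBundleMomentMap (chernConnection Ω) σ) (k : ℕ) (v : LieAlg (EK := EK) K) (p : ℕ) :
    IsSmoothForm (eqChernCharacter (chernConnection Ω) σ k v p) := by
  intro x
  refine ContDiffOn.congr ?_ fun z hz => formInChart_eqChernCharacter hΩ k v p x hz
  exact contDiffOn_chernForm_curvOf (chartAt (Cn n) x).open_target (hσ.smooth v x)
    (hΩ.contDiffOn_chern x) k p

/-- The differential of `k` is complex-linear and invertible. It relates both H and R at `x` and `k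
• x` by the same conjugation, combined with pull-back for R. -/
theorem eqChernCharacter_smul (hΩ : IsKahlerForm Ω)
    (hk : ∀ k : K, IsKahlerMap Ω (fun x : X => k • x))
    (hσ : IsBundleMomentMap (chernConnection Ω) σ) (j : ℕ) (k : K) (v : LieAlg (EK := EK) K)
    (p : ℕ) (x : X) :
    (eqChernCharacter (chernConnection Ω) σ j (Ad k v) p (k • x)).compContinuousLinearMap (actD k x)
      = eqChernCharacter (chernConnection Ω) σ j v p x := by
  obtain ⟨f, L, U, h, hzU, hfz, hLz, hf, -⟩ := exists_smul_chartMap hΩ (hk k) x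
  obtain ⟨ℓ, hℓ⟩ := h.isUnit _ hzU
  have hL : actD k x = (ℓ : EndC n).restrictScalars ℝ := by
    ext1 u
    rw [hℓ]
    exact (hLz u).symm
  have h1 : σ v x = (↑ℓ⁻¹ : EndC n) * σ (Ad k v) (k • x) * ℓ := by
    have e : (ℓ : EndC n) * σ v x = σ (Ad k v) (k • x) * ℓ := by
      refine ContinuousLinearMap.ext fun u => ?_
      have := hσ.equivariant k v x u
      rw [hL] at this
      exact this.symm
    rw [mul_assoc, ← e, ← mul_assoc, Units.inv_mul, one_mul]
  have h2 : curvature (chernConnection Ω) x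
      = transport (actD k x) (↑ℓ⁻¹ : EndC n) ℓ (curvature (chernConnection Ω) (k • x)) := by
    refine ext_twoForm fun u w => ?_
    have e := h.curvOf_eq hΩ hzU u w
    rw [hfz, hLz, hLz, ← hℓ] at e
    have e' := congrArg (fun T => (↑ℓ⁻¹ : EndC n) * T) e
    simp only [← mul_assoc, Units.inv_mul, one_mul] at e'
    refine e'.trans ?_
    rw [transport_apply]
    congr 3
    funext i
    fin_cases i <;> rfl
  rw [eqChernCharacter_eq, eqChernCharacter_eq, h1, h2,
    chernForm_transport scaleCLM_mul_left scaleCLM_mul_right (traceFactorial_conj j) _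
      (Units.inv_mul ℓ) (Units.mul_inv ℓ)]

theorem isEquivariantForm_eqChernCharacter (hΩ : IsKahlerForm Ω)
    (hk : ∀ k : K, IsKahlerMap Ω (fun x : X => k • x))
    (hσ : IsBundleMomentMap (chernConnection Ω) σ) (k : ℕ) :
    IsEquivariantForm (eqChernCharacter (chernConnection Ω) σ k) := by
  refine ⟨isSmoothForm_eqChernCharacter hΩ hσ k, ?_, fun g v p x =>
    eqChernCharacter_smul hΩ hk hσ k g v p x⟩
  let H : LieAlg (EK := EK) K →ₗ[ℝ] (X → EndC n) :=
    { toFun := σ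
      map_add' := fun v w => funext fun x => hσ.map_add v w x
      map_smul' := fun c v => funext fun x => (hσ.map_smul c v x).trans
        (ContinuousLinearMap.ext fun u => Complex.coe_smul c (σ v x u)) }
  have e : eqChernCharacter (chernConnection Ω) σ k = fun v p x =>
      chernForm (traceFactorial n k) (scaleCLM n) (H v x) (curvature (chernConnection Ω) x) k p := by
    funext v p x
    exact eqChernCharacter_eq _ σ k v p x
  rw [e]
  exact isPolynomialMap_chernForm _ _ _ _ k

theorem eqD_eqChernCharacter (hΩ : IsKahlerForm Ω)
    (hσ : IsBundleMomentMap (chernConnection Ω) σ) (k : ℕ) (v : LieAlg (EK := EK) K) (p : ℕ)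
    (x : X) : eqD (eqChernCharacter (chernConnection Ω) σ k) v p x = 0 := by
  have ho := (chartAt (Cn n) x).open_target
  have hz := mem_chart_target (Cn n) x
  have hm : ∀ u, curvOf (chernConnection Ω x) (chartAt (Cn n) x x) ![fund v x, u]
      = -(fderiv ℝ (endInChart (σ v) x) (chartAt (Cn n) x x) u
        + (chernConnection Ω x (chartAt (Cn n) x x) u * endInChart (σ v) x (chartAt (Cn n) x x)
          - endInChart (σ v) x (chartAt (Cn n) x x)
            * chernConnection Ω x (chartAt (Cn n) x x) u)) := by
    intro u
    rw [endInChart_self]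
    exact hσ.moment v x u
  have h := eqDAt_powMixed_curvOf ho hz (hΩ.contDiffOn_chern x) (hσ.smooth v x) hm
    scaleCLM_mul_left scaleCLM_mul_right (traceFactorial_conj k) k p
  have hc : ∀ q, formInChart (eqChernCharacter (chernConnection Ω) σ k v q) x
      =ᶠ[𝓝 (chartAt (Cn n) x x)] fun z => chernForm (traceFactorial n k) (scaleCLM n)
        (endInChart (σ v) x z) (curvOf (chernConnection Ω x) z) k q := fun q =>
    Filter.eventually_of_mem (ho.mem_nhds hz) fun z hz =>
      formInChart_eqChernCharacter hΩ k v q x hz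
  have hc' : ∀ q, eqChernCharacter (chernConnection Ω) σ k v q x
      = chernForm (traceFactorial n k) (scaleCLM n) (endInChart (σ v) x (chartAt (Cn n) x x))
        (curvOf (chernConnection Ω x) (chartAt (Cn n) x x)) k q := fun q => by
    rw [← formInChart_eqChernCharacter hΩ k v q x hz, formInChart_self]
  cases p with
  | zero =>
    change (eqChernCharacter (chernConnection Ω) σ k v 1 x).curryLeft (fund v x) = 0
    rw [hc']
    exact h
  | succ p =>
    change extDeriv (formInChart (eqChernCharacter (chernConnection Ω) σ k v p) x) _
      + (eqChernCharacter (chernConnection Ω) σ k v (p + 2) x).curryLeft (fund v x) = 0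
    rw [hc', (hc p).extDeriv_eq]
    exact h

end Manifold

end KahlerMoment
end

/-! ### The theorem. -/

theorem mainTheorem4
    {EK : Type*} [NormedAddCommGroup EK] [NormedSpace ℝ EK] [FiniteDimensional ℝ EK]
    {K : Type*} [TopologicalSpace K] [T2Space K] [CompactSpace K] [ChartedSpace EK K] [Group K]
    [LieGroup 𝓘(ℝ, EK) ∞ K]
    {n : ℕ} {X : Type*} [TopologicalSpace X] [T2Space X] [SecondCountableTopology X]
    [ChartedSpace (KahlerMoment.Cn n) X] [IsManifold 𝓘(ℂ, KahlerMoment.Cn n) ∞ X]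
    [MulAction K X]
    (hact : ContMDiff ((𝓘(ℝ, EK)).prod 𝓘(ℝ, KahlerMoment.Cn n)) 𝓘(ℝ, KahlerMoment.Cn n) ∞
      (fun p : K × X => p.1 • p.2))
    (Ω : X → KahlerMoment.Cn n [⋀^Fin 2]→L[ℝ] ℝ)
    (hΩ : KahlerMoment.IsKahlerForm Ω)
    (hsymplectic : ∀ (k : K) (x : X) (u w : KahlerMoment.Cn n),
      Ω (k • x) ![KahlerMoment.actD k x u, KahlerMoment.actD k x w] = Ω x ![u, w])
    (hisometry : ∀ (k : K) (x : X) (u w : KahlerMoment.Cn n),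
      Ω (k • x) ![KahlerMoment.actD k x u, Complex.I • KahlerMoment.actD k x w]
        = Ω x ![u, Complex.I • w])
    (μ : X → Module.Dual ℝ (KahlerMoment.LieAlg (EK := EK) K))
    (hμ : KahlerMoment.IsMomentMap Ω μ) :
    KahlerMoment.IsInvariantConnection K (KahlerMoment.chernConnection Ω) ∧
    KahlerMoment.IsBundleMomentMap (KahlerMoment.chernConnection Ω)
      (fun v => KahlerMoment.metricHessian Ω (fun x => μ x v)) ∧
    ∀ k : ℕ,
      KahlerMoment.IsEquivariantForm
        (KahlerMoment.eqChernCharacter (KahlerMoment.chernConnection Ω)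
          (fun v : KahlerMoment.LieAlg (EK := EK) K =>
            KahlerMoment.metricHessian Ω (fun x => μ x v)) k) ∧
      ∀ (v : KahlerMoment.LieAlg (EK := EK) K) (p : ℕ) (x : X),
        KahlerMoment.eqD
          (KahlerMoment.eqChernCharacter (KahlerMoment.chernConnection Ω)
            (fun v : KahlerMoment.LieAlg (EK := EK) K =>
              KahlerMoment.metricHessian Ω (fun x => μ x v)) k) v p x = 0 := by
  have hk := KahlerMoment.isKahlerMap_smul hΩ (KahlerMoment.contMDiff_smul_left hact) hsymplectic
    hisometry
  have hσ := KahlerMoment.isBundleMomentMap_metricHessian hΩ hact hk hμ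
  exact ⟨KahlerMoment.isInvariantConnection_chern hΩ hk, hσ, fun k =>
    ⟨KahlerMoment.isEquivariantForm_eqChernCharacter hΩ hk hσ k,
      KahlerMoment.eqD_eqChernCharacter hΩ hσ k⟩⟩
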